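/- **Setting.** Let $N\ge 1$, let $\Omega\subset\mathbb R^N$ be a bounded domain (open, connected, nonempty; Lipschitz regularity of $\partial\Omega$ is not needed) and let $T>0$. Let $P\in C[0,\infty)$ with $P(0)=0$ and $0<P(s)<c_3<\infty$ for $s>0$; let $h\in C(0,\infty)$ be positive and integrable at $0$; assume that $F:=hP$ satisfies $F(0)=0$ and is differentiable on $(0,\infty)$ with $F'>0$ locally bounded on $(0,\infty)$. Put $H(u)=\int_0^u h(s)\,ds$ and, for $\epsilon>0$, $\tilde H(u)=\int_\epsilon^u\sqrt{\frac{h(s)}{F(s)+\epsilon}}\,ds$. Let $g\in W^{1,2}(\Omega)$, $g\ge0$ in $\Omega$, and $\psi\ge0$ on $\partial\Omega$. A classical solution is a function $u^\epsilon\in C^{2,1}_{x,t}(\Omega\times(0,T])\cap C(\overline\Omega\times[0,T])$ with $$\begin{cases}\partial_t\big(H(u^\epsilon)\big)-\big(F(u^\epsilon)+\epsilon\big)\Delta u^\epsilon=0 & \text{in }\Omega\times(0,T],\\ u^\epsilon(x,0)=\epsilon+g(x) & \text{in }\Omega,\\ u^\epsilon(x,t)=\epsilon\,\psi(x) & \text{on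 }\partial\Omega\times(0,T].\end{cases}$$ **Theorem.** There is a constant $C=C(\Omega,T)>0$, depending only on $\Omega$ and $T$, such that for all $h,P,\epsilon,K,g,\psi$ as above and every classical solution $u^\epsilon$ with $0<\epsilon\le u^\epsilon\le K<\infty$ in $\Omega\times(0,T]$ the following holds. For every $0<\tau\le T$, $$2\int_0^\tau\!\!\int_\Omega\big[\partial_t\tilde H(u^\epsilon)\big]^2\,dx\,dt+\int_\Omega|\nabla u^\epsilon(x,\tau)|^2\,dx=\int_\Omega|\nabla g(x)|^2\,dx,$$ and $$\int_0^T\!\!\int_\Omega\big[\partial_t\tilde H(u^\epsilon)\big]^2dx\,dt+\int_0^T\!\!\int_\Omega|\nabla u^\epsilon|^2dx\,dt+\int_0^T\!\!\int_\Omega|u^\epsilon|^2dx\,dt\le C(\Omega,T)\Big[\int_\Omega|\nabla g|^2dx+K^2\int_{\partial\Omega}|\psi|^2\,ds\Big],$$ where $\nabla g$ is the weak gradient and $ds$ is the $(N-1)$-dimensional Hausdorff measure (the surface measure when $\partial\Omega$ is Lipschitz; the boundary integral may be $+\infty$ for an irregular boundary). -/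

import Mathlib

open MeasureTheory Set Filter Topology
open scoped ENNReal ContDiff

namespace DegenerateEinstein

/-- The coefficient `F = h P`. -/
noncomputable def coeffF (h P : ℝ → ℝ) (s : ℝ) : ℝ := h s * P s

/-- `H(u) = ∫₀ᵘ h(s) ds`. -/
noncomputable def primH (h : ℝ → ℝ) (u : ℝ) : ℝ := ∫ s in (0 : ℝ)..u, h s

/-- `H̃(u) = ∫_ε^u √(h(s) / (F(s) + ε)) ds`. -/
noncomputable def primHtilde (h P : ℝ → ℝ) (ε u : ℝ) : ℝ :=
  ∫ s in ε..u, Real.sqrt (h s / (coeffF h P s + ε))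

/-- The structural conditions on `P` and `h`: `P` is continuous on `[0, ∞)`, vanishes at `0` and is
positive and bounded on `(0, ∞)`; `h` is positive and continuous on `(0, ∞)` and integrable at `0`;
`F = h P` vanishes at `0` and is differentiable on `(0, ∞)` with positive, locally bounded
derivative. -/
structure Admissible (h P : ℝ → ℝ) : Prop where
  P_continuous : ContinuousOn P (Ici 0)
  P_zero : P 0 = 0
  P_pos : ∀ s, 0 < s → 0 < P s
  P_bounded : ∃ c : ℝ, ∀ s, 0 < s → P s < c
  h_pos : ∀ s, 0 < s → 0 < h s
  h_continuous : ContinuousOn h (Ioi 0)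
  h_integrable : IntegrableAtFilter h (𝓝[>] 0) volume
  F_zero : coeffF h P 0 = 0
  F_differentiable : ∀ s, 0 < s → DifferentiableAt ℝ (coeffF h P) s
  F_deriv_pos : ∀ s, 0 < s → 0 < deriv (coeffF h P) s
  F_deriv_locallyBounded :
    ∀ a b : ℝ, 0 < a → ∃ C : ℝ, ∀ s ∈ Icc a b, |deriv (coeffF h P) s| ≤ C

variable {N : ℕ}

/-- The time derivative of `v : Ω × (0, T] → ℝ` (one-sided at `t = T`). -/
noncomputable def timeDeriv (T : ℝ) (v : EuclideanSpace ℝ (Fin N) → ℝ → ℝ)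
    (x : EuclideanSpace ℝ (Fin N)) (t : ℝ) : ℝ :=
  derivWithin (v x) (Ioc 0 T) t

/-- The gradient in the space variable. -/
noncomputable def spaceGrad (v : EuclideanSpace ℝ (Fin N) → ℝ → ℝ)
    (x : EuclideanSpace ℝ (Fin N)) (t : ℝ) : EuclideanSpace ℝ (Fin N) :=
  gradient (fun y => v y t) x

/-- The Laplacian in the space variable. -/
noncomputable def spaceLaplacian (v : EuclideanSpace ℝ (Fin N) → ℝ → ℝ)
    (x : EuclideanSpace ℝ (Fin N)) (t : ℝ) : ℝ :=
  Laplacian.laplacian (fun y => v y t) x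

/-- `v ∈ C^{2,1}_{x,t}(Ω × (0, T])`: the space derivatives of order at most two and the time
derivative of order one exist and are jointly continuous on `Ω × (0, T]`. -/
structure IsC21 (Ω : Set (EuclideanSpace ℝ (Fin N))) (T : ℝ)
    (v : EuclideanSpace ℝ (Fin N) → ℝ → ℝ) : Prop where
  space : ∀ t ∈ Ioc 0 T, ContDiffOn ℝ 2 (fun y => v y t) Ω
  time : ∀ x ∈ Ω, DifferentiableOn ℝ (v x) (Ioc 0 T)
  continuous : ContinuousOn (fun p : EuclideanSpace ℝ (Fin N) × ℝ => v p.1 p.2) (Ω ×ˢ Ioc 0 T)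
  continuous_grad :
    ContinuousOn (fun p : EuclideanSpace ℝ (Fin N) × ℝ => spaceGrad v p.1 p.2) (Ω ×ˢ Ioc 0 T)
  continuous_hess :
    ContinuousOn (fun p : EuclideanSpace ℝ (Fin N) × ℝ =>
      iteratedFDeriv ℝ 2 (fun y => v y p.2) p.1) (Ω ×ˢ Ioc 0 T)
  continuous_time :
    ContinuousOn (fun p : EuclideanSpace ℝ (Fin N) × ℝ => timeDeriv T v p.1 p.2) (Ω ×ˢ Ioc 0 T)

/-- `g ∈ W^{1,2}(Ω)` with weak gradient `Dg`. -/
structure IsW12 (Ω : Set (EuclideanSpace ℝ (Fin N))) (g : EuclideanSpace ℝ (Fin N) → ℝ)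
    (Dg : EuclideanSpace ℝ (Fin N) → EuclideanSpace ℝ (Fin N)) : Prop where
  memLp : MemLp g 2 (volume.restrict Ω)
  memLp_grad : MemLp Dg 2 (volume.restrict Ω)
  weak_grad : ∀ φ : EuclideanSpace ℝ (Fin N) → ℝ,
    ContDiff ℝ ∞ φ → HasCompactSupport φ → tsupport φ ⊆ Ω →
      ∫ x in Ω, g x • gradient φ x = -∫ x in Ω, φ x • Dg x

/-- `u` is a classical solution, i.e. `u ∈ C^{2,1}_{x,t}(Ω × (0, T]) ∩ C(Ω̄ × [0, T])`, of
`H_t(u) - (F(u) + ε) Δu = 0` in `Ω × (0, T]`, `u(x, 0) = ε + g(x)` in `Ω`,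
`u(x, t) = ε ψ(x)` on `∂Ω × (0, T]`. -/
structure IsClassicalSolution (h P : ℝ → ℝ) (Ω : Set (EuclideanSpace ℝ (Fin N))) (T ε : ℝ)
    (g ψ : EuclideanSpace ℝ (Fin N) → ℝ) (u : EuclideanSpace ℝ (Fin N) → ℝ → ℝ) : Prop where
  regular : IsC21 Ω T u
  continuous : ContinuousOn (fun p : EuclideanSpace ℝ (Fin N) × ℝ => u p.1 p.2)
    (closure Ω ×ˢ Icc 0 T)
  equation : ∀ x ∈ Ω, ∀ t ∈ Ioc 0 T,
    timeDeriv T (fun y s => primH h (u y s)) x t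
      - (coeffF h P (u x t) + ε) * spaceLaplacian u x t = 0
  initial : ∀ x ∈ Ω, u x 0 = ε + g x
  boundary : ∀ x ∈ frontier Ω, ∀ t ∈ Ioc 0 T, u x t = ε * ψ x

end DegenerateEinstein

/-!
Write `a = h / (F + ε)`, so that the equation is the filtration equation `a(u) ∂ₜu = Δu` and
`(∂ₜ H̃(u))² = a(u) (∂ₜu)²`, and let `E(t) = ∫_Ω |∇u(t)|²` for `t > 0` and `E(0) = ∫_Ω |∇g|²`.
Formally `E' = -2 ∫_Ω a(u) (∂ₜu)²`, which is the energy identity; but `u` is only continuous up to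
the lateral boundary and up to the initial time, the boundary is arbitrary, and nothing is known
about `∇∂ₜu`. The argument below tests the equation with differences of two time slices only. These
vanish on the lateral boundary, and their truncation `trunc n` has compact support in `Ω`, so Green's
identity holds for them without boundary regularity (`IsZeroTrace.setIntegral_laplacian_mul_trunc`).
When the truncation is removed, the zero set of a difference does no harm, because the gradient of
the difference vanishes there almost everywhere (`IsZeroTrace.ae_grad_eq_zero`).

Testing with `u(r) - u(s)` and integrating over `r ∈ (s, t]` gives the fundamental inequality
`∫_s^t E + 2 ∫_Ω Φ(u(s), u(t)) ≤ (t - s) E(s)` with `Φ(p, q) = ∫_p^q a(ρ) (ρ - p) dρ ≥ 0`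
(`IsFiltration.lintegral_energy_add_potential_le`), also for `s = 0`. Since `E` is lower
semicontinuous, it follows that `E` is nonincreasing on `[0, T]` (`IsFiltration.energy_antitoneOn`).
Averaged over `s`, the inequality with `t = s + η` yields `2 ∬ a(u) (∂ₜu)² + E(τ) ≤ E(0)` as `η → 0`,
because `Φ(p, q)` behaves like `a(p) (q - p)² / 2` (`IsFiltration.dissipation_add_energy_le`).

For the converse, convexity gives `E(s) ≤ E(t) + 2 ∫_Ω Δu(s) (u(t) - u(s))`. With `t = s + η` and
Young's inequality, the mean of `E` over `(0, η)` is at most `E(τ) + (2 + o(1)) ∬ a(u) (∂ₜu)²`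
(`IsFiltration.energy_le_add_dissipation_of_pos`). Hence `E(t) ≤ E(τ) + 2 ∬ a(u) (∂ₜu)²` for all
`t > 0`, and the bound passes to `t = 0` because `u(t) → g + ε` uniformly, with fixed boundary
values (`IsFiltration.energy_zero_le`).

The identity bounds the first two terms of the a priori estimate by `(1 + T) E(0)`. On the boundary
`ε ψ = u ≥ ε`, so `ψ ≥ 1` there, and `∬ u² ≤ T |Ω| K²` is at most a multiple of `K² ∫_{∂Ω} ψ²`, since
the boundary of a bounded open set has positive surface measure
(`euclideanHausdorffMeasure_frontier_pos`).
-/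

namespace DegenerateEinstein

/-! ### Mollification and the truncated chain rule -/

section Sobolev

variable {E : Type*} [NormedAddCommGroup E] [InnerProductSpace ℝ E] [FiniteDimensional ℝ E]
  [MeasurableSpace E] [BorelSpace E] {μ : Measure E} [μ.IsAddHaarMeasure]

open ContinuousLinearMap in
lemma fderiv_convolution_apply {k w : E → ℝ} (hk : ContDiff ℝ 1 k) (hks : HasCompactSupport k)
    (hw : Continuous w) (x e : E) :
    fderiv ℝ (convolution k w (lsmul ℝ ℝ) μ) x e = ∫ y, fderiv ℝ k (x - y) e * w y ∂μ := by
  rw [(hks.hasFDerivAt_convolution_left (lsmul ℝ ℝ) hk hw.locallyIntegrable x).fderiv,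
    convolution_eq_swap, ContinuousLinearMap.integral_apply]
  · simp [precompL_apply]
  · have hc : Continuous fun t : E => ((lsmul ℝ ℝ).precompL E) (fderiv ℝ k (x - t)) (w t) := by
      have := hk.continuous_fderiv (by simp)
      fun_prop
    refine hc.integrable_of_hasCompactSupport ?_
    have h1 : HasCompactSupport fun t : E => fderiv ℝ k (x - t) :=
      (hks.fderiv ℝ).comp_homeomorph (Homeomorph.subLeft x)
    refine h1.mono fun t ht => ?_
    contrapose! ht
    simp only [Function.mem_support, ne_eq, not_not] at ht ⊢
    simp [ht]

open ContinuousLinearMap in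
/-- Convolution with an even kernel is symmetric, and the derivative of the kernel is odd. -/
lemma integral_mul_fderiv_convolution {k w θ : E → ℝ} (hk : ContDiff ℝ 1 k)
    (hks : HasCompactSupport k) (hkn : ∀ x, k (-x) = k x) (hw : Continuous w)
    (hws : HasCompactSupport w) (hθ : Continuous θ) (hθs : HasCompactSupport θ) (e : E) :
    ∫ x, θ x * fderiv ℝ (convolution k w (lsmul ℝ ℝ) μ) x e ∂μ
      = -∫ y, fderiv ℝ (convolution k θ (lsmul ℝ ℝ) μ) y e * w y ∂μ := by
  have hodd : ∀ x, fderiv ℝ k (-x) e = -fderiv ℝ k x e := by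
    intro x
    have h1 : (fun y => k (-y)) = k := funext hkn
    have h2 : HasFDerivAt (fun y => k (-y)) ((fderiv ℝ k (-x)).comp (-ContinuousLinearMap.id ℝ E)) x :=
      ((hk.differentiable (by simp)) (-x)).hasFDerivAt.comp x (hasFDerivAt_id x).neg
    rw [h1] at h2
    rw [h2.fderiv]; simp
  simp_rw [fderiv_convolution_apply hk hks hw, fderiv_convolution_apply hk hks hθ,
    ← integral_const_mul, ← integral_mul_const]
  rw [integral_integral_swap_of_hasCompactSupport]
  · rw [← integral_neg]
    congr 1; ext y
    rw [← integral_neg]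
    congr 1; ext x
    rw [← neg_sub y x, hodd]; ring
  · have := hk.continuous_fderiv (by simp)
    simp only [Function.uncurry_def]
    fun_prop
  · have : IsCompact (tsupport θ ×ˢ tsupport w) := hθs.prod hws
    refine HasCompactSupport.intro this fun p hp => ?_
    simp only [mem_prod, not_and_or] at hp
    rcases hp with hp | hp <;> simp [Function.uncurry_def, image_eq_zero_of_notMem_tsupport hp]

omit [FiniteDimensional ℝ E] [MeasurableSpace E] [BorelSpace E] in
lemma hasCompactSupport_fderiv_apply {f : E → ℝ} (hf : HasCompactSupport f) (e : E) :
    HasCompactSupport fun x => fderiv ℝ f x e :=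
  (hf.fderiv ℝ).mono fun t ht => by
    contrapose! ht
    simp only [Function.mem_support, ne_eq, not_not] at ht ⊢
    simp [ht]

/-- The mollification `ρ ⋆ f` of `f` by a normalized bump function `ρ`. -/
noncomputable def mollify (μ : Measure E) (ρ : ContDiffBump (0 : E)) (f : E → ℝ) : E → ℝ :=
  convolution (ρ.normed μ) f (ContinuousLinearMap.lsmul ℝ ℝ) μ

section Mollify

variable (μ) (ρ : ContDiffBump (0 : E))

lemma contDiff_mollify {f : E → ℝ} (hf : Continuous f) : ContDiff ℝ ∞ (mollify μ ρ f) :=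
  ρ.hasCompactSupport_normed.contDiff_convolution_left _ ρ.contDiff_normed hf.locallyIntegrable

lemma hasCompactSupport_mollify {f : E → ℝ} (hf : HasCompactSupport f) :
    HasCompactSupport (mollify μ ρ f) :=
  ρ.hasCompactSupport_normed.convolution _ hf

lemma dist_mollify_le {f : E → ℝ} (hf : Continuous f) {x : E} {η : ℝ}
    (h : ∀ y ∈ Metric.ball x ρ.rOut, dist (f y) (f x) ≤ η) : dist (mollify μ ρ f x) (f x) ≤ η :=
  ρ.dist_normed_convolution_le hf.aestronglyMeasurable h

lemma norm_mollify_le {f : E → ℝ} (hf : Continuous f) {C : ℝ} (h : ∀ x, ‖f x‖ ≤ C) (x : E) :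
    ‖mollify μ ρ f x‖ ≤ C := by
  have h3 : dist (mollify μ ρ f x) 0 ≤ C :=
    dist_convolution_le ((norm_nonneg _).trans (h x))
      ρ.support_normed_eq.subset ρ.nonneg_normed ρ.integral_normed
      hf.aestronglyMeasurable fun y _ => by simpa using h y
  simpa using h3

open scoped Pointwise in
lemma tsupport_mollify_subset {f : E → ℝ} {K : Set E} (hK : IsCompact K) (hf : ∀ x ∉ K, f x = 0)
    {r : ℝ} (hr : ρ.rOut ≤ r) : tsupport (mollify μ ρ f) ⊆ Metric.cthickening r K := by
  refine closure_minimal ?_ Metric.isClosed_cthickening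
  refine (support_convolution_subset _).trans ?_
  rw [← hK.add_closedBall_zero (ρ.rOut_pos.le.trans hr), add_comm K]
  refine Set.add_subset_add ?_ ?_
  · rw [ρ.support_normed_eq]
    exact Metric.ball_subset_closedBall.trans (Metric.closedBall_subset_closedBall hr)
  · intro x hx
    by_contra h
    exact hx (hf x h)

lemma integral_mul_fderiv_mollify {w θ : E → ℝ} (hw : Continuous w)
    (hws : HasCompactSupport w) (hθ : Continuous θ) (hθs : HasCompactSupport θ) (e : E) :
    ∫ x, θ x * fderiv ℝ (mollify μ ρ w) x e ∂μ = -∫ y, fderiv ℝ (mollify μ ρ θ) y e * w y ∂μ :=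
  integral_mul_fderiv_convolution ρ.contDiff_normed ρ.hasCompactSupport_normed ρ.normed_neg
    hw hws hθ hθs e

lemma tendsto_mollify {ρ : ℕ → ContDiffBump (0 : E)}
    (hρ : Tendsto (fun n => (ρ n).rOut) atTop (𝓝 0)) {f : ℕ → E → ℝ} (hf : ∀ n, Continuous (f n))
    {x : E} {z : ℝ} (h : Tendsto (fun p : ℕ × E => f p.1 p.2) (atTop ×ˢ 𝓝 x) (𝓝 z)) :
    Tendsto (fun n => mollify μ (ρ n) (f n) x) atTop (𝓝 z) :=
  ContDiffBump.convolution_tendsto_right hρ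
    (Eventually.of_forall fun n => (hf n).aestronglyMeasurable) h tendsto_const_nhds

end Mollify

/-- The truncated chain rule for a Sobolev function vanishing on the boundary. If `w` is continuous,
vanishes off `Ω` and has the weak derivative `d` in the direction `e`, and if `S` vanishes near `0`,
then `S ∘ w` has compact support in `Ω` and weak derivative `(S' ∘ w) d`, tested here with
functions `ψ` that need not vanish near the boundary. -/
lemma integral_fderiv_mul_comp_of_weakDeriv {Ω : Set E} (hΩ : IsOpen Ω) {w d : E → ℝ} {e : E}
    (hw : Continuous w) (hws : HasCompactSupport w) (hw0 : ∀ x ∉ Ω, w x = 0)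
    (hd : LocallyIntegrableOn d Ω μ)
    (hweak : ∀ φ : E → ℝ, ContDiff ℝ ∞ φ → HasCompactSupport φ → tsupport φ ⊆ Ω →
      ∫ x, fderiv ℝ φ x e * w x ∂μ = -∫ x, φ x * d x ∂μ)
    {S S' : ℝ → ℝ} (hS : ∀ y, HasDerivAt S (S' y) y) (hS' : Continuous S') {δ : ℝ} (hδ : 0 < δ)
    (hSδ' : ∀ y, |y| ≤ δ → S' y = 0)
    {ψ : E → ℝ} (hψ : ContDiff ℝ 1 ψ) (hψs : HasCompactSupport ψ) :
    ∫ x, fderiv ℝ ψ x e * S (w x) ∂μ = -∫ x, ψ x * S' (w x) * d x ∂μ := by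
  have hSc : Continuous S := continuous_iff_continuousAt.2 fun y => (hS y).continuousAt
  set K : Set E := {x | δ / 2 ≤ |w x|} with hKdef
  have hK : IsCompact K := by
    refine hws.of_isClosed_subset (isClosed_le continuous_const hw.abs) fun x hx => ?_
    refine subset_tsupport _ ?_
    intro h0
    simp only [hKdef, mem_ofPred_eq, h0, abs_zero] at hx
    linarith
  have hKΩ : K ⊆ Ω := by
    intro x hx
    by_contra h
    simp only [hKdef, mem_ofPred_eq, hw0 x h, abs_zero] at hx
    linarith
  obtain ⟨r₀, hr₀, hr₀Ω⟩ := hK.exists_cthickening_subset_open hΩ hKΩ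
  have hwu : UniformContinuous w := hws.uniformContinuous_of_continuous hw
  obtain ⟨r₁, hr₁, hr₁w⟩ := Metric.uniformContinuous_iff.1 hwu (δ / 2) (by positivity)
  -- mollifiers with radius below `r₀` and `r₁`
  let ρ : ℕ → ContDiffBump (0 : E) := fun n =>
    ⟨min r₀ r₁ / (n + 2) / 2, min r₀ r₁ / (n + 2), by positivity, by
      have : 0 < min r₀ r₁ / ((n : ℝ) + 2) := by positivity
      linarith⟩
  have hρ : ∀ n, (ρ n).rOut = min r₀ r₁ / (n + 2) := fun n => rfl
  have hρlt : ∀ n, (ρ n).rOut < min r₀ r₁ := by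
    intro n
    rw [hρ, div_lt_iff₀ (by positivity)]
    have : 0 < min r₀ r₁ := by positivity
    nlinarith [(Nat.cast_nonneg n : (0 : ℝ) ≤ n)]
  have hρ0 : Tendsto (fun n => (ρ n).rOut) atTop (𝓝 0) := by
    simp only [hρ]
    exact tendsto_const_nhds.div_atTop
      (tendsto_atTop_add_const_right _ _ tendsto_natCast_atTop_atTop)
  obtain ⟨wn, hwn_def⟩ : ∃ wn : ℕ → E → ℝ, ∀ n, wn n = mollify μ (ρ n) w := ⟨_, fun _ => rfl⟩
  have hwn : ∀ n, ContDiff ℝ ∞ (wn n) := fun n => hwn_def n ▸ contDiff_mollify μ (ρ n) hw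
  have hwn_close : ∀ n x, dist (wn n x) (w x) ≤ δ / 2 := fun n x => hwn_def n ▸
    dist_mollify_le μ (ρ n) hw fun y hy =>
      (hr₁w ((Metric.mem_ball.1 hy).trans ((hρlt n).trans_le (min_le_right _ _)))).le
  have hwn_tend : ∀ x, Tendsto (fun p : ℕ × E => wn p.1 p.2) (atTop ×ˢ 𝓝 x) (𝓝 (w x)) := by
    intro x
    rw [Metric.tendsto_nhds]
    intro η hη
    obtain ⟨r, hr, hrw⟩ := Metric.uniformContinuous_iff.1 hwu (η / 2) (by positivity)
    have h1 : ∀ᶠ n in atTop, (ρ n).rOut < r := hρ0.eventually (gt_mem_nhds hr)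
    have h2 : ∀ᶠ y in 𝓝 x, dist (w y) (w x) < η / 2 :=
      Metric.tendsto_nhds.1 (hw.tendsto x) _ (by positivity)
    filter_upwards [h1.prod_mk h2] with p hp
    have h3 : dist (wn p.1 p.2) (w p.2) ≤ η / 2 := hwn_def p.1 ▸
      dist_mollify_le μ (ρ p.1) hw fun y hy =>
        (hrw ((Metric.mem_ball.1 hy).trans hp.1)).le
    calc dist (wn p.1 p.2) (w x) ≤ dist (wn p.1 p.2) (w p.2) + dist (w p.2) (w x) :=
          dist_triangle _ _ _
      _ < η := by linarith [hp.2]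
  have hoff : ∀ n, ∀ x ∉ K, |wn n x| ≤ δ := by
    intro n x hx
    simp only [hKdef, mem_ofPred_eq, not_le] at hx
    have := hwn_close n x
    rw [Real.dist_eq] at this
    calc |wn n x| = |(wn n x - w x) + w x| := by ring_nf
      _ ≤ |wn n x - w x| + |w x| := abs_add_le _ _
      _ ≤ δ := by linarith
  obtain ⟨θ, hθ_def⟩ : ∃ θ : ℕ → E → ℝ, ∀ n x, θ n x = ψ x * S' (wn n x) := ⟨_, fun _ _ => rfl⟩
  have hθ : ∀ n, Continuous (θ n) := fun n => by
    rw [funext (hθ_def n)]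
    exact hψ.continuous.mul (hS'.comp (hwn n).continuous)
  have hθK : ∀ n, ∀ x ∉ K, θ n x = 0 := fun n x hx => by
    rw [hθ_def, hSδ' _ (hoff n x hx), mul_zero]
  have hθs : ∀ n, HasCompactSupport (θ n) := fun n => HasCompactSupport.intro hK (hθK n)
  obtain ⟨φ, hφ_def⟩ : ∃ φ : ℕ → E → ℝ, ∀ n, φ n = mollify μ (ρ n) (θ n) := ⟨_, fun _ => rfl⟩
  have hφ : ∀ n, ContDiff ℝ ∞ (φ n) := fun n => hφ_def n ▸ contDiff_mollify μ (ρ n) (hθ n)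
  have hφsub : ∀ n, tsupport (φ n) ⊆ Metric.cthickening r₀ K := fun n => hφ_def n ▸
    tsupport_mollify_subset μ (ρ n) hK (hθK n) ((hρlt n).le.trans (min_le_left _ _))
  have hφs : ∀ n, HasCompactSupport (φ n) := fun n =>
    hφ_def n ▸ hasCompactSupport_mollify μ (ρ n) (hθs n)
  -- only the values of `d` on a compact neighbourhood of `K` in `Ω` matter
  set Q := Metric.cthickening r₀ K with hQ
  have hQc : IsCompact Q := hK.cthickening
  have hKQ : K ⊆ Q := Metric.self_subset_cthickening K
  have hdQ : Integrable (Q.indicator d) μ :=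
    (integrable_indicator_iff hQc.isClosed.measurableSet).2 (hd.integrableOn_compact_subset hr₀Ω hQc)
  have hφd : ∀ n x, φ n x * d x = φ n x * Q.indicator d x := by
    intro n x
    by_cases hx : x ∈ Q
    · rw [indicator_of_mem hx]
    · rw [image_eq_zero_of_notMem_tsupport fun h => hx (hφsub n h), zero_mul, zero_mul]
  have hψd : ∀ x, ψ x * S' (w x) * d x = ψ x * S' (w x) * Q.indicator d x := by
    intro x
    by_cases hx : x ∈ Q
    · rw [indicator_of_mem hx]
    · have hxK : |w x| ≤ δ := by
        have : |w x| < δ / 2 := not_le.1 fun h : δ / 2 ≤ |w x| => hx (hKQ h)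
        linarith
      rw [hSδ' _ hxK]; simp
  have key : ∀ n, ∫ x, fderiv ℝ ψ x e * S (wn n x) ∂μ = -∫ x, φ n x * d x ∂μ := by
    intro n
    have h1 := integral_mul_fderiv_mollify μ (ρ n) hw hws (hθ n) (hθs n) e
    rw [← hwn_def, ← hφ_def] at h1
    have h2 := hweak (φ n) (hφ n) (hφs n) ((hφsub n).trans hr₀Ω)
    have h3 : ∫ x, θ n x * fderiv ℝ (wn n) x e ∂μ = ∫ x, φ n x * d x ∂μ := by
      rw [h1, h2, neg_neg]
    rw [← h3]
    have hcd : ∀ x, HasFDerivAt (fun y => S (wn n y)) (S' (wn n x) • fderiv ℝ (wn n) x) x :=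
      fun x => (hS _).comp_hasFDerivAt x
        (((hwn n).differentiable (by simp)) x).hasFDerivAt
    have hcψ : Continuous fun x => fderiv ℝ ψ x e :=
      (hψ.continuous_fderiv (by simp)).clm_apply continuous_const
    have hcw : Continuous fun x => fderiv ℝ (wn n) x e :=
      ((hwn n).continuous_fderiv (by simp)).clm_apply continuous_const
    have hSw : Continuous fun x => S (wn n x) := hSc.comp (hwn n).continuous
    have h4 := integral_mul_fderiv_eq_neg_fderiv_mul_of_integrable (μ := μ) (f := ψ)
      (g := fun y => S (wn n y)) (v := e) ?_ ?_ ?_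
      (fun x _ => hψ.differentiable (by simp) x) (fun x _ => (hcd x).differentiableAt)
    · rw [← neg_eq_iff_eq_neg, ← h4]
      congr 1; ext x
      rw [(hcd x).fderiv]
      simp [hθ_def]; ring
    · exact (hcψ.mul hSw).integrable_of_hasCompactSupport
        ((hasCompactSupport_fderiv_apply hψs e).mul_right)
    · have : (fun x => ψ x * fderiv ℝ (fun y => S (wn n y)) x e)
          = fun x => ψ x * (S' (wn n x) * fderiv ℝ (wn n) x e) := by
        ext x; rw [(hcd x).fderiv]; simp
      rw [this]
      exact (hψ.continuous.mul ((hS'.comp (hwn n).continuous).mul hcw)).integrable_of_hasCompactSupport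
        hψs.mul_right
    · exact (hψ.continuous.mul hSw).integrable_of_hasCompactSupport hψs.mul_right
  have hcψ : Continuous fun x => fderiv ℝ ψ x e :=
    (hψ.continuous_fderiv (by simp)).clm_apply continuous_const
  have hwnx : ∀ x, Tendsto (fun n => wn n x) atTop (𝓝 (w x)) := fun x =>
    (hwn_tend x).comp (tendsto_id.prodMk tendsto_const_nhds)
  -- `w` and the mollified functions take values in a fixed compact interval
  obtain ⟨B, hB⟩ : ∃ B, ∀ x, |w x| ≤ B := by
    obtain ⟨B, hB⟩ := hws.exists_bound_of_continuous hw
    exact ⟨B, fun x => hB x⟩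
  have hwnB : ∀ n x, wn n x ∈ Icc (-(B + δ)) (B + δ) := by
    intro n x
    have h1 := hwn_close n x
    rw [Real.dist_eq] at h1
    have h2 := abs_le.1 h1
    have h3 := abs_le.1 (hB x)
    constructor <;> linarith [h2.1, h2.2, h3.1, h3.2]
  obtain ⟨C, hC⟩ := (isCompact_Icc (a := -(B + δ)) (b := B + δ)).exists_bound_of_continuousOn
    hSc.continuousOn
  obtain ⟨C', hC'⟩ := (isCompact_Icc (a := -(B + δ)) (b := B + δ)).exists_bound_of_continuousOn
    hS'.continuousOn
  obtain ⟨Cψ, hCψ⟩ := hψs.exists_bound_of_continuous hψ.continuous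
  have lim1 : Tendsto (fun n => ∫ x, fderiv ℝ ψ x e * S (wn n x) ∂μ) atTop
      (𝓝 (∫ x, fderiv ℝ ψ x e * S (w x) ∂μ)) := by
    refine tendsto_integral_of_dominated_convergence (fun x => ‖fderiv ℝ ψ x e‖ * C)
      (fun n => (hcψ.mul (hSc.comp (hwn n).continuous)).aestronglyMeasurable) ?_ ?_ ?_
    · exact ((hcψ.integrable_of_hasCompactSupport
        (hasCompactSupport_fderiv_apply hψs e)).norm).mul_const _
    · intro n
      refine ae_of_all _ fun x => ?_
      rw [norm_mul]
      exact mul_le_mul_of_nonneg_left (hC _ (hwnB n x)) (norm_nonneg _)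
    · exact ae_of_all _ fun x => (hSc.tendsto _ |>.comp (hwnx x)).const_mul _
  have lim2 : Tendsto (fun n => ∫ x, φ n x * d x ∂μ) atTop
      (𝓝 (∫ x, ψ x * S' (w x) * d x ∂μ)) := by
    simp_rw [hφd, hψd]
    have hθb : ∀ n x, ‖θ n x‖ ≤ Cψ * C' := fun n x => by
      rw [hθ_def, norm_mul]
      exact mul_le_mul (hCψ x) (hC' _ (hwnB n x)) (norm_nonneg _)
        ((norm_nonneg _).trans (hCψ x))
    have hφb : ∀ n x, ‖φ n x‖ ≤ Cψ * C' := fun n x =>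
      hφ_def n ▸ norm_mollify_le μ (ρ n) (hθ n) (hθb n) x
    refine tendsto_integral_of_dominated_convergence (fun x => Cψ * C' * ‖Q.indicator d x‖)
      (fun n => ((hφ n).continuous.aestronglyMeasurable).mul hdQ.aestronglyMeasurable) ?_ ?_ ?_
    · exact hdQ.norm.const_mul _
    · intro n
      refine ae_of_all _ fun x => ?_
      rw [norm_mul]
      exact mul_le_mul_of_nonneg_right (hφb n x) (norm_nonneg _)
    · refine ae_of_all _ fun x => Tendsto.mul_const _ ?_
      simp_rw [hφ_def]
      refine tendsto_mollify μ hρ0 hθ ?_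
      simp_rw [hθ_def]
      exact ((hψ.continuous.tendsto x).comp tendsto_snd).mul
        ((hS'.tendsto _).comp (hwn_tend x))
  have lim3 := lim2.neg
  simp only [← key] at lim3
  exact tendsto_nhds_unique lim1 lim3

omit [InnerProductSpace ℝ E] [FiniteDimensional ℝ E] [μ.IsAddHaarMeasure] in
lemma integrable_mul_of_locallyIntegrableOn {Ω : Set E} {ψ d : E → ℝ} (hψ : Continuous ψ)
    (hψs : HasCompactSupport ψ) (hψΩ : tsupport ψ ⊆ Ω) (hd : LocallyIntegrableOn d Ω μ) :
    Integrable (fun x => ψ x * d x) μ := by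
  obtain ⟨C, hC⟩ := hψs.exists_bound_of_continuous hψ
  have h := ((integrable_indicator_iff (isClosed_tsupport ψ).measurableSet).2
    (hd.integrableOn_compact_subset hψΩ hψs)).bdd_mul (c := C) hψ.aestronglyMeasurable
      (ae_of_all _ hC)
  refine h.congr (ae_of_all _ fun x => ?_)
  by_cases hx : x ∈ tsupport ψ
  · simp [indicator_of_mem hx]
  · simp [image_eq_zero_of_notMem_tsupport hx]

end Sobolev

/-! ### Sobolev functions with zero boundary values -/

/-- The derivative of the truncation `trunc n`: a continuous function with values in `[0, 1]` that
vanishes near `0` and tends to `1` away from `0` as `n → ∞`. -/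
noncomputable def truncDeriv (n : ℕ) (y : ℝ) : ℝ := min 1 (max 0 ((n + 1) * |y| - 1))

/-- A `C¹` truncation of the identity that vanishes near `0` and tends to the identity. -/
noncomputable def trunc (n : ℕ) (y : ℝ) : ℝ := ∫ z in (0 : ℝ)..y, truncDeriv n z

lemma continuous_truncDeriv (n : ℕ) : Continuous (truncDeriv n) := by
  unfold truncDeriv; fun_prop

lemma truncDeriv_nonneg (n : ℕ) (y : ℝ) : 0 ≤ truncDeriv n y :=
  le_min zero_le_one (le_max_left _ _)

lemma truncDeriv_le_one (n : ℕ) (y : ℝ) : truncDeriv n y ≤ 1 := min_le_left _ _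

lemma truncDeriv_eq_zero {n : ℕ} {y : ℝ} (h : |y| ≤ 1 / (n + 1)) : truncDeriv n y = 0 := by
  have h1 : (n + 1) * |y| ≤ 1 := by
    rwa [le_div_iff₀' (by positivity)] at h
  simp [truncDeriv, max_eq_left (sub_nonpos.2 h1)]

lemma truncDeriv_zero (n : ℕ) : truncDeriv n 0 = 0 :=
  truncDeriv_eq_zero (by simp; positivity)

lemma tendsto_truncDeriv {y : ℝ} (hy : y ≠ 0) :
    Tendsto (fun n => truncDeriv n y) atTop (𝓝 1) := by
  refine tendsto_const_nhds.congr' ?_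
  have h : Tendsto (fun n : ℕ => ((n : ℝ) + 1) * |y|) atTop atTop :=
    (tendsto_atTop_add_const_right _ _ tendsto_natCast_atTop_atTop).atTop_mul_const
      (abs_pos.2 hy)
  filter_upwards [h.eventually_ge_atTop 2] with n hn
  rw [truncDeriv, min_eq_left]
  exact le_max_of_le_right (by linarith)

lemma hasDerivAt_trunc (n : ℕ) (y : ℝ) : HasDerivAt (trunc n) (truncDeriv n y) y :=
  intervalIntegral.integral_hasDerivAt_right ((continuous_truncDeriv n).intervalIntegrable _ _)
    ((continuous_truncDeriv n).stronglyMeasurableAtFilter _ _) (continuous_truncDeriv n).continuousAt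

lemma continuous_trunc (n : ℕ) : Continuous (trunc n) :=
  continuous_iff_continuousAt.2 fun y => (hasDerivAt_trunc n y).continuousAt

lemma trunc_zero (n : ℕ) : trunc n 0 = 0 := by simp [trunc]

lemma trunc_neg (n : ℕ) (y : ℝ) : trunc n (-y) = -trunc n y := by
  have h := intervalIntegral.integral_comp_neg (f := truncDeriv n) (a := 0) (b := y)
  have h2 : ∀ z, truncDeriv n (-z) = truncDeriv n z := fun z => by simp [truncDeriv]
  simp only [h2, neg_zero] at h
  rw [trunc, trunc, h, intervalIntegral.integral_symm]

lemma trunc_nonneg (n : ℕ) {y : ℝ} (hy : 0 ≤ y) : 0 ≤ trunc n y :=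
  intervalIntegral.integral_nonneg hy fun _ _ => truncDeriv_nonneg _ _

lemma trunc_le_self (n : ℕ) {y : ℝ} (hy : 0 ≤ y) : trunc n y ≤ y := by
  calc trunc n y ≤ ∫ _ in (0 : ℝ)..y, (1 : ℝ) :=
        intervalIntegral.integral_mono_on hy ((continuous_truncDeriv n).intervalIntegrable _ _)
          (by simp) fun z _ => truncDeriv_le_one n z
    _ = y := by simp

lemma abs_trunc_le (n : ℕ) (y : ℝ) : |trunc n y| ≤ |y| := by
  rcases le_total 0 y with hy | hy
  · rw [abs_of_nonneg (trunc_nonneg n hy), abs_of_nonneg hy]; exact trunc_le_self n hy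
  · have h : y = -(-y) := by ring
    rw [h, trunc_neg, abs_neg, abs_neg, abs_of_nonneg (trunc_nonneg n (by linarith)),
      abs_of_nonneg (a := -y) (by linarith)]
    exact trunc_le_self n (by linarith)

lemma trunc_eq_zero {n : ℕ} {y : ℝ} (h : |y| ≤ 1 / (n + 1)) : trunc n y = 0 := by
  rw [trunc, intervalIntegral.integral_congr (g := fun _ => (0 : ℝ))]
  · simp
  · intro z hz
    refine truncDeriv_eq_zero (le_trans ?_ h)
    have := abs_sub_left_of_mem_uIcc hz
    simpa using this

lemma tendsto_trunc (y : ℝ) : Tendsto (fun n => trunc n y) atTop (𝓝 y) := by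
  have h : Tendsto (fun n => trunc n y) atTop (𝓝 (∫ _ in (0 : ℝ)..y, (1 : ℝ))) := by
    refine intervalIntegral.tendsto_integral_filter_of_dominated_convergence (fun _ => 1)
      (Eventually.of_forall fun n => (continuous_truncDeriv n).aestronglyMeasurable)
      (Eventually.of_forall fun n => ae_of_all _ fun z _ => ?_) (by simp) ?_
    · rw [Real.norm_eq_abs, abs_of_nonneg (truncDeriv_nonneg n z)]
      exact truncDeriv_le_one n z
    · have h0 : ∀ᵐ z : ℝ, z ≠ 0 := by
        simp [ae_iff]
      filter_upwards [h0] with z hz _ using tendsto_truncDeriv hz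
  simpa using h

section Sobolev

variable {E : Type*} [NormedAddCommGroup E] [InnerProductSpace ℝ E] [FiniteDimensional ℝ E]
  [MeasurableSpace E] [BorelSpace E] {μ : Measure E} [μ.IsAddHaarMeasure]

/-- `w` is a continuous function on `E` with compact support that vanishes off `Ω` and has the
locally integrable weak gradient `Dw` in `Ω`; the gradient is extended by zero off `Ω`. -/
structure IsZeroTrace (μ : Measure E) (Ω : Set E) (w : E → ℝ) (Dw : E → E) : Prop where
  continuous : Continuous w
  compact : HasCompactSupport w
  zero : ∀ x ∉ Ω, w x = 0
  locInt : LocallyIntegrableOn Dw Ω μ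
  grad_zero : ∀ x ∉ Ω, Dw x = 0
  weak : ∀ φ : E → ℝ, ContDiff ℝ ∞ φ → HasCompactSupport φ → tsupport φ ⊆ Ω → ∀ e : E,
    ∫ x, fderiv ℝ φ x e * w x ∂μ = -∫ x, φ x * inner ℝ (Dw x) e ∂μ

namespace IsZeroTrace

variable {Ω : Set E} {w : E → ℝ} {Dw : E → E}

omit [BorelSpace E] [μ.IsAddHaarMeasure] in
lemma locallyIntegrableOn_inner (h : IsZeroTrace μ Ω w Dw) (hΩ : IsOpen Ω) (e : E) :
    LocallyIntegrableOn (fun x => inner ℝ (Dw x) e) Ω μ := by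
  rw [locallyIntegrableOn_iff hΩ.isLocallyClosed]
  intro k hk hkc
  exact (h.locInt.integrableOn_compact_subset hk hkc).inner_const e

lemma integral_fderiv_mul_trunc (h : IsZeroTrace μ Ω w Dw) (hΩ : IsOpen Ω) (n : ℕ) {ψ : E → ℝ}
    (hψ : ContDiff ℝ 1 ψ) (hψs : HasCompactSupport ψ) (e : E) :
    ∫ x, fderiv ℝ ψ x e * trunc n (w x) ∂μ
      = -∫ x, ψ x * truncDeriv n (w x) * inner ℝ (Dw x) e ∂μ :=
  integral_fderiv_mul_comp_of_weakDeriv hΩ h.continuous h.compact h.zero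
    (h.locallyIntegrableOn_inner hΩ e)
    (fun φ h1 h2 h3 => h.weak φ h1 h2 h3 e) (hasDerivAt_trunc n) (continuous_truncDeriv n)
    (δ := 1 / (n + 1)) (by positivity) (fun _ => truncDeriv_eq_zero) hψ hψs

/-- In the limit the truncated chain rule only sees the set where `w` does not vanish. Comparison
with the weak derivative of `w` shows that the latter vanishes elsewhere. -/
lemma integral_fderiv_mul_eq_ne_zero (h : IsZeroTrace μ Ω w Dw) (hΩ : IsOpen Ω) {ψ : E → ℝ}
    (hψ : ContDiff ℝ 1 ψ) (hψs : HasCompactSupport ψ) (e : E)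
    (hi : Integrable (fun x => ψ x * inner ℝ (Dw x) e) μ) :
    ∫ x, fderiv ℝ ψ x e * w x ∂μ
      = -∫ x, ψ x * {x | w x ≠ 0}.indicator (fun x => inner ℝ (Dw x) e) x ∂μ := by
  have hcψ : Continuous fun x => fderiv ℝ ψ x e :=
    (hψ.continuous_fderiv (by simp)).clm_apply continuous_const
  have lim1 : Tendsto (fun n => ∫ x, fderiv ℝ ψ x e * trunc n (w x) ∂μ) atTop
      (𝓝 (∫ x, fderiv ℝ ψ x e * w x ∂μ)) := by
    refine tendsto_integral_of_dominated_convergence (fun x => ‖fderiv ℝ ψ x e * w x‖)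
      (fun n => (hcψ.mul ((continuous_trunc n).comp h.continuous)).aestronglyMeasurable) ?_ ?_ ?_
    · exact ((hcψ.mul h.continuous).integrable_of_hasCompactSupport
        (hasCompactSupport_fderiv_apply hψs e).mul_right).norm
    · refine fun n => ae_of_all _ fun x => ?_
      rw [norm_mul, norm_mul]
      exact mul_le_mul_of_nonneg_left (abs_trunc_le n _) (norm_nonneg _)
    · exact ae_of_all _ fun x => (tendsto_trunc (w x)).const_mul _
  have lim2 : Tendsto (fun n => ∫ x, ψ x * truncDeriv n (w x) * inner ℝ (Dw x) e ∂μ) atTop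
      (𝓝 (∫ x, ψ x * {x | w x ≠ 0}.indicator (fun x => inner ℝ (Dw x) e) x ∂μ)) := by
    refine tendsto_integral_of_dominated_convergence (fun x => ‖ψ x * inner ℝ (Dw x) e‖)
      (fun n => ?_) hi.norm ?_ ?_
    · have := (((continuous_truncDeriv n).comp h.continuous).aestronglyMeasurable (μ := μ)).mul
        hi.aestronglyMeasurable
      refine this.congr (ae_of_all _ fun x => ?_)
      simp only [Pi.mul_apply, Function.comp_apply]; ring
    · refine fun n => ae_of_all _ fun x => ?_
      rw [mul_right_comm, norm_mul, Real.norm_of_nonneg (truncDeriv_nonneg n _)]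
      exact mul_le_of_le_one_right (norm_nonneg _) (truncDeriv_le_one n _)
    · refine ae_of_all _ fun x => ?_
      by_cases hx : w x = 0
      · simp [hx, truncDeriv_zero]
      · rw [indicator_of_mem (by exact hx)]
        simpa using ((tendsto_truncDeriv hx).const_mul (ψ x)).mul_const (inner ℝ (Dw x) e)
  have lim3 := lim2.neg
  simp only [← h.integral_fderiv_mul_trunc hΩ _ hψ hψs e] at lim3
  exact tendsto_nhds_unique lim1 lim3

/-- The weak gradient of `w` vanishes almost everywhere on the zero set of `w`. -/
lemma ae_grad_eq_zero (h : IsZeroTrace μ Ω w Dw) (hΩ : IsOpen Ω) :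
    ∀ᵐ x ∂μ, w x = 0 → Dw x = 0 := by
  have hne : MeasurableSet {x | w x ≠ 0} :=
    (isOpen_ne_fun h.continuous continuous_const).measurableSet
  have key : ∀ e : E, ∀ᵐ x ∂μ, x ∈ Ω → {x | w x ≠ 0}ᶜ.indicator (fun x => inner ℝ (Dw x) e) x = 0 := by
    intro e
    have hi := h.locallyIntegrableOn_inner hΩ e
    have hloc : LocallyIntegrableOn ({x | w x ≠ 0}ᶜ.indicator fun x => inner ℝ (Dw x) e) Ω μ := by
      rw [locallyIntegrableOn_iff hΩ.isLocallyClosed]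
      exact fun k hk hkc => (hi.integrableOn_compact_subset hk hkc).indicator hne.compl
    refine hΩ.ae_eq_zero_of_integral_contDiff_smul_eq_zero hloc fun φ hφ hφs hφΩ => ?_
    have h1 := h.weak φ hφ hφs hφΩ e
    have hi1 : Integrable (fun x => φ x * inner ℝ (Dw x) e) μ :=
      integrable_mul_of_locallyIntegrableOn hφ.continuous hφs hφΩ hi
    rw [h.integral_fderiv_mul_eq_ne_zero hΩ (hφ.of_le (by simp)) hφs e hi1, neg_inj] at h1
    have hi2 : Integrable (fun x => φ x * {x | w x ≠ 0}.indicator (fun x => inner ℝ (Dw x) e) x) μ := by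
      refine (hi1.indicator hne).congr (ae_of_all _ fun x => ?_)
      by_cases hx : w x = 0 <;> simp [hx]
    have h2 : ∀ x, φ x • {x | w x ≠ 0}ᶜ.indicator (fun x => inner ℝ (Dw x) e) x
        = φ x * inner ℝ (Dw x) e
          - φ x * {x | w x ≠ 0}.indicator (fun x => inner ℝ (Dw x) e) x := by
      intro x
      rw [indicator_compl]; simp [mul_sub]
    simp_rw [h2]
    rw [integral_sub hi1 hi2, h1, sub_self]
  have key2 : ∀ᵐ x ∂μ, ∀ i, x ∈ Ω →
      {x | w x ≠ 0}ᶜ.indicator (fun x => inner ℝ (Dw x) (stdOrthonormalBasis ℝ E i)) x = 0 :=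
    ae_all_iff.2 fun i => key _
  filter_upwards [key2] with x hx hw
  by_cases hxΩ : x ∈ Ω
  · rw [← (stdOrthonormalBasis ℝ E).sum_repr' (Dw x)]
    refine Finset.sum_eq_zero fun i _ => ?_
    have := hx i hxΩ
    rw [indicator_of_mem (by simpa using hw), real_inner_comm] at this
    rw [this, zero_smul]
  · exact h.grad_zero x hxΩ

/-- The extension of `w` by zero is weakly differentiable on the whole space. -/
lemma integral_fderiv_mul (h : IsZeroTrace μ Ω w Dw) (hΩ : IsOpen Ω) {ψ : E → ℝ}
    (hψ : ContDiff ℝ 1 ψ) (hψs : HasCompactSupport ψ) (e : E) (hi : Integrable Dw μ) :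
    ∫ x, fderiv ℝ ψ x e * w x ∂μ = -∫ x, ψ x * inner ℝ (Dw x) e ∂μ := by
  obtain ⟨C, hC⟩ := hψs.exists_bound_of_continuous hψ.continuous
  rw [h.integral_fderiv_mul_eq_ne_zero hΩ hψ hψs e ((hi.inner_const e).bdd_mul (c := C)
    hψ.continuous.aestronglyMeasurable (ae_of_all _ hC))]
  congr 1
  refine integral_congr_ae ?_
  filter_upwards [h.ae_grad_eq_zero hΩ] with x hx
  by_cases hw : w x = 0
  · simp [hw, hx hw]
  · rw [indicator_of_mem (by exact hw)]

end IsZeroTrace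
end Sobolev

/-! ### Green's identity and lower semicontinuity of the energy -/

lemma lintegral_enorm_sq_eq {α F : Type*} [MeasurableSpace α] {μ : Measure α}
    [NormedAddCommGroup F] {f : α → F} (hf : MemLp f 2 μ) :
    ∫⁻ x, ‖f x‖ₑ ^ 2 ∂μ = ENNReal.ofReal (∫ x, ‖f x‖ ^ 2 ∂μ) := by
  rw [ofReal_integral_eq_lintegral_ofReal (hf.integrable_norm_pow (by simp))
    (ae_of_all _ fun x => by positivity)]
  refine lintegral_congr fun x => ?_
  rw [ENNReal.ofReal_pow (norm_nonneg _), ofReal_norm]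

section Sobolev

variable {E : Type*} [NormedAddCommGroup E] [InnerProductSpace ℝ E] [FiniteDimensional ℝ E]
  [MeasurableSpace E] [BorelSpace E] {μ : Measure E} [μ.IsAddHaarMeasure]

omit [MeasurableSpace E] [BorelSpace E] in
/-- A smooth cutoff function that equals `1` near a compact subset `K` of an open set `Ω`. -/
lemma exists_contDiff_cutoff {K Ω : Set E} (hK : IsCompact K) (hΩ : IsOpen Ω) (h : K ⊆ Ω) :
    ∃ χ : E → ℝ, ContDiff ℝ ∞ χ ∧ HasCompactSupport χ ∧ tsupport χ ⊆ Ω ∧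
      ∀ x ∈ K, χ =ᶠ[𝓝 x] fun _ => 1 := by
  obtain ⟨K', hK', hKK', hK'Ω⟩ := exists_compact_between hK hΩ h
  obtain ⟨f, hf1, hf0, -⟩ := exists_contMDiffMap_one_nhds_of_subset_interior (n := (⊤ : ℕ∞))
    (modelWithCornersSelf ℝ E) hK.isClosed hKK'
  have hsub : tsupport f ⊆ K' := closure_minimal
    (fun x hx => by by_contra hc; exact hx (hf0 x hc)) hK'.isClosed
  refine ⟨f, f.contMDiff.contDiff, hK'.of_isClosed_subset (isClosed_tsupport _) hsub,
    hsub.trans hK'Ω, fun x hx => ?_⟩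
  exact eventually_nhdsSet_iff_forall.1 hf1 x hx

omit [FiniteDimensional ℝ E] [MeasurableSpace E] [BorelSpace E] in
lemma contDiff_mul_of_tsupport_subset {Ω : Set E} (hΩ : IsOpen Ω) {n : ℕ∞} {χ f : E → ℝ}
    (hχ : ContDiff ℝ n χ) (hχΩ : tsupport χ ⊆ Ω) (hf : ContDiffOn ℝ n f Ω) :
    ContDiff ℝ n fun x => χ x * f x := by
  rw [contDiff_iff_contDiffAt]
  intro x
  by_cases hx : x ∈ Ω
  · exact hχ.contDiffAt.mul (hf.contDiffAt (hΩ.mem_nhds hx))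
  · have h0 : (fun x => χ x * f x) =ᶠ[𝓝 x] fun _ => 0 := by
      filter_upwards [(isClosed_tsupport χ).isOpen_compl.mem_nhds fun h => hx (hχΩ h)] with y hy
      rw [image_eq_zero_of_notMem_tsupport hy, zero_mul]
    exact contDiffAt_const.congr_of_eventuallyEq h0

lemma integral_fderiv_mul_of_contDiffOn {Ω : Set E} (hΩ : IsOpen Ω) {f φ : E → ℝ}
    (hf : ContDiffOn ℝ 1 f Ω) (hφ : ContDiff ℝ 1 φ) (hφs : HasCompactSupport φ)
    (hφΩ : tsupport φ ⊆ Ω) (e : E) :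
    ∫ x, fderiv ℝ φ x e * f x ∂μ = -∫ x, φ x * fderiv ℝ f x e ∂μ := by
  have hfd : ∀ x ∈ tsupport φ, DifferentiableAt ℝ f x := fun x hx =>
    (hf.contDiffAt (hΩ.mem_nhds (hφΩ hx))).differentiableAt (by simp)
  have hfc : ContinuousOn (fun x => fderiv ℝ f x e) Ω :=
    (hf.continuousOn_fderiv_of_isOpen hΩ (by simp)).clm_apply continuousOn_const
  have hmul : ∀ {p q : E → ℝ}, Continuous p → tsupport p ⊆ Ω → HasCompactSupport p →
      ContinuousOn q Ω → Integrable (fun x => p x * q x) μ := by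
    intro p q hp hpΩ hps hq
    have h : Continuous fun x => p x * q x := by
      have hsub : tsupport (fun x => p x * q x) ⊆ tsupport p :=
        closure_mono (Function.support_mul_subset_left _ _)
      refine continuous_of_tsupport fun x hx => ?_
      exact hp.continuousAt.mul (hq.continuousAt (hΩ.mem_nhds (hpΩ (hsub hx))))
    exact h.integrable_of_hasCompactSupport hps.mul_right
  rw [← neg_eq_iff_eq_neg]
  symm
  refine integral_mul_fderiv_eq_neg_fderiv_mul_of_integrable ?_ ?_ ?_
    (fun x _ => hφ.differentiable (by simp) x) hfd
  · exact hmul ((hφ.continuous_fderiv (by simp)).clm_apply continuous_const)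
      ((tsupport_fderiv_apply_subset ℝ e).trans hφΩ) (hasCompactSupport_fderiv_apply hφs e)
      hf.continuousOn
  · exact hmul hφ.continuous hφΩ hφs hfc
  · exact hmul hφ.continuous hφΩ hφs hf.continuousOn

namespace IsZeroTrace

variable {Ω : Set E} {w : E → ℝ} {Dw : E → E}

/-- Green's identity tested with the truncation of a function with zero boundary values; `f` needs
no regularity at the boundary, since the truncation has compact support in `Ω`. -/
lemma setIntegral_laplacian_mul_trunc (h : IsZeroTrace μ Ω w Dw) (hΩ : IsOpen Ω) (n : ℕ)
    {f : E → ℝ} (hf : ContDiffOn ℝ 2 f Ω) :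
    ∫ x in Ω, Laplacian.laplacian f x * trunc n (w x) ∂μ
      = -∫ x in Ω, truncDeriv n (w x) * inner ℝ (gradient f x) (Dw x) ∂μ := by
  set b := stdOrthonormalBasis ℝ E
  set K : Set E := {x | 1 / (n + 1 : ℝ) ≤ |w x|} with hKdef
  have hn : (0 : ℝ) < 1 / (n + 1) := by positivity
  have hKΩ : K ⊆ Ω := by
    intro x hx
    by_contra hc
    simp only [hKdef, mem_ofPred_eq, h.zero x hc, abs_zero] at hx
    linarith
  have hK : IsCompact K := by
    refine h.compact.of_isClosed_subset (isClosed_le continuous_const h.continuous.abs)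
      fun x hx => subset_tsupport _ fun h0 => ?_
    simp only [hKdef, mem_ofPred_eq, h0, abs_zero] at hx
    linarith
  have hoff : ∀ x ∉ K, trunc n (w x) = 0 ∧ truncDeriv n (w x) = 0 := by
    intro x hx
    have : |w x| ≤ 1 / (n + 1) := (not_le.1 hx).le
    exact ⟨trunc_eq_zero this, truncDeriv_eq_zero this⟩
  obtain ⟨χ, hχ, hχs, hχΩ, hχ1⟩ := exists_contDiff_cutoff hK hΩ hKΩ
  have hf' : ContDiffOn ℝ 1 (fderiv ℝ f) Ω := hf.fderiv_of_isOpen hΩ (by norm_num)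
  set ψ : Fin (Module.finrank ℝ E) → E → ℝ := fun i x => χ x * fderiv ℝ f x (b i) with hψdef
  have hψ : ∀ i, ContDiff ℝ 1 (ψ i) := fun i =>
    contDiff_mul_of_tsupport_subset (n := 1) hΩ (hχ.of_le (by simp)) hχΩ
      (hf'.clm_apply contDiffOn_const)
  have hψs : ∀ i, HasCompactSupport (ψ i) := fun i => hχs.mul_right
  have hψK : ∀ i, ∀ x ∈ K, ψ i x = fderiv ℝ f x (b i) := fun i x hx => by
    simp [hψdef, (hχ1 x hx).eq_of_nhds]
  have hψ'K : ∀ i, ∀ x ∈ K, fderiv ℝ (ψ i) x (b i) = iteratedFDeriv ℝ 2 f x ![b i, b i] := by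
    intro i x hx
    have h1 : ψ i =ᶠ[𝓝 x] fun y => fderiv ℝ f y (b i) := by
      filter_upwards [hχ1 x hx] with y hy
      simp [hψdef, hy]
    have h2 : DifferentiableAt ℝ (fderiv ℝ f) x :=
      (hf'.contDiffAt (hΩ.mem_nhds (hKΩ hx))).differentiableAt (by simp)
    rw [h1.fderiv_eq, iteratedFDeriv_two_apply, fderiv_clm_apply h2 (differentiableAt_const _)]
    simp
  have hT : Continuous fun x => trunc n (w x) := (continuous_trunc n).comp h.continuous
  have hT' : Continuous fun x => truncDeriv n (w x) := (continuous_truncDeriv n).comp h.continuous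
  have e1 : ∫ x in Ω, Laplacian.laplacian f x * trunc n (w x) ∂μ
      = ∑ i, ∫ x, fderiv ℝ (ψ i) x (b i) * trunc n (w x) ∂μ := by
    rw [setIntegral_eq_integral_of_forall_compl_eq_zero
      (fun x hx => by rw [h.zero x hx, trunc_zero, mul_zero]), ← integral_finsetSum]
    · congr 1; ext x
      by_cases hx : x ∈ K
      · rw [InnerProductSpace.laplacian_eq_iteratedFDeriv_orthonormalBasis f b, Finset.sum_mul]
        refine Finset.sum_congr rfl fun i _ => ?_
        rw [hψ'K i x hx]
      · simp [(hoff x hx).1]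
    · intro i _
      exact ((((hψ i).continuous_fderiv (by simp)).clm_apply
        continuous_const).mul hT).integrable_of_hasCompactSupport
          (hasCompactSupport_fderiv_apply (hψs i) _).mul_right
  have e2 : ∫ x in Ω, truncDeriv n (w x) * inner ℝ (gradient f x) (Dw x) ∂μ
      = ∑ i, ∫ x, ψ i x * truncDeriv n (w x) * inner ℝ (Dw x) (b i) ∂μ := by
    rw [setIntegral_eq_integral_of_forall_compl_eq_zero
      (fun x hx => by rw [h.zero x hx, truncDeriv_zero, zero_mul]), ← integral_finsetSum]
    · congr 1; ext x
      by_cases hx : x ∈ K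
      · rw [← b.sum_inner_mul_inner, Finset.mul_sum]
        refine Finset.sum_congr rfl fun i _ => ?_
        rw [hψK i x hx, inner_gradient_left, real_inner_comm (Dw x)]
        ring
      · simp [(hoff x hx).2]
    · intro i _
      refine (integrable_mul_of_locallyIntegrableOn ((hψ i).continuous.mul hT') (hψs i).mul_right
        (subset_trans ?_ hχΩ) (h.locallyIntegrableOn_inner hΩ (b i)))
      refine closure_mono fun x hx => ?_
      contrapose! hx
      simp only [Function.mem_support, not_not] at hx ⊢
      simp [hψdef, hx]
  rw [e1, e2, ← Finset.sum_neg_distrib]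
  exact Finset.sum_congr rfl fun i _ => h.integral_fderiv_mul_trunc hΩ n (hψ i) (hψs i) (b i)

end IsZeroTrace

/-- Lower semicontinuity of the Dirichlet energy along a sequence that converges uniformly with
fixed boundary values: here `Y` and `X n` are the gradients of the limit and of the sequence, and
`w n` is the difference of the functions. -/
lemma lintegral_enorm_sq_le_of_isZeroTrace {Ω : Set E} (hΩ : IsOpen Ω) {Y : E → E} {X : ℕ → E → E}
    {w : ℕ → E → ℝ} (hY : MemLp Y 2 μ) (hX : ∀ n, MemLp (X n) 2 μ)
    (hw : ∀ n, IsZeroTrace μ Ω (w n) fun x => Y x - X n x)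
    (hwi : ∀ n, Integrable (fun x => Y x - X n x) μ) {c : ℕ → ℝ}
    (hwc : ∀ n x, |w n x| ≤ c n) (hc : Tendsto c atTop (𝓝 0)) {M : ℝ≥0∞}
    (hM : ∀ n, ∫⁻ x, ‖X n x‖ₑ ^ 2 ∂μ ≤ M) : ∫⁻ x, ‖Y x‖ₑ ^ 2 ∂μ ≤ M := by
  rcases eq_or_ne M ∞ with rfl | hMtop
  · exact le_top
  set y : Lp E 2 μ := hY.toLp with hy
  set m := Real.sqrt M.toReal with hm
  have hnorm : ∀ {Z : E → E} (hZ : MemLp Z 2 μ), ∫ x, ‖Z x‖ ^ 2 ∂μ = ‖hZ.toLp‖ ^ 2 := by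
    intro Z hZ
    rw [← real_inner_self_eq_norm_sq, L2.inner_def]
    refine integral_congr_ae ?_
    filter_upwards [hZ.coeFn_toLp] with x hx
    rw [hx, real_inner_self_eq_norm_sq]
  have hXm : ∀ n, ‖(hX n).toLp‖ ≤ m := by
    intro n
    refine Real.le_sqrt_of_sq_le ?_
    rw [← hnorm]
    refine (ENNReal.ofReal_le_iff_le_toReal hMtop).1 ?_
    rw [← lintegral_enorm_sq_eq (hX n)]
    exact hM n
  have hdense : ∀ Φ : Lp E 2 μ, inner ℝ y Φ ≤ m * ‖Φ‖ := by
    have hcl : IsClosed {Φ : Lp E 2 μ | inner ℝ y Φ ≤ m * ‖Φ‖} :=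
      isClosed_le (by fun_prop) (by fun_prop)
    have hd := MeasureTheory.Lp.dense_hasCompactSupport_contDiff (F := E) (μ := μ) (p := 2)
      (by simp)
    suffices hsub : {f : Lp E 2 μ | ∃ g : E → E, f =ᵐ[μ] g ∧ HasCompactSupport g ∧ ContDiff ℝ ∞ g}
        ⊆ {Φ : Lp E 2 μ | inner ℝ y Φ ≤ m * ‖Φ‖} by
      intro Φ
      exact closure_minimal hsub hcl (hd Φ)
    rintro Φ ⟨g, hΦg, hgs, hg⟩
    set b := stdOrthonormalBasis ℝ E
    have hgi : ∀ i, ContDiff ℝ ∞ fun x => inner ℝ (b i) (g x) := fun i =>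
      contDiff_const.inner ℝ hg
    have hgis : ∀ i, HasCompactSupport fun x => inner ℝ (b i) (g x) := fun i =>
      hgs.mono fun x hx => by
        contrapose! hx
        simp only [Function.mem_support, not_not] at hx ⊢
        simp [hx]
    have hgLp : MemLp g 2 μ := hg.continuous.memLp_of_hasCompactSupport hgs
    have hdiff : ∀ n, inner ℝ y Φ - inner ℝ (hX n).toLp Φ
        = -∑ i, ∫ x, fderiv ℝ (fun x => inner ℝ (b i) (g x)) x (b i) * w n x ∂μ := by
      intro n
      rw [← inner_sub_left, ← MemLp.toLp_sub, L2.inner_def, ← Finset.sum_neg_distrib]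
      have h1 : ∀ i, -∫ x, fderiv ℝ (fun x => inner ℝ (b i) (g x)) x (b i) * w n x ∂μ
          = ∫ x, inner ℝ (b i) (g x) * inner ℝ (Y x - X n x) (b i) ∂μ := fun i => by
        rw [(hw n).integral_fderiv_mul hΩ ((hgi i).of_le (by simp)) (hgis i) _ (hwi n), neg_neg]
      simp_rw [h1]
      rw [← integral_finsetSum]
      · refine integral_congr_ae ?_
        filter_upwards [hΦg, (hY.sub (hX n)).coeFn_toLp] with x hx1 hx2
        rw [hx1, hx2, ← b.sum_inner_mul_inner]
        refine Finset.sum_congr rfl fun i _ => ?_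
        rw [mul_comm]; rfl
      · intro i _
        obtain ⟨C, hC⟩ := (hgis i).exists_bound_of_continuous (hgi i).continuous
        exact ((hwi n).inner_const _).bdd_mul (c := C)
          (hgi i).continuous.aestronglyMeasurable (ae_of_all _ hC)
    have hlim : Tendsto (fun n => inner ℝ y Φ - inner ℝ (hX n).toLp Φ) atTop (𝓝 0) := by
      simp_rw [hdiff]
      rw [← neg_zero, ← Finset.sum_const_zero (s := Finset.univ (α := Fin (Module.finrank ℝ E)))]
      refine (tendsto_finsetSum _ fun i _ => ?_).neg
      set q : E → ℝ := fun x => fderiv ℝ (fun x => inner ℝ (b i) (g x)) x (b i) with hq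
      have hqc : Continuous q := ((hgi i).continuous_fderiv (by simp)).clm_apply continuous_const
      have hqi : Integrable q μ :=
        hqc.integrable_of_hasCompactSupport (hasCompactSupport_fderiv_apply (hgis i) _)
      have hb : ∀ n, ‖∫ x, q x * w n x ∂μ‖ ≤ c n * ∫ x, ‖q x‖ ∂μ := by
        intro n
        rw [mul_comm, ← integral_mul_const]
        refine norm_integral_le_of_norm_le (hqi.norm.mul_const _) (ae_of_all _ fun x => ?_)
        rw [norm_mul]
        exact mul_le_mul_of_nonneg_left (hwc n x) (norm_nonneg _)
      refine squeeze_zero_norm hb ?_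
      simpa using hc.mul_const (∫ x, ‖q x‖ ∂μ)
    have hlim2 : Tendsto (fun n => inner ℝ y Φ - (inner ℝ y Φ - inner ℝ (hX n).toLp Φ)) atTop
        (𝓝 (inner ℝ y Φ - 0)) := tendsto_const_nhds.sub hlim
    simp only [sub_sub_cancel, sub_zero] at hlim2
    refine le_of_tendsto' hlim2 fun n => (real_inner_le_norm _ _).trans ?_
    exact mul_le_mul_of_nonneg_right (hXm n) (norm_nonneg _)
  have hyy := hdense y
  rw [real_inner_self_eq_norm_sq] at hyy
  have hym : ‖y‖ ≤ m := by
    by_contra hlt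
    push Not at hlt
    have : 0 ≤ m := Real.sqrt_nonneg _
    nlinarith
  rw [lintegral_enorm_sq_eq hY, hnorm hY]
  refine ENNReal.ofReal_le_of_le_toReal ?_
  calc ‖y‖ ^ 2 ≤ m ^ 2 := by gcongr
    _ = M.toReal := Real.sq_sqrt ENNReal.toReal_nonneg

end Sobolev

/-! ### The filtration equation and its potential -/

/-- The potential `∫_p^q a(ρ) S(ρ - p) dρ`. If `A' = a` and `B' = ρ a(ρ)`, it
equals `B(q) - B(p) - p (A(q) - A(p))` for `S = id`: the Bregman distance of `B` as a convex function
of `A`. -/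
noncomputable def potential (a S : ℝ → ℝ) (p q : ℝ) : ℝ := ∫ ρ in p..q, a ρ * S (ρ - p)

section Potential

variable {a S : ℝ → ℝ} {p q : ℝ}

lemma uIcc_subset_Ioi (hp : 0 < p) (hq : 0 < q) : uIcc p q ⊆ Ioi 0 := fun _ hx =>
  lt_of_lt_of_le (lt_min hp hq) hx.1

lemma intervalIntegrable_potential (ha : ContinuousOn a (Ioi 0)) (hS : Continuous S) (c : ℝ)
    (hp : 0 < p) (hq : 0 < q) : IntervalIntegrable (fun ρ => a ρ * S (ρ - c)) volume p q :=
  ((ha.mono (uIcc_subset_Ioi hp hq)).mul (by fun_prop)).intervalIntegrable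

lemma hasDerivAt_potential (ha : ContinuousOn a (Ioi 0)) (hS : Continuous S) (hp : 0 < p)
    (hq : 0 < q) : HasDerivAt (potential a S p) (a q * S (q - p)) q := by
  have hc : ContinuousOn (fun ρ => a ρ * S (ρ - p)) (Ioi 0) := ha.mul (by fun_prop)
  exact intervalIntegral.integral_hasDerivAt_right (intervalIntegrable_potential ha hS p hp hq)
    (hc.stronglyMeasurableAtFilter isOpen_Ioi _ hq) (hc.continuousAt (Ioi_mem_nhds hq))

lemma potential_mono (ha : ContinuousOn a (Ioi 0)) (ha0 : ∀ s, 0 < s → 0 < a s)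
    {S₁ S₂ : ℝ → ℝ} (hS₁ : Continuous S₁) (hS₂ : Continuous S₂)
    (hpos : ∀ y, 0 ≤ y → S₁ y ≤ S₂ y) (hneg : ∀ y, y ≤ 0 → S₂ y ≤ S₁ y) (hp : 0 < p) (hq : 0 < q) :
    potential a S₁ p q ≤ potential a S₂ p q := by
  rcases le_total p q with h | h
  · refine intervalIntegral.integral_mono_on h (intervalIntegrable_potential ha hS₁ p hp hq)
      (intervalIntegrable_potential ha hS₂ p hp hq) fun x hx => ?_
    exact mul_le_mul_of_nonneg_left (hpos _ (by linarith [hx.1])) (ha0 x (hp.trans_le hx.1)).le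
  · rw [potential, potential, intervalIntegral.integral_symm, intervalIntegral.integral_symm q p,
      neg_le_neg_iff]
    refine intervalIntegral.integral_mono_on h (intervalIntegrable_potential ha hS₂ p hq hp)
      (intervalIntegrable_potential ha hS₁ p hq hp) fun x hx => ?_
    exact mul_le_mul_of_nonneg_left (hneg _ (by linarith [hx.2])) (ha0 x (hq.trans_le hx.1)).le

lemma potential_nonneg (ha : ContinuousOn a (Ioi 0)) (ha0 : ∀ s, 0 < s → 0 < a s)
    (hS : Continuous S) (hpos : ∀ y, 0 ≤ y → 0 ≤ S y) (hneg : ∀ y, y ≤ 0 → S y ≤ 0)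
    (hp : 0 < p) (hq : 0 < q) : 0 ≤ potential a S p q := by
  have h := potential_mono (S₁ := fun _ => 0) ha ha0 continuous_const hS hpos hneg hp hq
  simpa [potential] using h

lemma trunc_nonpos (n : ℕ) {y : ℝ} (hy : y ≤ 0) : trunc n y ≤ 0 := by
  have h := trunc_nonneg n (y := -y) (by linarith)
  rw [trunc_neg] at h; linarith

lemma self_le_trunc (n : ℕ) {y : ℝ} (hy : y ≤ 0) : y ≤ trunc n y := by
  have h := trunc_le_self n (y := -y) (by linarith)
  rw [trunc_neg] at h; linarith

lemma potential_trunc_nonneg (ha : ContinuousOn a (Ioi 0)) (ha0 : ∀ s, 0 < s → 0 < a s) (n : ℕ)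
    (hp : 0 < p) (hq : 0 < q) : 0 ≤ potential a (trunc n) p q :=
  potential_nonneg ha ha0 (continuous_trunc n) (fun _ => trunc_nonneg n) (fun _ => trunc_nonpos n)
    hp hq

lemma potential_id_nonneg (ha : ContinuousOn a (Ioi 0)) (ha0 : ∀ s, 0 < s → 0 < a s)
    (hp : 0 < p) (hq : 0 < q) : 0 ≤ potential a id p q :=
  potential_nonneg ha ha0 continuous_id (fun _ h => h) (fun _ h => h) hp hq

lemma potential_trunc_le (ha : ContinuousOn a (Ioi 0)) (ha0 : ∀ s, 0 < s → 0 < a s) (n : ℕ)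
    (hp : 0 < p) (hq : 0 < q) : potential a (trunc n) p q ≤ potential a id p q :=
  potential_mono ha ha0 (continuous_trunc n) continuous_id (fun _ => trunc_le_self n)
    (fun _ => self_le_trunc n) hp hq

lemma tendsto_potential_trunc (ha : ContinuousOn a (Ioi 0)) (hp : 0 < p) (hq : 0 < q) :
    Tendsto (fun n => potential a (trunc n) p q) atTop (𝓝 (potential a id p q)) := by
  refine intervalIntegral.tendsto_integral_filter_of_dominated_convergence
    (fun ρ => ‖a ρ * id (ρ - p)‖) (Eventually.of_forall fun n => ?_)
    (Eventually.of_forall fun n => ae_of_all _ fun ρ _ => ?_)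
    (intervalIntegrable_potential ha continuous_id p hp hq).norm
    (ae_of_all _ fun ρ _ => (tendsto_trunc _).const_mul _)
  · exact (intervalIntegrable_potential ha (continuous_trunc n) p hp hq).def'.aestronglyMeasurable
  · rw [norm_mul, norm_mul]
    exact mul_le_mul_of_nonneg_left (abs_trunc_le n _) (norm_nonneg _)

lemma continuousOn_primitive_Ioi {b : ℝ → ℝ} (hb : ContinuousOn b (Ioi 0)) :
    ContinuousOn (fun q => ∫ ρ in (1 : ℝ)..q, b ρ) (Ioi 0) := fun _ hq =>
  (intervalIntegral.integral_hasDerivAt_right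
    ((hb.mono (uIcc_subset_Ioi one_pos hq)).intervalIntegrable)
    (hb.stronglyMeasurableAtFilter isOpen_Ioi _ hq)
    (hb.continuousAt (Ioi_mem_nhds hq))).continuousAt.continuousWithinAt

lemma continuousOn_potential_id (ha : ContinuousOn a (Ioi 0)) :
    ContinuousOn (fun z : ℝ × ℝ => potential a id z.1 z.2) (Ioi 0 ×ˢ Ioi 0) := by
  have ha1 : ContinuousOn (fun ρ => a ρ * ρ) (Ioi 0) := ha.mul continuousOn_id
  have h : ∀ z ∈ (Ioi (0 : ℝ) ×ˢ Ioi (0 : ℝ)), potential a id z.1 z.2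
      = ((∫ ρ in (1 : ℝ)..z.2, a ρ * ρ) - ∫ ρ in (1 : ℝ)..z.1, a ρ * ρ)
        - z.1 * ((∫ ρ in (1 : ℝ)..z.2, a ρ) - ∫ ρ in (1 : ℝ)..z.1, a ρ) := by
    rintro ⟨p, q⟩ ⟨hp, hq⟩
    have hi : ∀ {b : ℝ → ℝ} {x y : ℝ}, ContinuousOn b (Ioi 0) → 0 < x → 0 < y →
        IntervalIntegrable b volume x y := fun hb hx hy =>
      (hb.mono (uIcc_subset_Ioi hx hy)).intervalIntegrable
    simp only
    rw [intervalIntegral.integral_interval_sub_left (hi ha1 one_pos hq) (hi ha1 one_pos hp),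
      intervalIntegral.integral_interval_sub_left (hi ha one_pos hq) (hi ha one_pos hp),
      ← intervalIntegral.integral_const_mul,
      ← intervalIntegral.integral_sub (hi ha1 hp hq) ((hi ha hp hq).const_mul _), potential]
    refine intervalIntegral.integral_congr fun ρ _ => ?_
    simp only [id]; ring
  refine ContinuousOn.congr ?_ h
  have h2 : ∀ {b : ℝ → ℝ}, ContinuousOn b (Ioi 0) →
      ContinuousOn (fun z : ℝ × ℝ => (∫ ρ in (1 : ℝ)..z.2, b ρ) - ∫ ρ in (1 : ℝ)..z.1, b ρ)
        (Ioi 0 ×ˢ Ioi 0) := fun hb =>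
    ((continuousOn_primitive_Ioi hb).comp continuousOn_snd fun z hz => hz.2).sub
      ((continuousOn_primitive_Ioi hb).comp continuousOn_fst fun z hz => hz.1)
  exact (h2 ha1).sub (continuousOn_fst.mul (h2 ha))

/-- The potential is asymptotically `a(p) (q - p)² / 2`; only the lower bound is stated. -/
lemma eventually_le_potential (ha : ContinuousOn a (Ioi 0)) (hp : 0 < p) {c : ℝ} (hc : c < a p) :
    ∀ᶠ q in 𝓝 p, c * (q - p) ^ 2 / 2 ≤ potential a id p q := by
  have h1 : ∀ᶠ ρ in 𝓝 p, c < a ρ ∧ 0 < ρ :=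
    ((ha.continuousAt (Ioi_mem_nhds hp)).eventually (lt_mem_nhds hc)).and (lt_mem_nhds hp)
  obtain ⟨δ, hδ, hball⟩ := Metric.eventually_nhds_iff_ball.1 h1
  filter_upwards [Metric.ball_mem_nhds p hδ] with q hq
  have hq0 := (hball q hq).2
  have hsub : ∀ ρ ∈ uIcc p q, c ≤ a ρ := fun ρ hρ => by
    refine (hball ρ ?_).1.le
    have hconv := (convex_ball p δ).ordConnected.uIcc_subset (Metric.mem_ball_self hδ) hq hρ
    exact hconv
  have h2 : ∫ ρ in p..q, c * (ρ - p) = c * (q - p) ^ 2 / 2 := by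
    rw [intervalIntegral.integral_const_mul, intervalIntegral.integral_sub (by simp) (by simp)]
    simp; ring
  rw [← h2, potential]
  have hi := intervalIntegrable_potential (S := id) ha continuous_id p hp hq0
  have hi' : IntervalIntegrable (fun ρ => c * (ρ - p)) volume p q :=
    (by fun_prop : Continuous fun ρ : ℝ => c * (ρ - p)).intervalIntegrable _ _
  rcases le_total p q with h | h
  · refine intervalIntegral.integral_mono_on h hi' hi fun ρ hρ => ?_
    refine mul_le_mul_of_nonneg_right (hsub ρ (by rwa [uIcc_of_le h])) ?_
    simpa using hρ.1
  · rw [intervalIntegral.integral_symm, intervalIntegral.integral_symm q p, neg_le_neg_iff]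
    refine intervalIntegral.integral_mono_on h hi.symm hi'.symm fun ρ hρ => ?_
    refine mul_le_mul_of_nonpos_right (hsub ρ (by rwa [uIcc_of_ge h])) ?_
    simpa using hρ.2

end Potential

section Flow

variable {N : ℕ}

/-- A classical solution of the filtration equation `a(u) ∂ₜu = Δu` in `Ω × (0, T]` with values in
`[ε, K]` whose boundary values do not depend on time. The bounds and the boundary condition are
imposed on the closed cylinder. -/
structure IsFiltration (Ω : Set (EuclideanSpace ℝ (Fin N))) (T ε K : ℝ) (a : ℝ → ℝ)
    (u : EuclideanSpace ℝ (Fin N) → ℝ → ℝ) : Prop where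
  isOpen : IsOpen Ω
  isBounded : Bornology.IsBounded Ω
  eps_pos : 0 < ε
  coeff_continuous : ContinuousOn a (Ioi 0)
  coeff_pos : ∀ s, 0 < s → 0 < a s
  regular : IsC21 Ω T u
  continuous : ContinuousOn (fun p : EuclideanSpace ℝ (Fin N) × ℝ => u p.1 p.2)
    (closure Ω ×ˢ Icc 0 T)
  bounds : ∀ x ∈ closure Ω, ∀ t ∈ Icc 0 T, u x t ∈ Icc ε K
  equation : ∀ x ∈ Ω, ∀ t ∈ Ioc 0 T, spaceLaplacian u x t = a (u x t) * timeDeriv T u x t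
  boundary : ∀ x ∈ frontier Ω, ∀ t ∈ Icc 0 T, u x t = u x 0

/-- `v` has the square integrable weak gradient `Dv` in `Ω`. -/
structure HasWeakGradient (Ω : Set (EuclideanSpace ℝ (Fin N)))
    (v : EuclideanSpace ℝ (Fin N) → ℝ) (Dv : EuclideanSpace ℝ (Fin N) → EuclideanSpace ℝ (Fin N)) :
    Prop where
  memLp : MemLp Dv 2 (volume.restrict Ω)
  weak : ∀ φ : EuclideanSpace ℝ (Fin N) → ℝ, ContDiff ℝ ∞ φ → HasCompactSupport φ →
    tsupport φ ⊆ Ω → ∀ e, ∫ x in Ω, fderiv ℝ φ x e * v x = -∫ x in Ω, φ x * inner ℝ (Dv x) e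

variable {Ω : Set (EuclideanSpace ℝ (Fin N))} {T ε K : ℝ} {a : ℝ → ℝ}
  {u : EuclideanSpace ℝ (Fin N) → ℝ → ℝ}

namespace IsFiltration

lemma pos (hu : IsFiltration Ω T ε K a u) {x : EuclideanSpace ℝ (Fin N)} {t : ℝ}
    (hx : x ∈ closure Ω) (ht : t ∈ Icc 0 T) : 0 < u x t :=
  hu.eps_pos.trans_le (hu.bounds x hx t ht).1

lemma isCompact_closure (hu : IsFiltration Ω T ε K a u) : IsCompact (closure Ω) :=
  hu.isBounded.isCompact_closure

lemma volume_lt_top (hu : IsFiltration Ω T ε K a u) : volume Ω < ⊤ :=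
  hu.isBounded.measure_lt_top

lemma continuousOn_space (hu : IsFiltration Ω T ε K a u) {t : ℝ} (ht : t ∈ Icc 0 T) :
    ContinuousOn (fun x => u x t) (closure Ω) :=
  hu.continuous.comp (by fun_prop : Continuous fun x : EuclideanSpace ℝ (Fin N) => (x, t)).continuousOn
    fun _ hx => ⟨hx, ht⟩

lemma continuousOn_time (hu : IsFiltration Ω T ε K a u) {x : EuclideanSpace ℝ (Fin N)}
    (hx : x ∈ closure Ω) : ContinuousOn (u x) (Icc 0 T) :=
  hu.continuous.comp (by fun_prop : Continuous fun t : ℝ => (x, t)).continuousOn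
    fun _ ht => ⟨hx, ht⟩

lemma continuousOn_spaceGrad (hu : IsFiltration Ω T ε K a u) {t : ℝ} (ht : t ∈ Ioc 0 T) :
    ContinuousOn (fun x => spaceGrad u x t) Ω :=
  hu.regular.continuous_grad.comp
    (by fun_prop : Continuous fun x : EuclideanSpace ℝ (Fin N) => (x, t)).continuousOn
    fun _ hx => ⟨hx, ht⟩

lemma hasDerivAt (hu : IsFiltration Ω T ε K a u) {x : EuclideanSpace ℝ (Fin N)} (hx : x ∈ Ω)
    {t : ℝ} (ht : t ∈ Ioo 0 T) : HasDerivAt (u x) (timeDeriv T u x t) t :=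
  ((hu.regular.time x hx t ⟨ht.1, ht.2.le⟩).hasDerivWithinAt).hasDerivAt (Ioc_mem_nhds ht.1 ht.2)

lemma weak_spaceGrad (hu : IsFiltration Ω T ε K a u) {t : ℝ} (ht : t ∈ Ioc 0 T)
    (φ : EuclideanSpace ℝ (Fin N) → ℝ) (hφ : ContDiff ℝ ∞ φ) (hφs : HasCompactSupport φ)
    (hφΩ : tsupport φ ⊆ Ω) (e : EuclideanSpace ℝ (Fin N)) :
    ∫ x in Ω, fderiv ℝ φ x e * u x t = -∫ x in Ω, φ x * inner ℝ (spaceGrad u x t) e := by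
  have h := integral_fderiv_mul_of_contDiffOn (μ := volume) hu.isOpen
    ((hu.regular.space t ht).of_le (by norm_num)) (hφ.of_le (by simp)) hφs hφΩ e
  rw [setIntegral_eq_integral_of_forall_compl_eq_zero, h,
    setIntegral_eq_integral_of_forall_compl_eq_zero]
  · simp_rw [spaceGrad, inner_gradient_left]
  · intro x hx
    rw [image_eq_zero_of_notMem_tsupport fun h => hx (hφΩ h), zero_mul]
  · intro x hx
    have : x ∉ tsupport fun x => fderiv ℝ φ x e := fun h =>
      hx (hφΩ (tsupport_fderiv_apply_subset ℝ e h))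
    rw [image_eq_zero_of_notMem_tsupport this, zero_mul]

/-- The function `u(·, t)` has the weak gradient `∇u(·, t)` as soon as its energy is finite. -/
lemma hasWeakGradient (hu : IsFiltration Ω T ε K a u) {t : ℝ} (ht : t ∈ Ioc 0 T)
    (hE : ∫⁻ x in Ω, ‖spaceGrad u x t‖ₑ ^ 2 ≠ ⊤) :
    HasWeakGradient Ω (fun x => u x t) fun x => spaceGrad u x t where
  memLp := by
    refine ⟨(hu.continuousOn_spaceGrad ht).aestronglyMeasurable hu.isOpen.measurableSet, ?_⟩
    rw [eLpNorm_lt_top_iff_lintegral_rpow_enorm_lt_top (by simp) (by simp)]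
    simpa using hE.lt_top
  weak := hu.weak_spaceGrad ht

/-- Two time slices have the same boundary values, so their difference, extended by zero, has zero
trace. -/
lemma isZeroTrace_sub (hu : IsFiltration Ω T ε K a u) {s t : ℝ} (hs : s ∈ Icc 0 T)
    (ht : t ∈ Icc 0 T) {Ds Dt : EuclideanSpace ℝ (Fin N) → EuclideanSpace ℝ (Fin N)}
    (hDs : HasWeakGradient Ω (fun x => u x s) Ds)
    (hDt : LocallyIntegrableOn Dt Ω)
    (hweak : ∀ φ : EuclideanSpace ℝ (Fin N) → ℝ, ContDiff ℝ ∞ φ → HasCompactSupport φ →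
      tsupport φ ⊆ Ω → ∀ e, ∫ x in Ω, fderiv ℝ φ x e * u x t = -∫ x in Ω, φ x * inner ℝ (Dt x) e) :
    IsZeroTrace volume Ω (Ω.indicator fun x => u x t - u x s) (Ω.indicator fun x => Dt x - Ds x) where
  continuous := by
    refine continuous_indicator (fun x hx => ?_)
      ((hu.continuousOn_space ht).sub (hu.continuousOn_space hs))
    rw [hu.boundary x hx t ht, hu.boundary x hx s hs, sub_self]
  compact := HasCompactSupport.intro hu.isCompact_closure fun x hx =>
    indicator_of_notMem (fun h => hx (subset_closure h)) _
  zero x hx := indicator_of_notMem hx _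
  locInt := by
    rw [locallyIntegrableOn_iff hu.isOpen.isLocallyClosed] at hDt ⊢
    intro k hk hkc
    have : IsFiniteMeasure (volume.restrict Ω) := ⟨by simpa using hu.volume_lt_top⟩
    have h0 : IntegrableOn Ds Ω := hDs.memLp.integrable (by simp)
    have h1 : IntegrableOn Ds k := h0.mono_set hk
    exact ((hDt k hk hkc).sub h1).indicator hu.isOpen.measurableSet
  grad_zero x hx := indicator_of_notMem hx _
  weak φ hφ hφs hφΩ e := by
    have hΩm := hu.isOpen.measurableSet
    have hfd : Continuous fun x => fderiv ℝ φ x e :=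
      (hφ.continuous_fderiv (by simp)).clm_apply continuous_const
    have hfds : tsupport (fun x => fderiv ℝ φ x e) ⊆ Ω :=
      (tsupport_fderiv_apply_subset ℝ e).trans hφΩ
    have hint : ∀ {r : ℝ}, r ∈ Icc 0 T → IntegrableOn (fun x => fderiv ℝ φ x e * u x r) Ω :=
      fun hr => (integrable_mul_of_locallyIntegrableOn hfd (hasCompactSupport_fderiv_apply hφs e) hfds
        (((hu.continuousOn_space hr).mono subset_closure).locallyIntegrableOn hΩm)).integrableOn
    have hDsl : LocallyIntegrableOn Ds Ω := by
      have : IsFiniteMeasure (volume.restrict Ω) := ⟨by simpa using hu.volume_lt_top⟩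
      exact (IntegrableOn.locallyIntegrableOn (hDs.memLp.integrable (by simp)))
    have hint2 : ∀ {D : EuclideanSpace ℝ (Fin N) → EuclideanSpace ℝ (Fin N)},
        LocallyIntegrableOn D Ω → IntegrableOn (fun x => φ x * inner ℝ (D x) e) Ω := by
      intro D hD
      refine (integrable_mul_of_locallyIntegrableOn hφ.continuous hφs hφΩ ?_).integrableOn
      rw [locallyIntegrableOn_iff hu.isOpen.isLocallyClosed] at hD ⊢
      exact fun k hk hkc => (hD k hk hkc).inner_const e
    have e1 : ∀ x, fderiv ℝ φ x e * Ω.indicator (fun x => u x t - u x s) x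
        = Ω.indicator (fun x => fderiv ℝ φ x e * u x t - fderiv ℝ φ x e * u x s) x := by
      intro x; by_cases hx : x ∈ Ω <;> simp [hx, mul_sub]
    have e2 : ∀ x, φ x * inner ℝ (Ω.indicator (fun x => Dt x - Ds x) x) e
        = Ω.indicator (fun x => φ x * inner ℝ (Dt x) e - φ x * inner ℝ (Ds x) e) x := by
      intro x; by_cases hx : x ∈ Ω <;> simp [hx, mul_sub, inner_sub_left]
    simp_rw [e1, e2]
    rw [integral_indicator hΩm, integral_indicator hΩm, integral_sub (hint ht) (hint hs),
      integral_sub (hint2 hDt) (hint2 hDsl), hweak φ hφ hφs hφΩ e, hDs.weak φ hφ hφs hφΩ e]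
    ring

end IsFiltration
end Flow

/-! ### The truncated energy inequality -/

section Flow

variable {N : ℕ} {Ω : Set (EuclideanSpace ℝ (Fin N))} {T ε K : ℝ} {a : ℝ → ℝ}
  {u : EuclideanSpace ℝ (Fin N) → ℝ → ℝ}

namespace IsFiltration

/-- The truncated difference of two slices is supported in a compact subset of `Ω` that does not
depend on time, because all slices have the same boundary values. -/
lemma exists_isCompact_trunc_eq_zero (hu : IsFiltration Ω T ε K a u) {s : ℝ} (hs : s ∈ Icc 0 T)
    (n : ℕ) : ∃ Q ⊆ Ω, IsCompact Q ∧ ∀ x ∈ Ω, x ∉ Q → ∀ r ∈ Icc 0 T,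
      trunc n (u x r - u x s) = 0 ∧ truncDeriv n (u x r - u x s) = 0 := by
  have hcs : ContinuousOn (fun p : EuclideanSpace ℝ (Fin N) × ℝ => u p.1 s) (closure Ω ×ˢ Icc 0 T) :=
    (hu.continuousOn_space hs).comp continuousOn_fst fun p hp => hp.1
  have hcl := ((hu.continuous.sub hcs).abs).preimage_isClosed_of_isClosed
    (isClosed_closure.prod isClosed_Icc) (isClosed_Ici (a := 1 / ((n : ℝ) + 1)))
  have hcpt := ((hu.isCompact_closure.prod (isCompact_Icc (a := (0 : ℝ)) (b := T)))).of_isClosed_subset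
    hcl inter_subset_left
  refine ⟨_, ?_, hcpt.image continuous_fst, ?_⟩
  · rintro _ ⟨⟨x, r⟩, ⟨⟨hx, hr⟩, hxr⟩, rfl⟩
    by_contra hxΩ
    have hxf : x ∈ frontier Ω := ⟨hx, fun h => hxΩ (interior_subset h)⟩
    have hxr' : 1 / ((n : ℝ) + 1) ≤ |u x r - u x s| := hxr
    rw [hu.boundary x hxf r hr, hu.boundary x hxf s hs, sub_self, abs_zero] at hxr'
    have : (0 : ℝ) < 1 / (n + 1) := by positivity
    linarith
  · intro x hx hxQ r hr
    have hle : |u x r - u x s| ≤ 1 / (n + 1) := by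
      by_contra hlt
      exact hxQ ⟨(x, r), ⟨⟨subset_closure hx, hr⟩, (not_le.1 hlt).le⟩, rfl⟩
    exact ⟨trunc_eq_zero hle, truncDeriv_eq_zero hle⟩

lemma integrableOn_of_continuousOn (hu : IsFiltration Ω T ε K a u) {s t : ℝ} (hs : 0 < s)
    (ht : t ≤ T) {f : EuclideanSpace ℝ (Fin N) × ℝ → ℝ} (hf : ContinuousOn f (Ω ×ˢ Ioc 0 T))
    {Q : Set (EuclideanSpace ℝ (Fin N))} (hQΩ : Q ⊆ Ω) (hQ : IsCompact Q)
    (hfQ : ∀ x ∈ Ω, x ∉ Q → ∀ r ∈ Icc 0 T, f (x, r) = 0) :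
    IntegrableOn f (Ω ×ˢ Ioc s t) := by
  have h1 : IntegrableOn f (Q ×ˢ Icc s t) :=
    (hf.mono (prod_mono hQΩ fun r hr => ⟨hs.trans_le hr.1, hr.2.trans ht⟩)).integrableOn_compact
      (hQ.prod isCompact_Icc)
  refine (h1.of_forall_sdiff_eq_zero (hu.isOpen.measurableSet.prod measurableSet_Ioc)) ?_
  rintro ⟨x, r⟩ ⟨⟨hx, hr⟩, hn⟩
  refine hfQ x hx (fun hxQ => hn ⟨hxQ, hr.1.le, hr.2⟩) r ⟨hs.le.trans hr.1.le, hr.2.trans ht⟩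

/-- Green's identity for a time slice, tested with the truncated difference to the slice at
time `s`. -/
lemma setIntegral_timeDeriv_mul_trunc (hu : IsFiltration Ω T ε K a u) {s r : ℝ}
    {Dv : EuclideanSpace ℝ (Fin N) → EuclideanSpace ℝ (Fin N)} (hz : IsZeroTrace volume Ω
      (Ω.indicator fun x => u x r - u x s) (Ω.indicator fun x => spaceGrad u x r - Dv x)) (n : ℕ)
    {q : ℝ} (hq : q ∈ Ioc 0 T) :
    ∫ x in Ω, a (u x q) * timeDeriv T u x q * trunc n (u x r - u x s)
      = -∫ x in Ω, truncDeriv n (u x r - u x s) * inner ℝ (spaceGrad u x q) (spaceGrad u x r - Dv x) := by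
  have h := hz.setIntegral_laplacian_mul_trunc hu.isOpen n (hu.regular.space q hq)
  have hΩm := hu.isOpen.measurableSet
  rw [setIntegral_congr_fun hΩm (g := fun x => Laplacian.laplacian (fun y => u y q) x
    * trunc n (Ω.indicator (fun x => u x r - u x s) x)), h]
  · congr 1
    refine setIntegral_congr_fun hΩm fun x hx => ?_
    simp only [indicator_of_mem hx]
    rfl
  · intro x hx
    simp only [indicator_of_mem hx]
    rw [← hu.equation x hx q hq]
    rfl

lemma continuousOn_sub_slice (hu : IsFiltration Ω T ε K a u) {s : ℝ} (hs : s ∈ Icc 0 T) :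
    ContinuousOn (fun p : EuclideanSpace ℝ (Fin N) × ℝ => u p.1 p.2 - u p.1 s)
      (closure Ω ×ˢ Icc 0 T) :=
  hu.continuous.sub ((hu.continuousOn_space hs).comp continuousOn_fst fun _ hp => hp.1)

lemma prod_subset (Ω : Set (EuclideanSpace ℝ (Fin N))) (T : ℝ) :
    Ω ×ˢ Ioc 0 T ⊆ closure Ω ×ˢ Icc 0 T := prod_mono subset_closure Ioc_subset_Icc_self

lemma locallyIntegrableOn_spaceGrad (hu : IsFiltration Ω T ε K a u) {t : ℝ} (ht : t ∈ Ioc 0 T) :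
    LocallyIntegrableOn (fun x => spaceGrad u x t) Ω :=
  (hu.continuousOn_spaceGrad ht).locallyIntegrableOn hu.isOpen.measurableSet

lemma isZeroTrace_spaceGrad_sub (hu : IsFiltration Ω T ε K a u) {s t : ℝ} (hs : s ∈ Icc 0 T)
    (ht : t ∈ Ioc 0 T) {Dv : EuclideanSpace ℝ (Fin N) → EuclideanSpace ℝ (Fin N)}
    (hDv : HasWeakGradient Ω (fun x => u x s) Dv) :
    IsZeroTrace volume Ω (Ω.indicator fun x => u x t - u x s)
      (Ω.indicator fun x => spaceGrad u x t - Dv x) :=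
  hu.isZeroTrace_sub hs (Ioc_subset_Icc_self ht) hDv (hu.locallyIntegrableOn_spaceGrad ht)
    (hu.weak_spaceGrad ht)

/-- The chain rule for the potential along the solution. -/
lemma integral_timeDeriv_mul_trunc (hu : IsFiltration Ω T ε K a u) {s s' t : ℝ} (hs : s ∈ Icc 0 T)
    (hs' : 0 < s') (hst : s' ≤ t) (ht : t ≤ T) (n : ℕ) {x : EuclideanSpace ℝ (Fin N)} (hx : x ∈ Ω) :
    ∫ r in Ioc s' t, a (u x r) * timeDeriv T u x r * trunc n (u x r - u x s)
      = potential a (trunc n) (u x s) (u x t) - potential a (trunc n) (u x s) (u x s') := by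
  have hxc := subset_closure hx
  have hsub : Icc s' t ⊆ Icc 0 T := Icc_subset_Icc hs'.le ht
  have hpos : ∀ r ∈ Icc s' t, 0 < u x r := fun r hr => hu.pos hxc (hsub hr)
  have hcu : ContinuousOn (u x) (Icc s' t) := (hu.continuousOn_time hxc).mono hsub
  have hd : ∀ r ∈ Icc s' t, HasDerivAt (potential a (trunc n) (u x s))
      (a (u x r) * trunc n (u x r - u x s)) (u x r) := fun r hr =>
    hasDerivAt_potential hu.coeff_continuous (continuous_trunc n) (hu.pos hxc hs) (hpos r hr)
  have hct : ContinuousOn (fun r => timeDeriv T u x r) (Icc s' t) :=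
    hu.regular.continuous_time.comp (by fun_prop : Continuous fun r : ℝ => (x, r)).continuousOn
      fun r hr => ⟨hx, hs'.trans_le hr.1, hr.2.trans ht⟩
  rw [← intervalIntegral.integral_of_le hst]
  refine intervalIntegral.integral_eq_sub_of_hasDerivAt_of_le hst
    (f := fun r => potential a (trunc n) (u x s) (u x r)) ?_ ?_ ?_
  · exact fun r hr => (hd r hr).continuousAt.comp_continuousWithinAt (hcu r hr)
  · intro r hr
    have := (hd r (Ioo_subset_Icc_self hr)).comp r
      (hu.hasDerivAt hx ⟨hs'.trans hr.1, hr.2.trans_le ht⟩)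
    exact this.congr_deriv (by ring)
  · refine ContinuousOn.intervalIntegrable ?_
    rw [uIcc_of_le hst]
    refine ((hu.coeff_continuous.comp hcu fun r hr => hpos r hr).mul hct).mul ?_
    exact (continuous_trunc n).comp_continuousOn (hcu.sub continuousOn_const)

lemma integrableOn_timeDeriv_mul_trunc (hu : IsFiltration Ω T ε K a u) {s s' t : ℝ}
    (hs : s ∈ Icc 0 T) (hs' : 0 < s') (ht : t ≤ T) (n : ℕ) :
    IntegrableOn (fun z : EuclideanSpace ℝ (Fin N) × ℝ =>
      a (u z.1 z.2) * timeDeriv T u z.1 z.2 * trunc n (u z.1 z.2 - u z.1 s)) (Ω ×ˢ Ioc s' t) := by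
  obtain ⟨Q, hQΩ, hQ, hQ0⟩ := hu.exists_isCompact_trunc_eq_zero hs n
  have hw := (hu.continuousOn_sub_slice hs).mono (prod_subset Ω T)
  have hT := (continuous_trunc n).comp_continuousOn hw
  have hau : ContinuousOn (fun p : EuclideanSpace ℝ (Fin N) × ℝ => a (u p.1 p.2)) (Ω ×ˢ Ioc 0 T) :=
    hu.coeff_continuous.comp (hu.continuous.mono (prod_subset Ω T)) fun p hp =>
      hu.pos (prod_subset Ω T hp).1 (prod_subset Ω T hp).2
  exact hu.integrableOn_of_continuousOn hs' ht ((hau.mul hu.regular.continuous_time).mul hT) hQΩ hQ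
    fun x hx hxQ r hr => by simp only [(hQ0 x hx hxQ r hr).1, mul_zero]

lemma integrable_potential_sub (hu : IsFiltration Ω T ε K a u) {s s' t : ℝ} (hs : s ∈ Icc 0 T)
    (hs' : 0 < s') (hst : s' ≤ t) (ht : t ≤ T) (n : ℕ) :
    IntegrableOn (fun x => potential a (trunc n) (u x s) (u x t)
      - potential a (trunc n) (u x s) (u x s')) Ω := by
  have h := hu.integrableOn_timeDeriv_mul_trunc hs hs' ht n
  rw [IntegrableOn, Measure.volume_eq_prod, ← Measure.prod_restrict] at h
  refine h.integral_prod_left.congr ?_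
  filter_upwards [ae_restrict_mem hu.isOpen.measurableSet] with x hx
  exact hu.integral_timeDeriv_mul_trunc hs hs' hst ht n hx

/-- The truncated energy inequality on a time interval away from the initial time. -/
lemma integral_truncDeriv_mul_le (hu : IsFiltration Ω T ε K a u) {s s' t : ℝ} (hs : s ∈ Icc 0 T)
    (hs' : 0 < s') (hst : s' ≤ t) (ht : t ≤ T)
    {Dv : EuclideanSpace ℝ (Fin N) → EuclideanSpace ℝ (Fin N)}
    (hDv : HasWeakGradient Ω (fun x => u x s) Dv) (n : ℕ) :
    IntegrableOn (fun z => truncDeriv n (u z.1 z.2 - u z.1 s) * ‖spaceGrad u z.1 z.2‖ ^ 2)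
        (Ω ×ˢ Ioc s' t) ∧
    (∫ z in Ω ×ˢ Ioc s' t, truncDeriv n (u z.1 z.2 - u z.1 s) * ‖spaceGrad u z.1 z.2‖ ^ 2)
      + 2 * ∫ x in Ω, (potential a (trunc n) (u x s) (u x t)
          - potential a (trunc n) (u x s) (u x s'))
      ≤ ∫ z in Ω ×ˢ Ioc s' t, truncDeriv n (u z.1 z.2 - u z.1 s) * ‖Dv z.1‖ ^ 2 := by
  obtain ⟨Q, hQΩ, hQ, hQ0⟩ := hu.exists_isCompact_trunc_eq_zero hs n
  have hΩm := hu.isOpen.measurableSet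
  have hAm : MeasurableSet (Ω ×ˢ Ioc s' t) := hΩm.prod measurableSet_Ioc
  have hAsub : Ω ×ˢ Ioc s' t ⊆ Ω ×ˢ Ioc 0 T :=
    prod_mono subset_rfl fun r hr => ⟨hs'.trans hr.1, hr.2.trans ht⟩
  have hw := (hu.continuousOn_sub_slice hs).mono (prod_subset Ω T)
  have hT' := (continuous_truncDeriv n).comp_continuousOn hw
  have hX := hu.regular.continuous_grad
  have i1 := hu.integrableOn_timeDeriv_mul_trunc hs hs' ht n
  have i2 : IntegrableOn (fun z : EuclideanSpace ℝ (Fin N) × ℝ =>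
      truncDeriv n (u z.1 z.2 - u z.1 s) * ‖spaceGrad u z.1 z.2‖ ^ 2) (Ω ×ˢ Ioc s' t) :=
    hu.integrableOn_of_continuousOn hs' ht (hT'.mul (hX.norm.pow 2)) hQΩ hQ
      fun x hx hxQ r hr => by simp only [(hQ0 x hx hxQ r hr).2, zero_mul]
  have hT'm : AEStronglyMeasurable (fun z : EuclideanSpace ℝ (Fin N) × ℝ =>
      truncDeriv n (u z.1 z.2 - u z.1 s)) (volume.restrict (Ω ×ˢ Ioc s' t)) :=
    (hT'.mono hAsub).aestronglyMeasurable hAm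
  have hXm : AEStronglyMeasurable (fun z : EuclideanSpace ℝ (Fin N) × ℝ => spaceGrad u z.1 z.2)
      (volume.restrict (Ω ×ˢ Ioc s' t)) :=
    (hX.mono hAsub).aestronglyMeasurable hAm
  have hprod : (volume : Measure (EuclideanSpace ℝ (Fin N) × ℝ)).restrict (Ω ×ˢ Ioc s' t)
      = (volume.restrict Ω).prod (volume.restrict (Ioc s' t)) := by
    rw [Measure.prod_restrict, Measure.volume_eq_prod]
  have hDvm : AEStronglyMeasurable (fun z : EuclideanSpace ℝ (Fin N) × ℝ => Dv z.1)
      (volume.restrict (Ω ×ˢ Ioc s' t)) := by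
    rw [hprod]
    exact hDv.memLp.aestronglyMeasurable.comp_fst
  have iD : IntegrableOn (fun z : EuclideanSpace ℝ (Fin N) × ℝ => ‖Dv z.1‖ ^ 2) (Ω ×ˢ Ioc s' t) := by
    rw [IntegrableOn, hprod]
    exact (hDv.memLp.integrable_norm_pow (by simp)).comp_fst _
  have i3 : IntegrableOn (fun z : EuclideanSpace ℝ (Fin N) × ℝ =>
      truncDeriv n (u z.1 z.2 - u z.1 s) * ‖Dv z.1‖ ^ 2) (Ω ×ˢ Ioc s' t) :=
    iD.bdd_mul (c := 1) hT'm (ae_of_all _ fun z => by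
      rw [Real.norm_of_nonneg (truncDeriv_nonneg _ _)]; exact truncDeriv_le_one _ _)
  have hyoung : ∀ X D : EuclideanSpace ℝ (Fin N), |inner ℝ X D| ≤ (‖X‖ ^ 2 + ‖D‖ ^ 2) / 2 := by
    intro X D
    have := abs_real_inner_le_norm X D
    nlinarith [sq_nonneg (‖X‖ - ‖D‖)]
  have i4 : IntegrableOn (fun z : EuclideanSpace ℝ (Fin N) × ℝ =>
      truncDeriv n (u z.1 z.2 - u z.1 s)
        * inner ℝ (spaceGrad u z.1 z.2) (spaceGrad u z.1 z.2 - Dv z.1)) (Ω ×ˢ Ioc s' t) := by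
    have hc : IntegrableOn (fun z : EuclideanSpace ℝ (Fin N) × ℝ =>
      truncDeriv n (u z.1 z.2 - u z.1 s) * inner ℝ (spaceGrad u z.1 z.2) (Dv z.1))
        (Ω ×ˢ Ioc s' t) := by
      refine Integrable.mono' ((i2.add i3).div_const 2) (hT'm.mul (hXm.inner hDvm))
        (ae_of_all _ fun z => ?_)
      rw [norm_mul, Real.norm_of_nonneg (truncDeriv_nonneg _ _), Real.norm_eq_abs]
      have := mul_le_mul_of_nonneg_left (hyoung (spaceGrad u z.1 z.2) (Dv z.1))
        (truncDeriv_nonneg n (u z.1 z.2 - u z.1 s))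
      simp only [Pi.add_apply]
      linarith
    refine (i2.sub hc).congr (ae_of_all _ fun z => ?_)
    simp only [Pi.sub_apply, inner_sub_right, real_inner_self_eq_norm_sq]
    ring
  have e1 : ∫ z in Ω ×ˢ Ioc s' t,
      a (u z.1 z.2) * timeDeriv T u z.1 z.2 * trunc n (u z.1 z.2 - u z.1 s)
      = ∫ x in Ω, (potential a (trunc n) (u x s) (u x t)
          - potential a (trunc n) (u x s) (u x s')) := by
    rw [IntegrableOn, hprod] at i1
    rw [hprod, integral_prod _ i1]
    refine setIntegral_congr_fun hΩm fun x hx => ?_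
    exact hu.integral_timeDeriv_mul_trunc hs hs' hst ht n hx
  have e2 : ∫ z in Ω ×ˢ Ioc s' t,
      a (u z.1 z.2) * timeDeriv T u z.1 z.2 * trunc n (u z.1 z.2 - u z.1 s)
      = -∫ z in Ω ×ˢ Ioc s' t, truncDeriv n (u z.1 z.2 - u z.1 s)
        * inner ℝ (spaceGrad u z.1 z.2) (spaceGrad u z.1 z.2 - Dv z.1) := by
    rw [IntegrableOn, hprod] at i1 i4
    rw [hprod, integral_prod_symm _ i1, integral_prod_symm _ i4, ← integral_neg]
    refine setIntegral_congr_fun measurableSet_Ioc fun r hr => ?_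
    have hr' : r ∈ Ioc 0 T := ⟨hs'.trans hr.1, hr.2.trans ht⟩
    exact hu.setIntegral_timeDeriv_mul_trunc (hu.isZeroTrace_spaceGrad_sub hs hr' hDv) n hr'
  refine ⟨i2, ?_⟩
  have h4 : ∫ z in Ω ×ˢ Ioc s' t,
        ((truncDeriv n (u z.1 z.2 - u z.1 s) * ‖spaceGrad u z.1 z.2‖ ^ 2)
          - truncDeriv n (u z.1 z.2 - u z.1 s) * ‖Dv z.1‖ ^ 2)
      ≤ ∫ z in Ω ×ˢ Ioc s' t, 2 * (truncDeriv n (u z.1 z.2 - u z.1 s)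
        * inner ℝ (spaceGrad u z.1 z.2) (spaceGrad u z.1 z.2 - Dv z.1)) := by
    refine integral_mono (i2.sub i3) (i4.const_mul 2) fun z => ?_
    have h := (abs_le.1 (hyoung (spaceGrad u z.1 z.2) (Dv z.1))).2
    simp only [inner_sub_right, real_inner_self_eq_norm_sq]
    nlinarith [truncDeriv_nonneg n (u z.1 z.2 - u z.1 s)]
  rw [integral_sub i2 i3, integral_const_mul] at h4
  rw [← e1, e2]
  linarith

end IsFiltration
end Flow

/-! ### The fundamental energy inequality -/

section Flow

variable {N : ℕ} {Ω : Set (EuclideanSpace ℝ (Fin N))} {T ε K : ℝ} {a : ℝ → ℝ}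
  {u : EuclideanSpace ℝ (Fin N) → ℝ → ℝ}

namespace IsFiltration

lemma exists_abs_potential_le (hu : IsFiltration Ω T ε K a u) :
    ∃ B, ∀ x ∈ closure Ω, ∀ s ∈ Icc 0 T, ∀ t ∈ Icc 0 T, potential a id (u x s) (u x t) ≤ B := by
  have hc : ContinuousOn (fun z : ℝ × ℝ => potential a id z.1 z.2) (Icc ε K ×ˢ Icc ε K) :=
    (continuousOn_potential_id hu.coeff_continuous).mono
      (prod_mono (fun x hx => hu.eps_pos.trans_le hx.1) fun x hx => hu.eps_pos.trans_le hx.1)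
  obtain ⟨B, hB⟩ := (isCompact_Icc.prod isCompact_Icc).exists_bound_of_continuousOn hc
  exact ⟨B, fun x hx s hs t ht => (le_abs_self _).trans
    (hB (u x s, u x t) ⟨hu.bounds x hx s hs, hu.bounds x hx t ht⟩)⟩

lemma continuousOn_potential_slices (hu : IsFiltration Ω T ε K a u) {s t : ℝ} (hs : s ∈ Icc 0 T)
    (ht : t ∈ Icc 0 T) : ContinuousOn (fun x => potential a id (u x s) (u x t)) (closure Ω) :=
  (continuousOn_potential_id hu.coeff_continuous).comp
    ((hu.continuousOn_space hs).prodMk (hu.continuousOn_space ht))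
    fun _ hx => ⟨hu.pos hx hs, hu.pos hx ht⟩

lemma tendsto_potential_moving (hu : IsFiltration Ω T ε K a u) {s : ℝ} (hs : s ∈ Icc 0 T)
    {σ : ℕ → ℝ} (hσ : ∀ n, σ n ∈ Icc 0 T) (hσs : Tendsto σ atTop (𝓝 s))
    {x : EuclideanSpace ℝ (Fin N)} (hx : x ∈ closure Ω) :
    Tendsto (fun n => potential a (trunc n) (u x s) (u x (σ n))) atTop (𝓝 0) := by
  have h1 : Tendsto (fun n => u x (σ n)) atTop (𝓝 (u x s)) :=
    ((hu.continuousOn_time hx) s hs).tendsto.comp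
      (tendsto_nhdsWithin_iff.2 ⟨hσs, Eventually.of_forall hσ⟩)
  have h2 : Tendsto (fun n => potential a id (u x s) (u x (σ n))) atTop (𝓝 0) := by
    have h3 := (hasDerivAt_potential (S := id) hu.coeff_continuous continuous_id (hu.pos hx hs)
      (hu.pos hx hs)).continuousAt.tendsto.comp h1
    simpa [potential, Function.comp_def] using h3
  refine squeeze_zero (fun n => ?_) (fun n => ?_) h2
  · exact potential_trunc_nonneg hu.coeff_continuous hu.coeff_pos n (hu.pos hx hs) (hu.pos hx (hσ n))
  · exact potential_trunc_le hu.coeff_continuous hu.coeff_pos n (hu.pos hx hs) (hu.pos hx (hσ n))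

/-- The fundamental energy inequality
`∫_s^t ‖∇u(r)‖² dr + 2 ∫_Ω Φ(u(s), u(t)) ≤ (t - s) ‖∇u(s)‖²`, where `Φ(p, q) = ∫_p^q a(ρ)(ρ - p) dρ`.
It is the result of testing the equation with `u(r) - u(s)`, and it needs neither regularity at the
boundary nor, for `s = 0`, at the initial time. -/
theorem lintegral_energy_add_potential_le (hu : IsFiltration Ω T ε K a u) {s t : ℝ} (hs : 0 ≤ s)
    (hst : s < t) (ht : t ≤ T) {Dv : EuclideanSpace ℝ (Fin N) → EuclideanSpace ℝ (Fin N)}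
    (hDv : HasWeakGradient Ω (fun x => u x s) Dv) :
    (∫⁻ r in Ioc s t, ∫⁻ x in Ω, ‖spaceGrad u x r‖ₑ ^ 2)
      + 2 * ENNReal.ofReal (∫ x in Ω, potential a id (u x s) (u x t))
      ≤ ENNReal.ofReal (t - s) * ∫⁻ x in Ω, ‖Dv x‖ₑ ^ 2 := by
  have hsT : s ∈ Icc 0 T := ⟨hs, hst.le.trans ht⟩
  have htT : t ∈ Icc 0 T := ⟨hs.trans hst.le, ht⟩
  have hΩm := hu.isOpen.measurableSet
  set A : Set (EuclideanSpace ℝ (Fin N) × ℝ) := Ω ×ˢ Ioc s t with hA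
  have hAm : MeasurableSet A := hΩm.prod measurableSet_Ioc
  have hAsub : A ⊆ Ω ×ˢ Ioc 0 T :=
    prod_mono subset_rfl fun r hr => ⟨hs.trans_lt hr.1, hr.2.trans ht⟩
  have hprod : (volume : Measure (EuclideanSpace ℝ (Fin N) × ℝ)).restrict A
      = (volume.restrict Ω).prod (volume.restrict (Ioc s t)) := by
    rw [Measure.prod_restrict, Measure.volume_eq_prod]
  -- the set on which the two slices agree
  set Z : Set (EuclideanSpace ℝ (Fin N) × ℝ) :=
    (closure Ω ×ˢ Icc 0 T) ∩ {z | u z.1 z.2 - u z.1 s = 0} with hZ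
  have hZm : MeasurableSet Z :=
    ((hu.continuousOn_sub_slice hsT).preimage_isClosed_of_isClosed
      (isClosed_closure.prod isClosed_Icc) (isClosed_singleton (x := (0 : ℝ)))).measurableSet
  have hZA : ∀ z ∈ A, (z ∈ Z ↔ u z.1 z.2 - u z.1 s = 0) := fun z hz =>
    ⟨fun h => h.2, fun h => ⟨prod_subset Ω T (hAsub hz), h⟩⟩
  have hXm : AEStronglyMeasurable (fun z : EuclideanSpace ℝ (Fin N) × ℝ => spaceGrad u z.1 z.2)
      (volume.restrict A) := (hu.regular.continuous_grad.mono hAsub).aestronglyMeasurable hAm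
  have hDm : AEStronglyMeasurable (fun z : EuclideanSpace ℝ (Fin N) × ℝ => Dv z.1)
      (volume.restrict A) := by
    rw [hprod]; exact hDv.memLp.aestronglyMeasurable.comp_fst
  have hX2 : AEMeasurable (fun z : EuclideanSpace ℝ (Fin N) × ℝ => ‖spaceGrad u z.1 z.2‖ₑ ^ 2)
      (volume.restrict A) := hXm.enorm.pow_const 2
  have hD2 : AEMeasurable (fun z : EuclideanSpace ℝ (Fin N) × ℝ => ‖Dv z.1‖ₑ ^ 2)
      (volume.restrict A) := hDm.enorm.pow_const 2
  have iD : IntegrableOn (fun z : EuclideanSpace ℝ (Fin N) × ℝ => ‖Dv z.1‖ ^ 2) A := by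
    rw [IntegrableOn, hprod]
    exact (hDv.memLp.integrable_norm_pow (by simp)).comp_fst _
  -- on the set where the slices agree, so do the gradients
  have hagree : ∫⁻ z in A, Z.indicator (fun z => ‖spaceGrad u z.1 z.2‖ₑ ^ 2) z
      = ∫⁻ z in A, Z.indicator (fun z => ‖Dv z.1‖ₑ ^ 2) z := by
    have h1 := hX2.indicator hZm
    have h2 := hD2.indicator hZm
    rw [hprod] at h1 h2 ⊢
    rw [lintegral_prod_symm _ h1, lintegral_prod_symm _ h2]
    refine setLIntegral_congr_fun measurableSet_Ioc fun r hr => ?_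
    have hr' : r ∈ Ioc 0 T := ⟨hs.trans_lt hr.1, hr.2.trans ht⟩
    refine lintegral_congr_ae ?_
    have h3 := (hu.isZeroTrace_spaceGrad_sub hsT hr' hDv).ae_grad_eq_zero hu.isOpen
    filter_upwards [ae_restrict_of_ae h3, ae_restrict_mem hΩm] with x hx hxΩ
    rw [indicator_of_mem hxΩ, indicator_of_mem hxΩ] at hx
    by_cases hz : (x, r) ∈ Z
    · rw [indicator_of_mem hz, indicator_of_mem hz]
      simp only
      rw [sub_eq_zero.1 (hx hz.2)]
    · rw [indicator_of_notMem hz, indicator_of_notMem hz]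
  -- on the complement, the truncated inequalities have a limit
  set g := ∫ x in Ω, potential a id (u x s) (u x t) with hg
  set J := ∫ z in A, Zᶜ.indicator (fun z => ‖Dv z.1‖ ^ 2) z with hJ
  have hJi : IntegrableOn (Zᶜ.indicator fun z : EuclideanSpace ℝ (Fin N) × ℝ => ‖Dv z.1‖ ^ 2) A :=
    iD.indicator hZm.compl
  -- the truncated inequality is used from the times `σ n`, since `s` may be the initial time
  let σ : ℕ → ℝ := fun n => s + (t - s) / (n + 2)
  have hσ_gt : ∀ n, s < σ n := fun n => by
    have : 0 < (t - s) / ((n : ℝ) + 2) := div_pos (by linarith) (by positivity)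
    simp only [σ]; linarith
  have hσ_le : ∀ n, σ n ≤ t := fun n => by
    have : (t - s) / ((n : ℝ) + 2) ≤ t - s := div_le_self (by linarith) (by
      have : (0 : ℝ) ≤ n := Nat.cast_nonneg n
      linarith)
    simp only [σ]; linarith
  have hσ_lim : Tendsto σ atTop (𝓝 s) := by
    have : Tendsto (fun n : ℕ => (t - s) / ((n : ℝ) + 2)) atTop (𝓝 0) :=
      tendsto_const_nhds.div_atTop (tendsto_atTop_add_const_right _ _ tendsto_natCast_atTop_atTop)
    simpa [σ] using this.const_add s
  have hσT : ∀ n, σ n ∈ Icc 0 T := fun n => ⟨hs.trans (hσ_gt n).le, (hσ_le n).trans ht⟩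
  let P : ℕ → ℝ := fun n => ∫ x in Ω, (potential a (trunc n) (u x s) (u x t)
    - potential a (trunc n) (u x s) (u x (σ n)))
  obtain ⟨B, hB⟩ := hu.exists_abs_potential_le
  have hP : Tendsto P atTop (𝓝 g) := by
    have : IsFiniteMeasure (volume.restrict Ω) := ⟨by simpa using hu.volume_lt_top⟩
    have hlim : ∀ x ∈ Ω, Tendsto (fun n => potential a (trunc n) (u x s) (u x t)
        - potential a (trunc n) (u x s) (u x (σ n))) atTop (𝓝 (potential a id (u x s) (u x t))) := by
      intro x hx
      have hxc := subset_closure hx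
      simpa using (tendsto_potential_trunc hu.coeff_continuous (hu.pos hxc hsT) (hu.pos hxc htT)).sub
        (hu.tendsto_potential_moving hsT hσT hσ_lim hxc)
    refine tendsto_integral_of_dominated_convergence (fun _ => 2 * B) (fun n => ?_)
      (integrable_const _) (fun n => ?_) ?_
    · -- the difference is the integral over time of a jointly measurable function
      have hint := hu.integrable_potential_sub hsT (hs.trans_lt (hσ_gt n)) (hσ_le n) ht n
      exact hint.aestronglyMeasurable
    · filter_upwards [ae_restrict_mem hΩm] with x hx
      have hxc := subset_closure hx
      have hp : ∀ {r : ℝ}, r ∈ Icc 0 T → 0 ≤ potential a (trunc n) (u x s) (u x r) ∧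
          potential a (trunc n) (u x s) (u x r) ≤ B := fun hr =>
        ⟨potential_trunc_nonneg hu.coeff_continuous hu.coeff_pos n (hu.pos hxc hsT) (hu.pos hxc hr),
          (potential_trunc_le hu.coeff_continuous hu.coeff_pos n (hu.pos hxc hsT)
            (hu.pos hxc hr)).trans (hB x hxc s hsT _ hr)⟩
      rw [Real.norm_eq_abs, abs_le]
      constructor <;> linarith [(hp htT).1, (hp htT).2, (hp (hσT n)).1, (hp (hσT n)).2]
    · filter_upwards [ae_restrict_mem hΩm] with x hx using hlim x hx
  have hAn : ∀ n, Ω ×ˢ Ioc (σ n) t ⊆ A := fun n =>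
    prod_mono subset_rfl (Ioc_subset_Ioc_left (hσ_gt n).le)
  have hAnm : ∀ n, MeasurableSet (Ω ×ˢ Ioc (σ n) t) := fun n => hΩm.prod measurableSet_Ioc
  have hineq : ∀ n, (∫ z in Ω ×ˢ Ioc (σ n) t,
      truncDeriv n (u z.1 z.2 - u z.1 s) * ‖spaceGrad u z.1 z.2‖ ^ 2) ≤ J - 2 * P n := by
    intro n
    obtain ⟨-, h1⟩ := hu.integral_truncDeriv_mul_le hsT (hs.trans_lt (hσ_gt n)) (hσ_le n) ht hDv n
    have h2 : ∫ z in Ω ×ˢ Ioc (σ n) t, truncDeriv n (u z.1 z.2 - u z.1 s) * ‖Dv z.1‖ ^ 2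
        ≤ ∫ z in Ω ×ˢ Ioc (σ n) t, Zᶜ.indicator (fun z => ‖Dv z.1‖ ^ 2) z := by
      refine integral_mono_of_nonneg (ae_of_all _ fun z => mul_nonneg (truncDeriv_nonneg _ _)
        (by positivity)) (hJi.mono_set (hAn n)) ?_
      filter_upwards [ae_restrict_mem (hAnm n)] with z hz
      by_cases hzZ : z ∈ Z
      · rw [indicator_of_notMem (by simpa using hzZ), hzZ.2, truncDeriv_zero, zero_mul]
      · rw [indicator_of_mem (by simpa using hzZ)]
        exact mul_le_of_le_one_left (by positivity) (truncDeriv_le_one _ _)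
    have h3 : ∫ z in Ω ×ˢ Ioc (σ n) t, Zᶜ.indicator (fun z => ‖Dv z.1‖ ^ 2) z ≤ J :=
      setIntegral_mono_set hJi (ae_of_all _ fun z => indicator_nonneg (fun _ _ => by positivity) _)
        (hAn n).eventuallyLE
    linarith
  have hlimJ : Tendsto (fun n => J - 2 * P n) atTop (𝓝 (J - 2 * g)) :=
    tendsto_const_nhds.sub (hP.const_mul 2)
  have hJg : 0 ≤ J - 2 * g := ge_of_tendsto' hlimJ fun n =>
    (integral_nonneg fun z => mul_nonneg (truncDeriv_nonneg _ _) (by positivity)).trans (hineq n)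
  have hg0 : 0 ≤ g := setIntegral_nonneg hΩm fun x hx => potential_id_nonneg hu.coeff_continuous
    hu.coeff_pos (hu.pos (subset_closure hx) hsT) (hu.pos (subset_closure hx) htT)
  have hdiffer : ∫⁻ z in A, Zᶜ.indicator (fun z => ‖spaceGrad u z.1 z.2‖ₑ ^ 2) z
      ≤ ENNReal.ofReal (J - 2 * g) := by
    let F : ℕ → EuclideanSpace ℝ (Fin N) × ℝ → ℝ≥0∞ := fun n =>
      (Ω ×ˢ Ioc (σ n) t).indicator fun z => ENNReal.ofReal
        (truncDeriv n (u z.1 z.2 - u z.1 s) * ‖spaceGrad u z.1 z.2‖ ^ 2)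
    have hwc := (hu.continuousOn_sub_slice hsT).mono ((prod_subset Ω T).trans' hAsub)
    have hF : ∀ n, AEMeasurable (F n) (volume.restrict A) := fun n => by
      refine AEMeasurable.indicator ?_ (hAnm n)
      refine ENNReal.measurable_ofReal.comp_aemeasurable ?_
      exact ((((continuous_truncDeriv n).comp_continuousOn hwc).aestronglyMeasurable hAm).mul
        (hXm.norm.pow 2)).aemeasurable
    have hFle : ∀ n, ∫⁻ z in A, F n z ≤ ENNReal.ofReal (J - 2 * P n) := fun n => by
      rw [setLIntegral_indicator (hAnm n), inter_eq_left.2 (hAn n),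
        ← ofReal_integral_eq_lintegral_ofReal]
      · exact ENNReal.ofReal_le_ofReal (hineq n)
      · exact (hu.integral_truncDeriv_mul_le hsT (hs.trans_lt (hσ_gt n)) (hσ_le n) ht hDv n).1
      · exact ae_of_all _ fun z => mul_nonneg (truncDeriv_nonneg _ _) (by positivity)
    calc ∫⁻ z in A, Zᶜ.indicator (fun z => ‖spaceGrad u z.1 z.2‖ₑ ^ 2) z
        ≤ ∫⁻ z in A, liminf (fun n => F n z) atTop := by
          refine setLIntegral_mono_ae' hAm (ae_of_all _ fun z hz => ?_)
          by_cases hzZ : z ∈ Z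
          · rw [indicator_of_notMem (by simpa using hzZ)]; exact zero_le
          · rw [indicator_of_mem (by simpa using hzZ)]
            have hne : u z.1 z.2 - u z.1 s ≠ 0 := fun h => hzZ ((hZA z hz).2 h)
            have hl : Tendsto (fun n => F n z) atTop (𝓝 (‖spaceGrad u z.1 z.2‖ₑ ^ 2)) := by
              have h1 : Tendsto (fun n => ENNReal.ofReal
                  (truncDeriv n (u z.1 z.2 - u z.1 s) * ‖spaceGrad u z.1 z.2‖ ^ 2)) atTop
                  (𝓝 (‖spaceGrad u z.1 z.2‖ₑ ^ 2)) := by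
                have h2 := ENNReal.tendsto_ofReal
                  ((tendsto_truncDeriv hne).mul_const (‖spaceGrad u z.1 z.2‖ ^ 2))
                rwa [one_mul, ENNReal.ofReal_pow (norm_nonneg _), ofReal_norm] at h2
              refine h1.congr' ?_
              filter_upwards [hσ_lim.eventually (gt_mem_nhds hz.2.1)] with n hn
              have hz' : z ∈ Ω ×ˢ Ioc (σ n) t := ⟨hz.1, hn, hz.2.2⟩
              simp only [F, indicator_of_mem hz']
            rw [hl.liminf_eq]
      _ ≤ liminf (fun n => ∫⁻ z in A, F n z) atTop := lintegral_liminf_le' hF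
      _ ≤ liminf (fun n => ENNReal.ofReal (J - 2 * P n)) atTop :=
          liminf_le_liminf (Eventually.of_forall hFle)
      _ = ENNReal.ofReal (J - 2 * g) := (ENNReal.tendsto_ofReal hlimJ).liminf_eq
  have split : ∀ {f : EuclideanSpace ℝ (Fin N) × ℝ → ℝ≥0∞}, AEMeasurable f (volume.restrict A) →
      ∫⁻ z in A, f z = (∫⁻ z in A, Zᶜ.indicator f z) + ∫⁻ z in A, Z.indicator f z := by
    intro f hf
    rw [← lintegral_add_left' (hf.indicator hZm.compl)]
    refine lintegral_congr fun z => ?_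
    rw [add_comm, indicator_self_add_compl_apply]
  have hXA : ∫⁻ r in Ioc s t, ∫⁻ x in Ω, ‖spaceGrad u x r‖ₑ ^ 2
      = ∫⁻ z in A, ‖spaceGrad u z.1 z.2‖ₑ ^ 2 := by
    rw [hprod] at hX2 ⊢
    rw [lintegral_prod_symm _ hX2]
  have hDA : ENNReal.ofReal (t - s) * ∫⁻ x in Ω, ‖Dv x‖ₑ ^ 2 = ∫⁻ z in A, ‖Dv z.1‖ₑ ^ 2 := by
    rw [hprod] at hD2 ⊢
    rw [lintegral_prod_symm _ hD2]
    simp [mul_comm]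
  have hJe : ENNReal.ofReal J = ∫⁻ z in A, Zᶜ.indicator (fun z => ‖Dv z.1‖ₑ ^ 2) z := by
    rw [hJ, ofReal_integral_eq_lintegral_ofReal hJi
      (ae_of_all _ fun z => indicator_nonneg (fun _ _ => by positivity) _)]
    refine lintegral_congr fun z => ?_
    by_cases hz : z ∈ Zᶜ
    · rw [indicator_of_mem hz, indicator_of_mem hz, ENNReal.ofReal_pow (norm_nonneg _), ofReal_norm]
    · rw [indicator_of_notMem hz, indicator_of_notMem hz, ENNReal.ofReal_zero]
  rw [hXA, hDA, split hX2, split hD2, hagree, add_right_comm, ← hJe]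
  gcongr
  calc _ ≤ ENNReal.ofReal (J - 2 * g) + 2 * ENNReal.ofReal g := by gcongr
    _ = ENNReal.ofReal J := by
      rw [show (2 : ℝ≥0∞) = ENNReal.ofReal 2 by simp, ← ENNReal.ofReal_mul (by norm_num),
        ← ENNReal.ofReal_add hJg (by positivity)]
      congr 1; ring

end IsFiltration
end Flow

/-! ### Monotonicity of the energy and the bound for the dissipation -/

/-- A lower semicontinuous function whose mean over every interval `(r, t]` is at most its value at
the left endpoint `r` does not increase from `s` to `t`: otherwise, after the last time `r₀` with
`e r₀ ≤ e s`, the mean over `(r₀, t]` would exceed `e r₀`. -/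
lemma le_of_forall_mean_le {e : ℝ → ℝ≥0∞} {s t : ℝ} (hst : s < t)
    (he : LowerSemicontinuousOn e (Ioc s t)) (hem : AEMeasurable e (volume.restrict (Ioc s t)))
    (hmean : ∀ r ∈ Ico s t, ∫⁻ q in Ioc r t, e q ≤ ENNReal.ofReal (t - r) * e r) : e t ≤ e s := by
  by_contra! hlt
  set c := e s with hc
  have hctop : c ≠ ⊤ := ne_top_of_lt hlt
  set S : Set ℝ := {r | r ∈ Icc s t ∧ e r ≤ c} with hS
  have hsS : s ∈ S := ⟨left_mem_Icc.2 hst.le, le_rfl⟩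
  have hSb : BddAbove S := ⟨t, fun r hr => hr.1.2⟩
  set r₀ := sSup S with hr₀
  have hsr₀ : s ≤ r₀ := le_csSup hSb hsS
  have hr₀t : r₀ ≤ t := csSup_le ⟨s, hsS⟩ fun r hr => hr.1.2
  have hr₀S : e r₀ ≤ c := by
    by_contra! hgt
    have hne : s ≠ r₀ := fun h => by rw [← h] at hgt; exact lt_irrefl _ hgt
    have hsr : s < r₀ := lt_of_le_of_ne hsr₀ hne
    have h1 := he r₀ ⟨hsr, hr₀t⟩ c hgt
    rw [eventually_nhdsWithin_iff, Metric.eventually_nhds_iff] at h1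
    obtain ⟨δ, hδ, h1⟩ := h1
    obtain ⟨r, hrS, hr⟩ := exists_lt_of_lt_csSup ⟨s, hsS⟩
      (show r₀ - min δ (r₀ - s) < sSup S by
        have : 0 < min δ (r₀ - s) := lt_min hδ (by linarith)
        linarith)
    have hrr : r ≤ r₀ := le_csSup hSb hrS
    have hd1 := min_le_left δ (r₀ - s)
    have hd2 := min_le_right δ (r₀ - s)
    have h2 : c < e r := h1 (by rw [Real.dist_eq, abs_lt]; constructor <;> linarith)
      ⟨by linarith, hrS.1.2⟩
    exact absurd hrS.2 (not_le.2 h2)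
  have hr₀lt : r₀ < t := lt_of_le_of_ne hr₀t fun h => by rw [h] at hr₀S; exact absurd hr₀S (not_le.2 hlt)
  have hgt : ∀ r ∈ Ioc r₀ t, c < e r := by
    intro r hr
    by_contra! hle
    exact absurd (le_csSup hSb ⟨⟨hsr₀.trans hr.1.le, hr.2⟩, hle⟩) (not_le.2 hr.1)
  have hstrict : ∫⁻ _ in Ioc r₀ t, c < ∫⁻ q in Ioc r₀ t, e q := by
    refine lintegral_strict_mono ?_ (hem.mono_set (Ioc_subset_Ioc_left hsr₀)) ?_ ?_
    · rw [Ne, Measure.restrict_eq_zero, Real.volume_Ioc, ENNReal.ofReal_eq_zero, not_le]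
      linarith
    · rw [setLIntegral_const, Real.volume_Ioc]
      exact ENNReal.mul_ne_top hctop ENNReal.ofReal_ne_top
    · filter_upwards [ae_restrict_mem measurableSet_Ioc] with r hr using hgt r hr
  have h3 := (hstrict.trans_le (hmean r₀ ⟨hsr₀, hr₀lt⟩)).trans_le (mul_le_mul_right hr₀S _)
  rw [setLIntegral_const, Real.volume_Ioc, mul_comm] at h3
  exact lt_irrefl _ h3

/-- The mean decrease of an antitone function over short steps. The factor `1 / 2` comes from averaging
over the length `θ ∈ (0, η]` of the step. -/
lemma integral_integral_sub_shift_le {f : ℝ → ℝ} (hf : Antitone f) {η τ : ℝ} (hη : 0 ≤ η)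
    (hητ : η ≤ τ) :
    Integrable (fun s => ∫ θ in Ioc 0 η, (f s - f (s + θ))) (volume.restrict (Ioc 0 (τ - η))) ∧
    ∫ s in Ioc 0 (τ - η), ∫ θ in Ioc 0 η, (f s - f (s + θ)) ≤ η ^ 2 / 2 * (f 0 - f τ) := by
  have hfi : ∀ x y, IntervalIntegrable f volume x y := fun x y =>
    (hf.antitoneOn _).intervalIntegrable
  have hint : Integrable (fun z : ℝ × ℝ => f z.1 - f (z.1 + z.2))
      ((volume.restrict (Ioc 0 (τ - η))).prod (volume.restrict (Ioc 0 η))) := by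
    have hm : Measurable fun z : ℝ × ℝ => f z.1 - f (z.1 + z.2) :=
      (hf.measurable.comp measurable_fst).sub (hf.measurable.comp (by fun_prop))
    rw [Measure.prod_restrict]
    refine Measure.integrableOn_of_bounded (M := f 0 - f τ) ?_ hm.aestronglyMeasurable ?_
    · rw [Measure.prod_prod]; simp [ENNReal.mul_eq_top]
    · filter_upwards [ae_restrict_mem (measurableSet_Ioc.prod measurableSet_Ioc)] with z hz
      obtain ⟨⟨h1, h2⟩, h3, h4⟩ := hz
      rw [Real.norm_of_nonneg (sub_nonneg.2 (hf (by linarith)))]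
      exact sub_le_sub (hf h1.le) (hf (by linarith))
  refine ⟨hint.integral_prod_left, ?_⟩
  rw [integral_integral_swap hint]
  have hinner : ∀ θ ∈ Ioc 0 η, ∫ s in Ioc 0 (τ - η), (f s - f (s + θ)) ≤ θ * (f 0 - f τ) := by
    intro θ hθ
    have hshift : IntervalIntegrable (fun s => f (s + θ)) volume 0 (τ - η) := by
      have : Antitone fun s => f (s + θ) := fun x y hxy => hf (by linarith)
      exact (this.antitoneOn _).intervalIntegrable
    rw [← intervalIntegral.integral_of_le (by linarith), intervalIntegral.integral_sub (hfi _ _) hshift,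
      intervalIntegral.integral_comp_add_right f θ, zero_add]
    have e1 : (∫ s in (0 : ℝ)..(τ - η), f s) - ∫ s in θ..(τ - η + θ), f s
        = (∫ s in (0 : ℝ)..θ, f s) - ∫ s in (τ - η)..(τ - η + θ), f s := by
      rw [← intervalIntegral.integral_add_adjacent_intervals (hfi 0 θ) (hfi θ (τ - η)),
        ← intervalIntegral.integral_add_adjacent_intervals (hfi θ (τ - η)) (hfi (τ - η) (τ - η + θ))]
      ring
    have e2 : ∫ s in (0 : ℝ)..θ, f s ≤ θ * f 0 := by
      calc _ ≤ ∫ _ in (0 : ℝ)..θ, f 0 := intervalIntegral.integral_mono_on hθ.1.le (hfi _ _)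
              (by simp) fun s hs => hf hs.1
        _ = θ * f 0 := by simp
    have e3 : θ * f τ ≤ ∫ s in (τ - η)..(τ - η + θ), f s := by
      calc θ * f τ = ∫ _ in (τ - η)..(τ - η + θ), f τ := by simp
        _ ≤ _ := intervalIntegral.integral_mono_on (by linarith [hθ.1]) (by simp) (hfi _ _)
              fun s hs => hf (by linarith [hs.2, hθ.2])
    rw [e1]; linarith
  calc _ ≤ ∫ θ in Ioc 0 η, θ * (f 0 - f τ) := by
        refine setIntegral_mono_on hint.integral_prod_right ?_ measurableSet_Ioc hinner
        exact ((by fun_prop : Continuous fun θ : ℝ => θ * (f 0 - f τ)).integrableOn_Icc).mono_set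
          Ioc_subset_Icc_self
    _ = η ^ 2 / 2 * (f 0 - f τ) := by
        rw [← intervalIntegral.integral_of_le hη, intervalIntegral.integral_mul_const, integral_id]
        ring

section Flow

variable {N : ℕ} {Ω : Set (EuclideanSpace ℝ (Fin N))} {T ε K : ℝ} {a : ℝ → ℝ}
  {u : EuclideanSpace ℝ (Fin N) → ℝ → ℝ}

/-- The spatial gradient of `u` at time `t`; at the initial time, where `u` is not assumed to be
differentiable, it is the given weak gradient `Dg`. -/
noncomputable def sliceGrad (u : EuclideanSpace ℝ (Fin N) → ℝ → ℝ)
    (Dg : EuclideanSpace ℝ (Fin N) → EuclideanSpace ℝ (Fin N)) (t : ℝ)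
    (x : EuclideanSpace ℝ (Fin N)) : EuclideanSpace ℝ (Fin N) :=
  if t = 0 then Dg x else spaceGrad u x t

/-- The Dirichlet energy of the time slice. -/
noncomputable def energy (Ω : Set (EuclideanSpace ℝ (Fin N)))
    (u : EuclideanSpace ℝ (Fin N) → ℝ → ℝ)
    (Dg : EuclideanSpace ℝ (Fin N) → EuclideanSpace ℝ (Fin N)) (t : ℝ) : ℝ≥0∞ :=
  ∫⁻ x in Ω, ‖sliceGrad u Dg t x‖ₑ ^ 2

variable {Dg : EuclideanSpace ℝ (Fin N) → EuclideanSpace ℝ (Fin N)}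

lemma energy_zero : energy Ω u Dg 0 = ∫⁻ x in Ω, ‖Dg x‖ₑ ^ 2 := by simp [energy, sliceGrad]

lemma energy_of_pos {t : ℝ} (ht : 0 < t) :
    energy Ω u Dg t = ∫⁻ x in Ω, ‖spaceGrad u x t‖ₑ ^ 2 := by simp [energy, sliceGrad, ht.ne']

namespace IsFiltration

lemma hasWeakGradient_sliceGrad (hu : IsFiltration Ω T ε K a u)
    (hg : HasWeakGradient Ω (fun x => u x 0) Dg) {s : ℝ} (hs : s ∈ Icc 0 T)
    (hE : energy Ω u Dg s ≠ ⊤) : HasWeakGradient Ω (fun x => u x s) (sliceGrad u Dg s) := by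
  rcases hs.1.eq_or_lt with rfl | h0
  · have : sliceGrad u Dg 0 = Dg := by ext1 x; simp [sliceGrad]
    rwa [this]
  · have : sliceGrad u Dg s = fun x => spaceGrad u x s := by ext1 x; simp [sliceGrad, h0.ne']
    rw [this]
    rw [energy_of_pos h0] at hE
    exact hu.hasWeakGradient ⟨h0, hs.2⟩ hE

/-- The fundamental inequality in terms of the energy, without an assumption of finiteness. -/
lemma lintegral_energy_le (hu : IsFiltration Ω T ε K a u)
    (hg : HasWeakGradient Ω (fun x => u x 0) Dg) {s t : ℝ} (hs : 0 ≤ s) (hst : s < t) (ht : t ≤ T) :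
    (∫⁻ r in Ioc s t, energy Ω u Dg r)
      + 2 * ENNReal.ofReal (∫ x in Ω, potential a id (u x s) (u x t))
      ≤ ENNReal.ofReal (t - s) * energy Ω u Dg s := by
  by_cases hE : energy Ω u Dg s = ⊤
  · rw [hE, ENNReal.mul_top (by simpa using hst)]; exact le_top
  · have h := hu.lintegral_energy_add_potential_le hs hst ht
      (hu.hasWeakGradient_sliceGrad hg ⟨hs, hst.le.trans ht⟩ hE)
    rw [setLIntegral_congr_fun measurableSet_Ioc fun r hr => energy_of_pos (hs.trans_lt hr.1)]
    exact h

/-- Fatou's lemma and the pointwise continuity of the gradient in time. -/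
lemma lowerSemicontinuousOn_energy (hu : IsFiltration Ω T ε K a u) :
    LowerSemicontinuousOn (energy Ω u Dg) (Ioc 0 T) := by
  intro t ht
  refine lowerSemicontinuousWithinAt_iff_le_liminf.2 ?_
  -- off `(0, T]` the slices may fail to be measurable, so they are replaced by zero there
  set f : ℝ → EuclideanSpace ℝ (Fin N) → ℝ≥0∞ := fun r x =>
    (Ioc 0 T).indicator (fun r => ‖spaceGrad u x r‖ₑ ^ 2) r with hf
  have hfr : ∀ r ∈ Ioc 0 T, ∀ x, f r x = ‖spaceGrad u x r‖ₑ ^ 2 := fun r hr x =>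
    indicator_of_mem hr _
  have hfm : ∀ r, AEMeasurable (f r) (volume.restrict Ω) := by
    intro r
    by_cases hr : r ∈ Ioc 0 T
    · rw [funext (hfr r hr)]
      exact (((hu.continuousOn_spaceGrad hr).aestronglyMeasurable
        hu.isOpen.measurableSet).enorm).pow_const 2
    · have : f r = fun _ => 0 := funext fun x => indicator_of_notMem hr _
      rw [this]; exact aemeasurable_const
  have hef : ∀ r ∈ Ioc 0 T, energy Ω u Dg r = ∫⁻ x in Ω, f r x := fun r hr => by
    rw [energy_of_pos hr.1]; exact lintegral_congr fun x => (hfr r hr x).symm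
  have : (𝓝[Ioc 0 T] t).NeBot := mem_closure_iff_nhdsWithin_neBot.1 (subset_closure ht)
  calc energy Ω u Dg t = ∫⁻ x in Ω, f t x := hef t ht
    _ ≤ ∫⁻ x in Ω, liminf (fun r => f r x) (𝓝[Ioc 0 T] t) := by
        refine setLIntegral_mono_ae' hu.isOpen.measurableSet (ae_of_all _ fun x hx => ?_)
        have hc : ContinuousWithinAt (fun r => spaceGrad u x r) (Ioc 0 T) t :=
          (hu.regular.continuous_grad.comp
            (by fun_prop : Continuous fun r : ℝ => (x, r)).continuousOn fun r hr => ⟨hx, hr⟩) t ht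
        have hl : Tendsto (fun r => f r x) (𝓝[Ioc 0 T] t) (𝓝 (f t x)) := by
          rw [hfr t ht]
          refine Tendsto.congr' ?_ ((ENNReal.continuous_pow 2).continuousAt.tendsto.comp
            hc.enorm)
          filter_upwards [self_mem_nhdsWithin] with r hr using (hfr r hr x).symm
        rw [hl.liminf_eq]
    _ ≤ liminf (fun r => ∫⁻ x in Ω, f r x) (𝓝[Ioc 0 T] t) := lintegral_liminf_le' hfm
    _ = liminf (energy Ω u Dg) (𝓝[Ioc 0 T] t) := by
        refine liminf_congr ?_
        filter_upwards [self_mem_nhdsWithin] with r hr using (hef r hr).symm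

lemma aemeasurable_energy (hu : IsFiltration Ω T ε K a u) {s t : ℝ} (hs : 0 ≤ s) (ht : t ≤ T) :
    AEMeasurable (energy Ω u Dg) (volume.restrict (Ioc s t)) := by
  have hsub : Ω ×ˢ Ioc s t ⊆ Ω ×ˢ Ioc 0 T := prod_mono subset_rfl (Ioc_subset_Ioc hs ht)
  have hX : AEMeasurable (fun z : EuclideanSpace ℝ (Fin N) × ℝ => ‖spaceGrad u z.1 z.2‖ₑ ^ 2)
      ((volume.restrict Ω).prod (volume.restrict (Ioc s t))) := by
    rw [Measure.prod_restrict]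
    exact (((hu.regular.continuous_grad.mono hsub).aestronglyMeasurable
      (hu.isOpen.measurableSet.prod measurableSet_Ioc)).enorm).pow_const 2
  refine hX.lintegral_prod_left'.congr ?_
  filter_upwards [ae_restrict_mem measurableSet_Ioc] with r hr
  exact (energy_of_pos (hs.trans_lt hr.1)).symm

lemma energy_antitoneOn (hu : IsFiltration Ω T ε K a u)
    (hg : HasWeakGradient Ω (fun x => u x 0) Dg) : AntitoneOn (energy Ω u Dg) (Icc 0 T) := by
  intro s hs t ht hst
  rcases hst.eq_or_lt with rfl | hlt
  · exact le_rfl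
  · refine le_of_forall_mean_le hlt
      (hu.lowerSemicontinuousOn_energy.mono fun r hr => ⟨hs.1.trans_lt hr.1, hr.2.trans ht.2⟩)
      (hu.aemeasurable_energy hs.1 ht.2) fun r hr => ?_
    exact le_self_add.trans (hu.lintegral_energy_le hg (hs.1.trans hr.1) hr.2 ht.2)

/-- One half of the energy identity. Averaging the fundamental inequality on `(s, s + η]` over `s`
gives `∬ Φ(u(s), u(s + η)) / η² ≤ (E(0) - E(τ)) / 4`, and `Φ(u(s), u(s + η)) / η²` tends to
`a(u) (∂ₜu)² / 2` as `η → 0`. -/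
theorem dissipation_add_energy_le (hu : IsFiltration Ω T ε K a u)
    (hg : HasWeakGradient Ω (fun x => u x 0) Dg) {τ : ℝ} (hτ : τ ∈ Ioc 0 T) :
    2 * (∫⁻ s in Ioc 0 τ, ∫⁻ x in Ω, ENNReal.ofReal (a (u x s) * timeDeriv T u x s ^ 2))
      + energy Ω u Dg τ ≤ energy Ω u Dg 0 := by
  have hΩm := hu.isOpen.measurableSet
  have hE0 : energy Ω u Dg 0 ≠ ⊤ := by
    rw [energy_zero, lintegral_enorm_sq_eq hg.memLp]; exact ENNReal.ofReal_ne_top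
  have hT0 : (0 : ℝ) ≤ T := hτ.1.le.trans hτ.2
  have hanti := hu.energy_antitoneOn hg
  have hEtop : ∀ r ∈ Icc 0 T, energy Ω u Dg r ≠ ⊤ := fun r hr =>
    ne_top_of_le_ne_top hE0 (hanti ⟨le_rfl, hT0⟩ hr hr.1)
  -- the energy as a real function, extended by constants to an antitone function on the line
  set f : ℝ → ℝ := fun r => (energy Ω u Dg (max 0 (min r T))).toReal with hf
  have hclamp : ∀ r, max 0 (min r T) ∈ Icc 0 T := fun r =>
    ⟨le_max_left _ _, max_le hT0 (min_le_right _ _)⟩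
  have hfanti : Antitone f := fun r q hrq =>
    ENNReal.toReal_mono (hEtop _ (hclamp r)) (hanti (hclamp r) (hclamp q) (by gcongr))
  have hfE : ∀ r ∈ Icc 0 T, ENNReal.ofReal (f r) = energy Ω u Dg r := fun r hr => by
    rw [hf]; simp only
    rw [min_eq_left hr.2, max_eq_right hr.1, ENNReal.ofReal_toReal (hEtop r hr)]
  have hf0 : ∀ r, 0 ≤ f r := fun r => ENNReal.toReal_nonneg
  have hbound : ∀ s η, 0 ≤ s → 0 < η → s + η ≤ T →
      ENNReal.ofReal (∫ x in Ω, potential a id (u x s) (u x (s + η)))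
        ≤ ENNReal.ofReal ((∫ θ in Ioc 0 η, (f s - f (s + θ))) / 2) := by
    intro s η hs hη hsη
    have h := hu.lintegral_energy_le hg hs (show s < s + η by linarith) hsη
    have hsT : s ∈ Icc 0 T := ⟨hs, by linarith⟩
    have hfi : ∀ x y, IntervalIntegrable f volume x y := fun x y =>
      (hfanti.antitoneOn _).intervalIntegrable
    have e1 : ∫⁻ r in Ioc s (s + η), energy Ω u Dg r
        = ENNReal.ofReal (∫ r in Ioc s (s + η), f r) := by
      rw [ofReal_integral_eq_lintegral_ofReal (hfi s (s + η)).1 (ae_of_all _ hf0)]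
      exact setLIntegral_congr_fun measurableSet_Ioc fun r hr =>
        (hfE r ⟨hs.trans hr.1.le, hr.2.trans hsη⟩).symm
    have e2 : ∫ θ in Ioc 0 η, (f s - f (s + θ)) = η * f s - ∫ r in Ioc s (s + η), f r := by
      have hsh : IntervalIntegrable (fun θ => f (s + θ)) volume 0 η := by
        have : Antitone fun θ => f (s + θ) := fun x y hxy => hfanti (by linarith)
        exact (this.antitoneOn _).intervalIntegrable
      rw [← intervalIntegral.integral_of_le hη.le, ← intervalIntegral.integral_of_le (by linarith),
        intervalIntegral.integral_sub (by simp) hsh, intervalIntegral.integral_comp_add_left f s]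
      simp
    have hint0 : 0 ≤ ∫ r in Ioc s (s + η), f r := integral_nonneg hf0
    have hG0 : 0 ≤ ∫ x in Ω, potential a id (u x s) (u x (s + η)) :=
      setIntegral_nonneg hΩm fun x hx => potential_id_nonneg hu.coeff_continuous hu.coeff_pos
        (hu.pos (subset_closure hx) hsT) (hu.pos (subset_closure hx) ⟨by linarith, hsη⟩)
    have htwo : ∀ y : ℝ, 2 * ENNReal.ofReal y = ENNReal.ofReal (2 * y) := fun y => by
      rw [ENNReal.ofReal_mul (by norm_num), ENNReal.ofReal_ofNat]
    rw [e1, ← hfE s hsT, add_sub_cancel_left, ← ENNReal.ofReal_mul hη.le, htwo,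
      ← ENNReal.ofReal_add hint0 (by positivity),
      ENNReal.ofReal_le_ofReal_iff (mul_nonneg hη.le (hf0 s))] at h
    refine ENNReal.ofReal_le_ofReal ?_
    rw [e2]; linarith
  -- steps `η n` tending to zero
  set η : ℕ → ℝ := fun n => τ / (n + 2) with hη
  have hη0 : ∀ n, 0 < η n := fun n => div_pos hτ.1 (by positivity)
  have hητ : ∀ n, η n ≤ τ := fun n => div_le_self hτ.1.le (by
    have : (0 : ℝ) ≤ n := Nat.cast_nonneg n
    linarith)
  have hη_lim : Tendsto η atTop (𝓝 0) :=
    tendsto_const_nhds.div_atTop (tendsto_atTop_add_const_right _ _ tendsto_natCast_atTop_atTop)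
  set Q : ℕ → EuclideanSpace ℝ (Fin N) × ℝ → ℝ≥0∞ := fun n z =>
    ENNReal.ofReal (potential a id (u z.1 z.2) (u z.1 (z.2 + η n)) / η n ^ 2) with hQ
  have hAm : ∀ n, MeasurableSet (Ω ×ˢ Ioc 0 (τ - η n)) := fun n => hΩm.prod measurableSet_Ioc
  have hAsub : ∀ n, Ω ×ˢ Ioc 0 (τ - η n) ⊆ Ω ×ˢ Ioc 0 τ := fun n =>
    prod_mono subset_rfl (Ioc_subset_Ioc_right (by linarith [hη0 n]))
  have hQc : ∀ n, ContinuousOn (fun z : EuclideanSpace ℝ (Fin N) × ℝ =>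
      potential a id (u z.1 z.2) (u z.1 (z.2 + η n)) / η n ^ 2) (Ω ×ˢ Ioc 0 (τ - η n)) := by
    intro n
    have hm1 : ∀ z ∈ Ω ×ˢ Ioc 0 (τ - η n), z ∈ closure Ω ×ˢ Icc 0 T := fun z hz =>
      ⟨subset_closure hz.1, hz.2.1.le, by linarith [hz.2.2, hη0 n, hτ.2]⟩
    have hm2 : ∀ z ∈ Ω ×ˢ Ioc 0 (τ - η n), (z.1, z.2 + η n) ∈ closure Ω ×ˢ Icc 0 T := fun z hz =>
      ⟨subset_closure hz.1, by simp only; linarith [hz.2.1, hη0 n],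
        by simp only; linarith [hz.2.2, hτ.2]⟩
    refine ContinuousOn.div_const ?_ _
    refine (continuousOn_potential_id hu.coeff_continuous).comp ((hu.continuous.mono hm1).prodMk
      (hu.continuous.comp (f := fun z : EuclideanSpace ℝ (Fin N) × ℝ => (z.1, z.2 + η n))
        (by fun_prop) hm2)) fun z hz => ⟨hu.pos (hm1 z hz).1 (hm1 z hz).2, ?_⟩
    exact hu.pos (hm2 z hz).1 (hm2 z hz).2
  have hQm : ∀ n, AEMeasurable (Q n) (volume.restrict (Ω ×ˢ Ioc 0 (τ - η n))) := fun n =>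
    ENNReal.measurable_ofReal.comp_aemeasurable
      (((hQc n).aestronglyMeasurable (hAm n)).aemeasurable)
  have hQle : ∀ n, ∫⁻ z in Ω ×ˢ Ioc 0 (τ - η n), Q n z ≤ ENNReal.ofReal ((f 0 - f τ) / 4) := by
    intro n
    have hprod : (volume : Measure (EuclideanSpace ℝ (Fin N) × ℝ)).restrict (Ω ×ˢ Ioc 0 (τ - η n))
        = (volume.restrict Ω).prod (volume.restrict (Ioc 0 (τ - η n))) := by
      rw [Measure.prod_restrict, Measure.volume_eq_prod]
    have h1 := hQm n
    rw [hprod] at h1 ⊢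
    rw [lintegral_prod_symm _ h1]
    obtain ⟨hi, hle⟩ := integral_integral_sub_shift_le hfanti (hη0 n).le (hητ n)
    have hfs : ∀ s, ∀ θ ∈ Ioc 0 (η n), 0 ≤ f s - f (s + θ) := fun s θ hθ =>
      sub_nonneg.2 (hfanti (by linarith [hθ.1]))
    calc ∫⁻ s in Ioc 0 (τ - η n), ∫⁻ x in Ω, Q n (x, s)
        ≤ ∫⁻ s in Ioc 0 (τ - η n),
            ENNReal.ofReal ((∫ θ in Ioc 0 (η n), (f s - f (s + θ))) / 2 / η n ^ 2) := by
          refine setLIntegral_mono_ae' measurableSet_Ioc (ae_of_all _ fun s hs => ?_)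
          have hsT : s ∈ Icc 0 T := ⟨hs.1.le, by linarith [hs.2, hη0 n, hτ.2]⟩
          have hsT' : s + η n ∈ Icc 0 T := ⟨by linarith [hs.1, hη0 n], by linarith [hs.2, hτ.2]⟩
          have hpos : ∀ x ∈ Ω, 0 ≤ potential a id (u x s) (u x (s + η n)) := fun x hx =>
            potential_id_nonneg hu.coeff_continuous hu.coeff_pos
              (hu.pos (subset_closure hx) hsT) (hu.pos (subset_closure hx) hsT')
          have hint : IntegrableOn (fun x => potential a id (u x s) (u x (s + η n))) Ω :=
            ((hu.continuousOn_potential_slices hsT hsT').integrableOn_compact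
              hu.isCompact_closure).mono_set subset_closure
          simp only [hQ]
          simp_rw [ENNReal.ofReal_div_of_pos (show 0 < η n ^ 2 by have := hη0 n; positivity)]
          simp_rw [div_eq_mul_inv (ENNReal.ofReal _) (ENNReal.ofReal (η n ^ 2))]
          rw [lintegral_mul_const' _ _ (by
            simp only [ne_eq, ENNReal.inv_eq_top, ENNReal.ofReal_eq_zero, not_le]
            have := hη0 n; positivity),
            ← ofReal_integral_eq_lintegral_ofReal hint
              ((ae_restrict_mem hΩm).mono fun x hx => hpos x hx)]
          exact mul_le_mul_left (hbound s (η n) hs.1.le (hη0 n) hsT'.2) _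
      _ = ENNReal.ofReal (∫ s in Ioc 0 (τ - η n),
            (∫ θ in Ioc 0 (η n), (f s - f (s + θ))) / 2 / η n ^ 2) := by
          rw [ofReal_integral_eq_lintegral_ofReal ((hi.div_const 2).div_const _)]
          refine ae_of_all _ fun s => ?_
          have := setIntegral_nonneg (μ := volume) measurableSet_Ioc (hfs s)
          simp only [Pi.zero_apply]
          positivity
      _ ≤ ENNReal.ofReal ((f 0 - f τ) / 4) := by
          refine ENNReal.ofReal_le_ofReal ?_
          rw [integral_div, integral_div, div_div, div_le_iff₀ (by have := hη0 n; positivity)]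
          linarith
  have hfatou : ∫⁻ z in Ω ×ˢ Ioc 0 τ, ENNReal.ofReal (a (u z.1 z.2) * timeDeriv T u z.1 z.2 ^ 2 / 2)
      ≤ ENNReal.ofReal ((f 0 - f τ) / 4) := by
    have hA : MeasurableSet (Ω ×ˢ Ioo 0 τ) := hΩm.prod measurableSet_Ioo
    calc ∫⁻ z in Ω ×ˢ Ioc 0 τ, ENNReal.ofReal (a (u z.1 z.2) * timeDeriv T u z.1 z.2 ^ 2 / 2)
        = ∫⁻ z in Ω ×ˢ Ioo 0 τ,
            ENNReal.ofReal (a (u z.1 z.2) * timeDeriv T u z.1 z.2 ^ 2 / 2) := by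
          refine setLIntegral_congr ?_
          rw [Measure.volume_eq_prod]
          exact Measure.set_prod_ae_eq ae_eq_rfl Ioo_ae_eq_Ioc.symm
      _ ≤ ∫⁻ z in Ω ×ˢ Ioo 0 τ,
            liminf (fun n => (Ω ×ˢ Ioc 0 (τ - η n)).indicator (Q n) z) atTop := by
          refine setLIntegral_mono_ae' hA (ae_of_all _ ?_)
          rintro ⟨x, s⟩ ⟨hx, hs⟩
          have hxc := subset_closure hx
          have hsT : s ∈ Ioo 0 T := ⟨hs.1, hs.2.trans_le hτ.2⟩
          have hd := hu.hasDerivAt hx hsT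
          have hup := hu.pos hxc (Ioo_subset_Icc_self hsT)
          have hshift : Tendsto (fun n => s + η n) atTop (𝓝[≠] s) := by
            refine tendsto_nhdsWithin_iff.2 ⟨by simpa using hη_lim.const_add s,
              Eventually.of_forall fun n => ?_⟩
            have := hη0 n
            simp only [mem_compl_iff, mem_singleton_iff]
            linarith
          have hslope : Tendsto (fun n => ((u x (s + η n) - u x s) / η n) ^ 2) atTop
              (𝓝 (timeDeriv T u x s ^ 2)) := by
            have h1 := (hasDerivAt_iff_tendsto_slope.1 hd).comp hshift
            refine (h1.congr fun n => ?_).pow 2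
            simp [slope_def_field]
          have key : ∀ c < a (u x s), ENNReal.ofReal (c * timeDeriv T u x s ^ 2 / 2)
              ≤ liminf (fun n => (Ω ×ˢ Ioc 0 (τ - η n)).indicator (Q n) (x, s)) atTop := by
            intro c hc
            have h1 := ENNReal.tendsto_ofReal ((hslope.const_mul c).div_const 2)
            rw [← h1.liminf_eq]
            refine liminf_le_liminf ?_
            have hconv : Tendsto (fun n => u x (s + η n)) atTop (𝓝 (u x s)) :=
              hd.continuousAt.tendsto.comp (hshift.mono_right nhdsWithin_le_nhds)
            have h2 : ∀ᶠ n in atTop, s ≤ τ - η n := by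
              filter_upwards [hη_lim.eventually (gt_mem_nhds (show 0 < τ - s by linarith [hs.2]))]
                with n hn
              linarith
            filter_upwards [h2, hconv.eventually
              (eventually_le_potential hu.coeff_continuous hup hc)] with n hn hpot
            have hmem : (x, s) ∈ Ω ×ˢ Ioc 0 (τ - η n) := ⟨hx, hs.1, hn⟩
            rw [indicator_of_mem hmem]
            refine ENNReal.ofReal_le_ofReal ?_
            have := hη0 n
            rw [le_div_iff₀ (by positivity)]
            calc c * ((u x (s + η n) - u x s) / η n) ^ 2 / 2 * η n ^ 2
                = c * (u x (s + η n) - u x s) ^ 2 / 2 := by field_simp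
              _ ≤ _ := hpot
          have hcont : Tendsto (fun c => ENNReal.ofReal (c * timeDeriv T u x s ^ 2 / 2))
              (𝓝[<] (a (u x s))) (𝓝 (ENNReal.ofReal (a (u x s) * timeDeriv T u x s ^ 2 / 2))) := by
            refine ENNReal.tendsto_ofReal (Tendsto.mono_left ?_ nhdsWithin_le_nhds)
            exact (by fun_prop : Continuous fun c : ℝ => c * timeDeriv T u x s ^ 2 / 2).tendsto _
          refine le_of_tendsto hcont ?_
          filter_upwards [self_mem_nhdsWithin] with c hc using key c hc
      _ ≤ ∫⁻ z in Ω ×ˢ Ioc 0 τ,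
            liminf (fun n => (Ω ×ˢ Ioc 0 (τ - η n)).indicator (Q n) z) atTop :=
          lintegral_mono_set (prod_mono subset_rfl Ioo_subset_Ioc_self)
      _ ≤ liminf (fun n => ∫⁻ z in Ω ×ˢ Ioc 0 τ, (Ω ×ˢ Ioc 0 (τ - η n)).indicator (Q n) z)
            atTop := by
          refine lintegral_liminf_le' fun n => ?_
          exact ((aemeasurable_indicator_iff (hAm n)).2 (hQm n)).restrict
      _ ≤ ENNReal.ofReal ((f 0 - f τ) / 4) := by
          refine liminf_le_of_le (by isBoundedDefault) fun b hb => ?_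
          obtain ⟨n, hn⟩ := hb.exists
          refine hn.trans ?_
          rw [setLIntegral_indicator (hAm n), inter_eq_left.2 (hAsub n)]
          exact hQle n
  have hτT : τ ∈ Icc 0 T := Ioc_subset_Icc_self hτ
  have hD : 2 * (∫⁻ s in Ioc 0 τ, ∫⁻ x in Ω, ENNReal.ofReal (a (u x s) * timeDeriv T u x s ^ 2))
      ≤ ENNReal.ofReal (f 0 - f τ) := by
    have hm : AEMeasurable (fun z : EuclideanSpace ℝ (Fin N) × ℝ =>
        ENNReal.ofReal (a (u z.1 z.2) * timeDeriv T u z.1 z.2 ^ 2 / 2))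
        ((volume.restrict Ω).prod (volume.restrict (Ioc 0 τ))) := by
      rw [Measure.prod_restrict]
      have hsub : Ω ×ˢ Ioc 0 τ ⊆ Ω ×ˢ Ioc 0 T := prod_mono subset_rfl (Ioc_subset_Ioc_right hτ.2)
      refine ENNReal.measurable_ofReal.comp_aemeasurable (ContinuousOn.aestronglyMeasurable ?_
        (hΩm.prod measurableSet_Ioc)).aemeasurable
      refine ((hu.coeff_continuous.comp (hu.continuous.mono ((prod_subset Ω T).trans' hsub))
        fun z hz => ?_).mul ((hu.regular.continuous_time.mono hsub).pow 2)).div_const 2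
      exact hu.pos (prod_subset Ω T (hsub hz)).1 (prod_subset Ω T (hsub hz)).2
    rw [Measure.volume_eq_prod, ← Measure.prod_restrict, lintegral_prod_symm _ hm] at hfatou
    have h4 : ∀ y : ℝ, ENNReal.ofReal y = 2 * ENNReal.ofReal (y / 2) := fun y => by
      rw [show (2 : ℝ≥0∞) = ENNReal.ofReal 2 by simp, ← ENNReal.ofReal_mul (by norm_num)]
      congr 1; ring
    calc _ = 4 * ∫⁻ s in Ioc 0 τ, ∫⁻ x in Ω,
          ENNReal.ofReal (a (u x s) * timeDeriv T u x s ^ 2 / 2) := by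
          simp_rw [h4 (a _ * _), lintegral_const_mul' _ _ ENNReal.ofNat_ne_top]
          rw [← mul_assoc]; norm_num
      _ ≤ 4 * ENNReal.ofReal ((f 0 - f τ) / 4) := by gcongr
      _ = ENNReal.ofReal (f 0 - f τ) := by
          rw [show (4 : ℝ≥0∞) = ENNReal.ofReal 4 by simp, ← ENNReal.ofReal_mul (by norm_num)]
          congr 1; ring
  calc _ ≤ ENNReal.ofReal (f 0 - f τ) + energy Ω u Dg τ := by gcongr
    _ = energy Ω u Dg 0 := by
      rw [← hfE τ hτT, ← ENNReal.ofReal_add (sub_nonneg.2 (hfanti hτ.1.le)) (hf0 τ), sub_add_cancel,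
        hfE 0 ⟨le_rfl, hT0⟩]

end IsFiltration
end Flow

/-! ### The reverse energy inequality -/

lemma lintegral_lintegral_Ioc_add_le {B : ℝ → ℝ≥0∞} {τ η : ℝ}
    (hB : AEMeasurable B (volume.restrict (Ioc 0 τ))) :
    ∫⁻ s in Ioc 0 τ, ∫⁻ r in Ioc s (min (s + η) τ), B r
      ≤ ENNReal.ofReal η * ∫⁻ r in Ioc 0 τ, B r := by
  set W : Set (ℝ × ℝ) := {z | z.1 < z.2 ∧ z.2 ≤ z.1 + η} with hW
  have hWm : MeasurableSet W :=
    (measurableSet_lt measurable_fst measurable_snd).inter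
      (measurableSet_le measurable_snd (measurable_fst.add_const η))
  calc ∫⁻ s in Ioc 0 τ, ∫⁻ r in Ioc s (min (s + η) τ), B r
      = ∫⁻ s in Ioc 0 τ, ∫⁻ r in Ioc 0 τ, W.indicator (fun z => B z.2) (s, r) := by
        refine setLIntegral_congr_fun measurableSet_Ioc fun s hs => ?_
        have h1 : Ioc s (min (s + η) τ) = Ioc s (s + η) ∩ Ioc 0 τ := by
          ext r; simp only [mem_Ioc, mem_inter_iff, le_min_iff]
          exact ⟨fun h => ⟨⟨h.1, h.2.1⟩, hs.1.trans h.1, h.2.2⟩, fun h => ⟨h.1.1, h.1.2, h.2.2⟩⟩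
        rw [h1, ← setLIntegral_indicator measurableSet_Ioc]
        rfl
    _ = ∫⁻ r in Ioc 0 τ, ∫⁻ s in Ioc 0 τ, W.indicator (fun z => B z.2) (s, r) :=
        lintegral_lintegral_swap (hB.comp_snd.indicator hWm)
    _ ≤ ∫⁻ r in Ioc 0 τ, ENNReal.ofReal η * B r := by
        refine lintegral_mono fun r => ?_
        calc _ ≤ ∫⁻ s, (Ico (r - η) r).indicator (fun _ => B r) s := by
              refine (setLIntegral_le_lintegral _ _).trans (lintegral_mono fun s => ?_)
              by_cases h : (s, r) ∈ W
              · rw [indicator_of_mem h, indicator_of_mem]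
                exact ⟨by linarith [h.2], h.1⟩
              · rw [indicator_of_notMem h]; exact zero_le
          _ = _ := by
              rw [lintegral_indicator_const measurableSet_Ico, Real.volume_Ico, mul_comm]
              congr 2; ring
    _ = _ := lintegral_const_mul' _ _ ENNReal.ofReal_ne_top

/-- A discrete form of the fundamental theorem of calculus for a nonincreasing function: a bound for
`∫₀^τ (e(s) - e(s + η)) ds / η` bounds `e(η) - e(τ)`. -/
lemma le_add_of_lintegral_shift_le {e : ℝ → ℝ≥0∞} {τ η : ℝ} (hη : 0 < η) (hητ : η ≤ τ)
    (he : AntitoneOn e (Ioc 0 τ)) (hfin : ∫⁻ s in Ioc 0 τ, e s ≠ ⊤) {c : ℝ≥0∞}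
    (h : ∫⁻ s in Ioc 0 τ, e s ≤ (∫⁻ s in Ioc 0 τ, e (min (s + η) τ)) + ENNReal.ofReal η * c) :
    e η ≤ e τ + c := by
  have hsplit : ∀ (f : ℝ → ℝ≥0∞) {p : ℝ}, 0 ≤ p → p ≤ τ →
      ∫⁻ s in Ioc 0 τ, f s = (∫⁻ s in Ioc 0 p, f s) + ∫⁻ s in Ioc p τ, f s := by
    intro f p hp hpτ
    rw [← Ioc_union_Ioc_eq_Ioc hp hpτ,
      lintegral_union measurableSet_Ioc (Ioc_disjoint_Ioc_of_le le_rfl)]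
  have h1 : ∫⁻ s in Ioc 0 (τ - η), e (min (s + η) τ) = ∫⁻ s in Ioc η τ, e s := by
    rw [setLIntegral_congr_fun (g := fun s => e (s + η)) measurableSet_Ioc fun s hs => by
      simp only; rw [min_eq_left (by linarith [hs.2])]]
    have h2 := (measurePreserving_add_right volume η).setLIntegral_comp_preimage_emb
      (measurableEmbedding_addRight η) e (Ioc η τ)
    rw [← h2]
    congr 2
    ext s; simp only [mem_Ioc, mem_preimage]
    constructor <;> rintro ⟨h, h'⟩ <;> constructor <;> linarith
  have h3 : ∫⁻ s in Ioc (τ - η) τ, e (min (s + η) τ) = ENNReal.ofReal η * e τ := by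
    rw [setLIntegral_congr_fun (g := fun _ => e τ) measurableSet_Ioc fun s hs => by
      simp only; rw [min_eq_right (by linarith [hs.1])], setLIntegral_const, Real.volume_Ioc, mul_comm]
    congr 2; ring
  rw [hsplit (fun s => e (min (s + η) τ)) (p := τ - η) (by linarith) (by linarith), h1, h3,
    hsplit e hη.le hητ, add_comm (∫⁻ s in Ioc η τ, e s), add_right_comm] at h
  have hfin' : ∫⁻ s in Ioc η τ, e s ≠ ⊤ :=
    ne_top_of_le_ne_top hfin (lintegral_mono_set (Ioc_subset_Ioc_left hη.le))
  have h4 := (ENNReal.add_le_add_iff_right hfin').1 h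
  have h5 : ENNReal.ofReal η * e η ≤ ∫⁻ s in Ioc 0 η, e s := by
    calc ENNReal.ofReal η * e η = ∫⁻ _ in Ioc 0 η, e η := by
          rw [setLIntegral_const, Real.volume_Ioc, sub_zero, mul_comm]
      _ ≤ _ := setLIntegral_mono' measurableSet_Ioc fun s hs =>
          he ⟨hs.1, hs.2.trans hητ⟩ ⟨hη, hητ⟩ hs.2
  have h6 := h5.trans h4
  rw [← mul_add] at h6
  exact (ENNReal.mul_le_mul_iff_right (by simpa using hη) ENNReal.ofReal_ne_top).1 h6

lemma sq_sub_le_mul_integral_sq {f f' : ℝ → ℝ} {s t : ℝ} (hst : s ≤ t) (hf : ContinuousOn f (Icc s t))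
    (hd : ∀ r ∈ Ioo s t, HasDerivAt f (f' r) r) (hf' : ContinuousOn f' (Icc s t)) :
    (f t - f s) ^ 2 ≤ (t - s) * ∫ r in Ioc s t, f' r ^ 2 := by
  rcases hst.eq_or_lt with rfl | hlt
  · simp
  have hi : IntervalIntegrable f' volume s t := by
    refine ContinuousOn.intervalIntegrable ?_; rwa [uIcc_of_le hst]
  have hi2 : IntervalIntegrable (fun r => f' r ^ 2) volume s t := by
    refine ContinuousOn.intervalIntegrable ?_; rw [uIcc_of_le hst]; exact hf'.pow 2
  have hw := intervalIntegral.integral_eq_sub_of_hasDerivAt_of_le hst hf hd hi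
  rw [← intervalIntegral.integral_of_le hst]
  -- the variance of `f'` is nonnegative
  set m := (f t - f s) / (t - s) with hm
  have h0 : 0 ≤ ∫ r in s..t, (f' r ^ 2 - 2 * m * f' r + m ^ 2) :=
    intervalIntegral.integral_nonneg hst fun r _ => by nlinarith [sq_nonneg (f' r - m)]
  rw [intervalIntegral.integral_add (hi2.sub (hi.const_mul _)) (by simp),
    intervalIntegral.integral_sub hi2 (hi.const_mul _), intervalIntegral.integral_const_mul, hw,
    intervalIntegral.integral_const, smul_eq_mul] at h0
  have hts : 0 < t - s := by linarith
  have e1 : m * (t - s) = f t - f s := by rw [hm]; field_simp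
  rw [← e1] at h0 ⊢
  nlinarith

lemma integrable_inner_of_memLp {α F : Type*} [MeasurableSpace α] {μ : Measure α}
    [NormedAddCommGroup F] [InnerProductSpace ℝ F] {f g : α → F} (hf : MemLp f 2 μ)
    (hg : MemLp g 2 μ) : Integrable (fun x => inner ℝ (f x) (g x)) μ := by
  refine Integrable.mono' (hf.norm.integrable_mul hg.norm)
    (hf.aestronglyMeasurable.inner hg.aestronglyMeasurable) (ae_of_all _ fun x => ?_)
  exact norm_inner_le_norm _ _

section Flow

variable {N : ℕ} {Ω : Set (EuclideanSpace ℝ (Fin N))} {T ε K : ℝ} {a : ℝ → ℝ}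
  {u : EuclideanSpace ℝ (Fin N) → ℝ → ℝ}
  {Dg : EuclideanSpace ℝ (Fin N) → EuclideanSpace ℝ (Fin N)}

namespace IsFiltration

lemma continuousOn_coeff (hu : IsFiltration Ω T ε K a u) :
    ContinuousOn (fun z : EuclideanSpace ℝ (Fin N) × ℝ => a (u z.1 z.2)) (closure Ω ×ˢ Icc 0 T) :=
  hu.coeff_continuous.comp hu.continuous fun _ hz => hu.pos hz.1 hz.2

/-- Convexity of the Dirichlet energy: `E(s) ≤ E(t) + 2 ∫ Δu(s) (u(t) - u(s))`, with the last term
estimated by Young's inequality. -/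
lemma energy_le_add_dissipation (hu : IsFiltration Ω T ε K a u) {s t : ℝ} (hs : s ∈ Ioc 0 T)
    (ht : t ∈ Ioc 0 T) (hEs : energy Ω u Dg s ≠ ⊤) (hEt : energy Ω u Dg t ≠ ⊤) {η : ℝ} (hη : 0 < η) :
    energy Ω u Dg s ≤ energy Ω u Dg t
      + (ENNReal.ofReal η * (∫⁻ x in Ω, ENNReal.ofReal (a (u x s) * timeDeriv T u x s ^ 2))
        + ENNReal.ofReal η⁻¹ * ∫⁻ x in Ω, ENNReal.ofReal (a (u x s) * (u x t - u x s) ^ 2)) := by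
  have hΩm := hu.isOpen.measurableSet
  have hsT := Ioc_subset_Icc_self hs
  have htT := Ioc_subset_Icc_self ht
  have hslice : Continuous fun x : EuclideanSpace ℝ (Fin N) => (x, s) := by fun_prop
  have hac : ContinuousOn (fun x => a (u x s)) (closure Ω) :=
    hu.continuousOn_coeff.comp hslice.continuousOn fun _ hx => ⟨hx, hsT⟩
  have ha0 : ∀ x ∈ Ω, 0 < a (u x s) := fun x hx => hu.coeff_pos _ (hu.pos (subset_closure hx) hsT)
  have htc : ContinuousOn (fun x => timeDeriv T u x s) Ω :=
    hu.regular.continuous_time.comp hslice.continuousOn fun _ hx => ⟨hx, hs⟩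
  have hwc : ContinuousOn (fun x => u x t - u x s) (closure Ω) :=
    (hu.continuousOn_space htT).sub (hu.continuousOn_space hsT)
  have hbc : ContinuousOn (fun x => a (u x s) * timeDeriv T u x s ^ 2) Ω :=
    (hac.mono subset_closure).mul (htc.pow 2)
  have hb0 : ∀ x ∈ Ω, 0 ≤ a (u x s) * timeDeriv T u x s ^ 2 := fun x hx =>
    mul_nonneg (ha0 x hx).le (sq_nonneg _)
  by_cases hD : ∫⁻ x in Ω, ENNReal.ofReal (a (u x s) * timeDeriv T u x s ^ 2) = ⊤
  · rw [hD, ENNReal.mul_top (by simpa using hη)]; simp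
  have ib : IntegrableOn (fun x => a (u x s) * timeDeriv T u x s ^ 2) Ω := by
    refine ⟨hbc.aestronglyMeasurable hΩm, ?_⟩
    rw [hasFiniteIntegral_iff_ofReal ((ae_restrict_mem hΩm).mono hb0)]
    exact lt_top_iff_ne_top.2 hD
  have iw : IntegrableOn (fun x => a (u x s) * (u x t - u x s) ^ 2) Ω :=
    ((hac.mul (hwc.pow 2)).integrableOn_compact hu.isCompact_closure).mono_set subset_closure
  rw [energy_of_pos hs.1] at hEs ⊢
  rw [energy_of_pos ht.1] at hEt ⊢
  have hXs := hu.hasWeakGradient hs hEs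
  have hXt := hu.hasWeakGradient ht hEt
  have hz := hu.isZeroTrace_spaceGrad_sub hsT ht hXs
  have iXs : IntegrableOn (fun x => ‖spaceGrad u x s‖ ^ 2) Ω :=
    hXs.memLp.integrable_norm_pow (by simp)
  have iXt : IntegrableOn (fun x => ‖spaceGrad u x t‖ ^ 2) Ω :=
    hXt.memLp.integrable_norm_pow (by simp)
  set R := η * (∫ x in Ω, a (u x s) * timeDeriv T u x s ^ 2)
    + η⁻¹ * ∫ x in Ω, a (u x s) * (u x t - u x s) ^ 2 with hR
  have hSm : ∀ n, AEStronglyMeasurable (fun x => truncDeriv n (u x t - u x s))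
      (volume.restrict Ω) := fun n =>
    ((continuous_truncDeriv n).comp_continuousOn (hwc.mono subset_closure)).aestronglyMeasurable hΩm
  have hS1 : ∀ n y, ‖truncDeriv n y‖ ≤ 1 := fun n y => by
    rw [Real.norm_of_nonneg (truncDeriv_nonneg _ _)]; exact truncDeriv_le_one _ _
  have hn : ∀ n, ∫ x in Ω, truncDeriv n (u x t - u x s)
      * (‖spaceGrad u x s‖ ^ 2 - ‖spaceGrad u x t‖ ^ 2) ≤ R := by
    intro n
    have e1 := hu.setIntegral_timeDeriv_mul_trunc hz n hs
    have i1 : IntegrableOn (fun x => truncDeriv n (u x t - u x s)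
        * (‖spaceGrad u x s‖ ^ 2 - ‖spaceGrad u x t‖ ^ 2)) Ω :=
      (iXs.sub iXt).bdd_mul (hSm n) (ae_of_all _ fun x => hS1 n _)
    have i2 : IntegrableOn (fun x => truncDeriv n (u x t - u x s)
        * inner ℝ (spaceGrad u x s) (spaceGrad u x t - spaceGrad u x s)) Ω :=
      (integrable_inner_of_memLp hXs.memLp (hXt.memLp.sub hXs.memLp)).bdd_mul (hSm n)
        (ae_of_all _ fun x => hS1 n _)
    have iR : IntegrableOn (fun x => η * (a (u x s) * timeDeriv T u x s ^ 2)
        + η⁻¹ * (a (u x s) * (u x t - u x s) ^ 2)) Ω := (ib.const_mul _).add (iw.const_mul _)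
    have hyoung : ∀ x ∈ Ω, |2 * (a (u x s) * timeDeriv T u x s * trunc n (u x t - u x s))|
        ≤ η * (a (u x s) * timeDeriv T u x s ^ 2) + η⁻¹ * (a (u x s) * (u x t - u x s) ^ 2) := by
      intro x hx
      have h1 : |trunc n (u x t - u x s)| ≤ |u x t - u x s| := abs_trunc_le _ _
      set p := |timeDeriv T u x s|
      set q := |u x t - u x s|
      have h2 : 2 * (p * q) ≤ η * p ^ 2 + η⁻¹ * q ^ 2 := by
        have h3 := mul_nonneg (inv_nonneg.2 hη.le) (sq_nonneg (η * p - q))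
        have h4 : η⁻¹ * (η * p - q) ^ 2 = η * p ^ 2 + η⁻¹ * q ^ 2 - 2 * (p * q) := by
          field_simp; ring
        linarith
      rw [abs_mul, abs_mul, abs_mul, abs_two, abs_of_pos (ha0 x hx), ← sq_abs (timeDeriv T u x s),
        ← sq_abs (u x t - u x s)]
      calc _ ≤ 2 * (a (u x s) * p * q) := by
            have := (ha0 x hx).le
            gcongr
        _ = a (u x s) * (2 * (p * q)) := by ring
        _ ≤ a (u x s) * (η * p ^ 2 + η⁻¹ * q ^ 2) := mul_le_mul_of_nonneg_left h2 (ha0 x hx).le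
        _ = _ := by ring
    have i3 : IntegrableOn
        (fun x => 2 * (a (u x s) * timeDeriv T u x s * trunc n (u x t - u x s))) Ω := by
      refine Integrable.mono' iR ?_ ((ae_restrict_mem hΩm).mono hyoung)
      refine ContinuousOn.aestronglyMeasurable ?_ hΩm
      exact continuousOn_const.mul (((hac.mono subset_closure).mul htc).mul
        ((continuous_trunc n).comp_continuousOn (hwc.mono subset_closure)))
    calc _ ≤ ∫ x in Ω, -2 * (truncDeriv n (u x t - u x s)
          * inner ℝ (spaceGrad u x s) (spaceGrad u x t - spaceGrad u x s)) := by
          refine integral_mono i1 (i2.const_mul _) fun x => ?_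
          have h1 := norm_add_sq_real (spaceGrad u x s) (spaceGrad u x t - spaceGrad u x s)
          rw [add_sub_cancel] at h1
          have h2 := truncDeriv_nonneg n (u x t - u x s)
          simp only
          nlinarith [sq_nonneg ‖spaceGrad u x t - spaceGrad u x s‖]
      _ = ∫ x in Ω, 2 * (a (u x s) * timeDeriv T u x s * trunc n (u x t - u x s)) := by
          rw [integral_const_mul, integral_const_mul, e1]; ring
      _ ≤ ∫ x in Ω, (η * (a (u x s) * timeDeriv T u x s ^ 2)
          + η⁻¹ * (a (u x s) * (u x t - u x s) ^ 2)) :=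
          setIntegral_mono_on i3 iR hΩm fun x hx => (le_abs_self _).trans (hyoung x hx)
      _ = R := by
          rw [integral_add (ib.const_mul _) (iw.const_mul _), integral_const_mul, integral_const_mul]
  have hlim : Tendsto (fun n => ∫ x in Ω, truncDeriv n (u x t - u x s)
      * (‖spaceGrad u x s‖ ^ 2 - ‖spaceGrad u x t‖ ^ 2)) atTop
      (𝓝 (∫ x in Ω, (‖spaceGrad u x s‖ ^ 2 - ‖spaceGrad u x t‖ ^ 2))) := by
    refine tendsto_integral_of_dominated_convergence
      (fun x => ‖‖spaceGrad u x s‖ ^ 2 - ‖spaceGrad u x t‖ ^ 2‖)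
      (fun n => (hSm n).mul (iXs.sub iXt).aestronglyMeasurable) (iXs.sub iXt).norm
      (fun n => ae_of_all _ fun x => ?_) ?_
    · rw [norm_mul]
      exact mul_le_of_le_one_left (norm_nonneg _) (hS1 n _)
    · -- where the two slices agree, their gradients do
      filter_upwards [ae_restrict_of_ae (hz.ae_grad_eq_zero hu.isOpen), ae_restrict_mem hΩm]
        with x hx hxΩ
      rw [indicator_of_mem hxΩ, indicator_of_mem hxΩ] at hx
      by_cases h0 : u x t - u x s = 0
      · simp [sub_eq_zero.1 (hx h0)]
      · simpa using (tendsto_truncDeriv h0).mul_const (‖spaceGrad u x s‖ ^ 2 - ‖spaceGrad u x t‖ ^ 2)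
  have hle := le_of_tendsto' hlim hn
  rw [integral_sub iXs iXt] at hle
  have hc : ∀ {c y : ℝ}, 0 < c → ENNReal.ofReal c * ENNReal.ofReal y = ENNReal.ofReal (c * y) :=
    fun hc => (ENNReal.ofReal_mul hc.le).symm
  have hb1 : 0 ≤ ∫ x in Ω, a (u x s) * timeDeriv T u x s ^ 2 := setIntegral_nonneg hΩm hb0
  have hw0 : ∀ x ∈ Ω, 0 ≤ a (u x s) * (u x t - u x s) ^ 2 := fun x hx =>
    mul_nonneg (ha0 x hx).le (sq_nonneg _)
  have hw1 := setIntegral_nonneg (μ := volume) hΩm hw0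
  rw [lintegral_enorm_sq_eq hXs.memLp, lintegral_enorm_sq_eq hXt.memLp,
    ← ofReal_integral_eq_lintegral_ofReal ib ((ae_restrict_mem hΩm).mono hb0),
    ← ofReal_integral_eq_lintegral_ofReal iw ((ae_restrict_mem hΩm).mono hw0), hc hη,
    hc (inv_pos.2 hη), ← ENNReal.ofReal_add (by positivity) (by positivity),
    ← ENNReal.ofReal_add (integral_nonneg fun x => by positivity) (by positivity)]
  exact ENNReal.ofReal_le_ofReal (by linarith)

/-- The coefficient has uniformly small relative oscillation over short time intervals. -/
lemma exists_coeff_le (hu : IsFiltration Ω T ε K a u) {κ : ℝ} (hκ : 0 < κ) :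
    ∃ δ > 0, ∀ x ∈ Ω, ∀ s ∈ Icc 0 T, ∀ r ∈ Icc 0 T, |s - r| < δ →
      a (u x s) ≤ (1 + κ) * a (u x r) := by
  have hpos : ∀ z ∈ closure Ω ×ˢ Icc 0 T, 0 < a (u z.1 z.2) := fun z hz =>
    hu.coeff_pos _ (hu.pos hz.1 hz.2)
  have h1 := (hu.isCompact_closure.prod isCompact_Icc).uniformContinuousOn_of_continuous
    (hu.continuousOn_coeff.log fun z hz => (hpos z hz).ne')
  obtain ⟨δ, hδ, h2⟩ := Metric.uniformContinuousOn_iff.1 h1 (Real.log (1 + κ))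
    (Real.log_pos (by linarith))
  refine ⟨δ, hδ, fun x hx s hs r hr hsr => ?_⟩
  have hxs : (x, s) ∈ closure Ω ×ˢ Icc 0 T := ⟨subset_closure hx, hs⟩
  have hxr : (x, r) ∈ closure Ω ×ˢ Icc 0 T := ⟨subset_closure hx, hr⟩
  have h3 := h2 (x, s) hxs (x, r) hxr (by
    rw [Prod.dist_eq, dist_self, Real.dist_eq]; exact max_lt hδ hsr)
  rw [Real.dist_eq] at h3
  have h4 := (le_abs_self _).trans h3.le
  have p1 : 0 < a (u x s) := hpos _ hxs
  have p2 : 0 < a (u x r) := hpos _ hxr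
  rw [← Real.log_le_log_iff p1 (by positivity), Real.log_mul (by positivity) p2.ne']
  linarith

/-- The Cauchy-Schwarz inequality in time, with the coefficient frozen at time `s`. -/
lemma coeff_mul_sq_sub_le (hu : IsFiltration Ω T ε K a u) {κ : ℝ} (hκ : 0 ≤ κ) {s t η : ℝ}
    (hs : 0 < s) (hst : s ≤ t) (ht : t ≤ T) (hη : t - s ≤ η) {x : EuclideanSpace ℝ (Fin N)}
    (hx : x ∈ Ω) (hosc : ∀ r ∈ Icc s t, a (u x s) ≤ (1 + κ) * a (u x r)) :
    ENNReal.ofReal (a (u x s) * (u x t - u x s) ^ 2)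
      ≤ ENNReal.ofReal (η * (1 + κ))
        * ∫⁻ r in Ioc s t, ENNReal.ofReal (a (u x r) * timeDeriv T u x r ^ 2) := by
  have hxc := subset_closure hx
  have hsub : Icc s t ⊆ Icc 0 T := Icc_subset_Icc hs.le ht
  have hline : Continuous fun r : ℝ => (x, r) := by fun_prop
  have htc : ContinuousOn (fun r => timeDeriv T u x r) (Icc s t) :=
    hu.regular.continuous_time.comp hline.continuousOn
      fun r hr => ⟨hx, hs.trans_le hr.1, hr.2.trans ht⟩
  have hac : ContinuousOn (fun r => a (u x r)) (Icc s t) :=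
    hu.continuousOn_coeff.comp hline.continuousOn fun r hr => ⟨hxc, hsub hr⟩
  have ha0 : ∀ r ∈ Icc s t, 0 < a (u x r) := fun r hr => hu.coeff_pos _ (hu.pos hxc (hsub hr))
  have has := ha0 s ⟨le_rfl, hst⟩
  have i1 : IntegrableOn (fun r => timeDeriv T u x r ^ 2) (Ioc s t) :=
    ((htc.pow 2).integrableOn_compact isCompact_Icc).mono_set Ioc_subset_Icc_self
  have i2 : IntegrableOn (fun r => a (u x r) * timeDeriv T u x r ^ 2) (Ioc s t) :=
    ((hac.mul (htc.pow 2)).integrableOn_compact isCompact_Icc).mono_set Ioc_subset_Icc_self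
  have h0 : ∀ r ∈ Ioc s t, 0 ≤ a (u x r) * timeDeriv T u x r ^ 2 := fun r hr =>
    mul_nonneg (ha0 r (Ioc_subset_Icc_self hr)).le (sq_nonneg _)
  have h1 := sq_sub_le_mul_integral_sq hst ((hu.continuousOn_time hxc).mono hsub)
    (fun r hr => hu.hasDerivAt hx ⟨hs.trans hr.1, hr.2.trans_le ht⟩) htc
  rw [← ofReal_integral_eq_lintegral_ofReal i2 ((ae_restrict_mem measurableSet_Ioc).mono h0),
    ← ENNReal.ofReal_mul (mul_nonneg (by linarith) (by linarith))]
  refine ENNReal.ofReal_le_ofReal ?_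
  have hI : 0 ≤ ∫ r in Ioc s t, timeDeriv T u x r ^ 2 := integral_nonneg fun r => sq_nonneg _
  calc a (u x s) * (u x t - u x s) ^ 2
      ≤ a (u x s) * (η * ∫ r in Ioc s t, timeDeriv T u x r ^ 2) := by
        refine mul_le_mul_of_nonneg_left (h1.trans ?_) has.le
        exact mul_le_mul_of_nonneg_right hη hI
    _ = η * ∫ r in Ioc s t, a (u x s) * timeDeriv T u x r ^ 2 := by
        rw [integral_const_mul]; ring
    _ ≤ η * ∫ r in Ioc s t, (1 + κ) * (a (u x r) * timeDeriv T u x r ^ 2) := by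
        refine mul_le_mul_of_nonneg_left ?_ (by linarith)
        refine setIntegral_mono_on (i1.const_mul _) (i2.const_mul _) measurableSet_Ioc fun r hr => ?_
        rw [← mul_assoc]
        exact mul_le_mul_of_nonneg_right (hosc r (Ioc_subset_Icc_self hr)) (sq_nonneg _)
    _ = _ := by rw [integral_const_mul]; ring

lemma aemeasurable_dissipation (hu : IsFiltration Ω T ε K a u) {s t : ℝ} (hs : 0 ≤ s) (ht : t ≤ T) :
    AEMeasurable (fun z : EuclideanSpace ℝ (Fin N) × ℝ =>
      ENNReal.ofReal (a (u z.1 z.2) * timeDeriv T u z.1 z.2 ^ 2))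
      ((volume.restrict Ω).prod (volume.restrict (Ioc s t))) := by
  have hsub : Ω ×ˢ Ioc s t ⊆ Ω ×ˢ Ioc 0 T := prod_mono subset_rfl (Ioc_subset_Ioc hs ht)
  rw [Measure.prod_restrict]
  refine ENNReal.measurable_ofReal.comp_aemeasurable (ContinuousOn.aestronglyMeasurable ?_
    (hu.isOpen.measurableSet.prod measurableSet_Ioc)).aemeasurable
  exact (hu.continuousOn_coeff.mono ((prod_subset Ω T).trans' hsub)).mul
    ((hu.regular.continuous_time.mono hsub).pow 2)

/-- The other half of the energy identity, away from the initial time. -/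
theorem energy_le_add_dissipation_of_pos (hu : IsFiltration Ω T ε K a u)
    (hg : HasWeakGradient Ω (fun x => u x 0) Dg) {t τ : ℝ} (ht : 0 < t) (htτ : t ≤ τ) (hτ : τ ≤ T) :
    energy Ω u Dg t ≤ energy Ω u Dg τ
      + 2 * ∫⁻ s in Ioc 0 τ, ∫⁻ x in Ω, ENNReal.ofReal (a (u x s) * timeDeriv T u x s ^ 2) := by
  have hT0 : (0 : ℝ) ≤ T := ht.le.trans (htτ.trans hτ)
  have hanti := hu.energy_antitoneOn hg
  have hE0 : energy Ω u Dg 0 ≠ ⊤ := by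
    rw [energy_zero, lintegral_enorm_sq_eq hg.memLp]; exact ENNReal.ofReal_ne_top
  have hEtop : ∀ r ∈ Icc 0 T, energy Ω u Dg r ≠ ⊤ := fun r hr =>
    ne_top_of_le_ne_top hE0 (hanti ⟨le_rfl, hT0⟩ hr hr.1)
  set B : ℝ → ℝ≥0∞ := fun s => ∫⁻ x in Ω, ENNReal.ofReal (a (u x s) * timeDeriv T u x s ^ 2) with hB
  have hBm : AEMeasurable B (volume.restrict (Ioc 0 τ)) :=
    (hu.aemeasurable_dissipation le_rfl hτ).lintegral_prod_left'
  set D := ∫⁻ s in Ioc 0 τ, B s with hD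
  have hDtop : D ≠ ⊤ := by
    intro h
    have h1 := hu.dissipation_add_energy_le hg ⟨ht.trans_le htτ, hτ⟩
    rw [show (∫⁻ s in Ioc 0 τ, ∫⁻ x in Ω, ENNReal.ofReal (a (u x s) * timeDeriv T u x s ^ 2)) = ⊤
      from h, ENNReal.mul_top (by simp), top_add, top_le_iff] at h1
    exact hE0 h1
  have key : ∀ κ : ℝ, 0 < κ → energy Ω u Dg t ≤ energy Ω u Dg τ + ENNReal.ofReal (2 + κ) * D := by
    intro κ hκ
    obtain ⟨δ, hδ, hosc⟩ := hu.exists_coeff_le hκ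
    set η := min t (δ / 2) with hη
    have hη0 : 0 < η := lt_min ht (by linarith)
    have hηδ : η < δ := (min_le_right _ _).trans_lt (by linarith)
    have hηt : η ≤ t := min_le_left _ _
    have hητ : η ≤ τ := hηt.trans htτ
    refine (hanti ⟨hη0.le, hητ.trans hτ⟩ ⟨ht.le, htτ.trans hτ⟩ hηt).trans ?_
    have hantiτ : AntitoneOn (energy Ω u Dg) (Ioc 0 τ) :=
      hanti.mono fun r hr => ⟨hr.1.le, hr.2.trans hτ⟩
    refine le_add_of_lintegral_shift_le hη0 hητ hantiτ ?_ ?_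
    · refine ne_top_of_le_ne_top (b := ∫⁻ _ in Ioc 0 τ, energy Ω u Dg 0) ?_ ?_
      · rw [setLIntegral_const, Real.volume_Ioc]; exact ENNReal.mul_ne_top hE0 ENNReal.ofReal_ne_top
      · exact setLIntegral_mono' measurableSet_Ioc fun r hr =>
          hanti ⟨le_rfl, hT0⟩ ⟨hr.1.le, hr.2.trans hτ⟩ hr.1.le
    have hslice : ∀ s ∈ Ioc 0 τ, energy Ω u Dg s ≤ energy Ω u Dg (min (s + η) τ)
        + (ENNReal.ofReal η * B s
          + ENNReal.ofReal (1 + κ) * ∫⁻ r in Ioc s (min (s + η) τ), B r) := by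
      intro s hs
      set q := min (s + η) τ with hq
      have hsq : s ≤ q := le_min (by linarith) hs.2
      have hqT : q ≤ T := (min_le_right _ _).trans hτ
      have hqs : q - s ≤ η := by linarith [min_le_left (s + η) τ]
      have hsT : s ∈ Ioc 0 T := ⟨hs.1, hs.2.trans hτ⟩
      have hqT' : q ∈ Ioc 0 T := ⟨hs.1.trans_le hsq, hqT⟩
      refine (hu.energy_le_add_dissipation hsT hqT' (hEtop s (Ioc_subset_Icc_self hsT))
        (hEtop q (Ioc_subset_Icc_self hqT')) hη0).trans ?_
      refine add_le_add le_rfl (add_le_add le_rfl ?_)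
      have hm := hu.aemeasurable_dissipation hs.1.le hqT
      calc ENNReal.ofReal η⁻¹ * ∫⁻ x in Ω, ENNReal.ofReal (a (u x s) * (u x q - u x s) ^ 2)
          ≤ ENNReal.ofReal η⁻¹ * ∫⁻ x in Ω, ENNReal.ofReal (η * (1 + κ))
              * ∫⁻ r in Ioc s q, ENNReal.ofReal (a (u x r) * timeDeriv T u x r ^ 2) := by
            gcongr 1
            refine setLIntegral_mono' hu.isOpen.measurableSet fun x hx => ?_
            refine hu.coeff_mul_sq_sub_le hκ.le hs.1 hsq hqT hqs hx fun r hr => ?_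
            refine hosc x hx s (Ioc_subset_Icc_self hsT) r
              ⟨hs.1.le.trans hr.1, hr.2.trans hqT⟩ ?_
            rw [abs_sub_lt_iff]
            constructor <;> linarith [hr.1, hr.2]
        _ = ENNReal.ofReal (1 + κ) * ∫⁻ x in Ω,
              ∫⁻ r in Ioc s q, ENNReal.ofReal (a (u x r) * timeDeriv T u x r ^ 2) := by
            rw [lintegral_const_mul' _ _ ENNReal.ofReal_ne_top, ← mul_assoc,
              ← ENNReal.ofReal_mul (inv_nonneg.2 hη0.le), inv_mul_cancel_left₀ hη0.ne']
        _ = _ := by rw [lintegral_lintegral_swap hm]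
    have hmono : AEMeasurable (fun s => energy Ω u Dg (min (s + η) τ)) (volume.restrict (Ioc 0 τ)) := by
      refine aemeasurable_restrict_of_antitoneOn measurableSet_Ioc fun r hr s hs hrs => ?_
      have hm : ∀ r ∈ Ioc 0 τ, min (r + η) τ ∈ Icc 0 T := fun r hr =>
        ⟨le_min (by linarith [hr.1]) (hr.1.le.trans hr.2), (min_le_right _ _).trans hτ⟩
      exact hanti (hm r hr) (hm s hs) (by gcongr)
    calc ∫⁻ s in Ioc 0 τ, energy Ω u Dg s
        ≤ ∫⁻ s in Ioc 0 τ, (energy Ω u Dg (min (s + η) τ) + (ENNReal.ofReal η * B s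
          + ENNReal.ofReal (1 + κ) * ∫⁻ r in Ioc s (min (s + η) τ), B r)) :=
          setLIntegral_mono' measurableSet_Ioc hslice
      _ = (∫⁻ s in Ioc 0 τ, energy Ω u Dg (min (s + η) τ)) + (ENNReal.ofReal η * D
          + ENNReal.ofReal (1 + κ) * ∫⁻ s in Ioc 0 τ, ∫⁻ r in Ioc s (min (s + η) τ), B r) := by
          rw [lintegral_add_left' hmono, lintegral_add_left' (hBm.const_mul _),
            lintegral_const_mul' _ _ ENNReal.ofReal_ne_top,
            lintegral_const_mul' _ _ ENNReal.ofReal_ne_top]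
      _ ≤ (∫⁻ s in Ioc 0 τ, energy Ω u Dg (min (s + η) τ)) + (ENNReal.ofReal η * D
          + ENNReal.ofReal (1 + κ) * (ENNReal.ofReal η * D)) := by
          gcongr; exact lintegral_lintegral_Ioc_add_le hBm
      _ = (∫⁻ s in Ioc 0 τ, energy Ω u Dg (min (s + η) τ))
          + ENNReal.ofReal η * (ENNReal.ofReal (2 + κ) * D) := by
          have h2 : ENNReal.ofReal (2 + κ) = 1 + ENNReal.ofReal (1 + κ) := by
            rw [← ENNReal.ofReal_one, ← ENNReal.ofReal_add zero_le_one (by linarith)]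
            congr 1; ring
          rw [h2]
          ring
  have hlim : Tendsto (fun κ : ℝ => energy Ω u Dg τ + ENNReal.ofReal (2 + κ) * D) (𝓝[>] 0)
      (𝓝 (energy Ω u Dg τ + 2 * D)) := by
    refine Tendsto.const_add _ (ENNReal.Tendsto.mul_const ?_ (Or.inr hDtop))
    have h1 : Tendsto (fun κ : ℝ => 2 + κ) (𝓝[>] 0) (𝓝 (2 + 0)) :=
      ((continuous_const.add continuous_id).tendsto (0 : ℝ)).mono_left nhdsWithin_le_nhds
    simpa using ENNReal.tendsto_ofReal h1
  refine ge_of_tendsto hlim ?_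
  filter_upwards [self_mem_nhdsWithin] with κ hκ using key κ hκ

end IsFiltration
end Flow

/-! ### The energy identity up to the initial time -/

section Flow

variable {N : ℕ} {Ω : Set (EuclideanSpace ℝ (Fin N))} {T ε K : ℝ} {a : ℝ → ℝ}
  {u : EuclideanSpace ℝ (Fin N) → ℝ → ℝ}
  {Dg : EuclideanSpace ℝ (Fin N) → EuclideanSpace ℝ (Fin N)}

namespace IsFiltration

/-- A bound for the energy at positive times persists at the initial time: `u(0) - u(t)` tends to
zero uniformly, and extended by zero it has a square integrable weak gradient on the whole space. -/
lemma energy_zero_le (hu : IsFiltration Ω T ε K a u) (hg : HasWeakGradient Ω (fun x => u x 0) Dg)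
    {τ : ℝ} (hτ : τ ∈ Ioc 0 T) {M : ℝ≥0∞} (hM : ∀ t ∈ Ioc 0 τ, energy Ω u Dg t ≤ M) :
    energy Ω u Dg 0 ≤ M := by
  rcases eq_or_ne M ⊤ with rfl | hMtop
  · exact le_top
  have hΩm := hu.isOpen.measurableSet
  have hT0 : (0 : ℝ) ≤ T := hτ.1.le.trans hτ.2
  have hfin : IsFiniteMeasure (volume.restrict Ω) := ⟨by simpa using hu.volume_lt_top⟩
  have huc := (hu.isCompact_closure.prod
    (isCompact_Icc (a := 0) (b := T))).uniformContinuousOn_of_continuous hu.continuous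
  have hex : ∀ n : ℕ, ∃ t ∈ Ioc 0 τ, ∀ x ∈ Ω, |u x 0 - u x t| ≤ 1 / ((n : ℝ) + 1) := by
    intro n
    obtain ⟨δ, hδ, h⟩ := Metric.uniformContinuousOn_iff.1 huc (1 / ((n : ℝ) + 1)) (by positivity)
    have ht0 : 0 < min τ (δ / 2) := lt_min hτ.1 (by linarith)
    refine ⟨min τ (δ / 2), ⟨ht0, min_le_left _ _⟩, fun x hx => ?_⟩
    have h1 := h (x, 0) ⟨subset_closure hx, le_rfl, hT0⟩ (x, min τ (δ / 2))
      ⟨subset_closure hx, ht0.le, (min_le_left _ _).trans hτ.2⟩ (by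
        rw [Prod.dist_eq, dist_self, Real.dist_eq, zero_sub, abs_neg, abs_of_pos ht0]
        exact max_lt hδ ((min_le_right _ _).trans_lt (by linarith)))
    exact h1.le
  choose t ht htc using hex
  have htT : ∀ n, t n ∈ Ioc 0 T := fun n => ⟨(ht n).1, (ht n).2.trans hτ.2⟩
  have hE : ∀ n, ∫⁻ x in Ω, ‖spaceGrad u x (t n)‖ₑ ^ 2 ≤ M := fun n => by
    have := hM (t n) (ht n); rwa [energy_of_pos (ht n).1] at this
  have hX : ∀ n, HasWeakGradient Ω (fun x => u x (t n)) fun x => spaceGrad u x (t n) := fun n =>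
    hu.hasWeakGradient (htT n) (ne_top_of_le_ne_top hMtop (hE n))
  have hnorm : ∀ Y : EuclideanSpace ℝ (Fin N) → EuclideanSpace ℝ (Fin N),
      ∫⁻ x, ‖Ω.indicator Y x‖ₑ ^ 2 = ∫⁻ x in Ω, ‖Y x‖ₑ ^ 2 := by
    intro Y
    rw [← lintegral_indicator hΩm]
    refine lintegral_congr fun x => ?_
    by_cases hx : x ∈ Ω <;> simp [hx]
  have hsub : ∀ n, (fun x => Ω.indicator Dg x - Ω.indicator (fun x => spaceGrad u x (t n)) x)
      = Ω.indicator fun x => Dg x - spaceGrad u x (t n) := fun n => by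
    ext1 x; by_cases hx : x ∈ Ω <;> simp [hx]
  have hDg : MemLp Dg 2 (volume.restrict Ω) := hg.memLp
  rw [energy_zero, ← hnorm]
  refine lintegral_enorm_sq_le_of_isZeroTrace (μ := volume) hu.isOpen
    (X := fun n => Ω.indicator fun x => spaceGrad u x (t n))
    (w := fun n => Ω.indicator fun x => u x 0 - u x (t n)) (c := fun n => 1 / ((n : ℝ) + 1))
    ((memLp_indicator_iff_restrict hΩm).2 hDg)
    (fun n => (memLp_indicator_iff_restrict hΩm).2 (hX n).memLp) (fun n => ?_) (fun n => ?_)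
    (fun n x => ?_) tendsto_one_div_add_atTop_nhds_zero_nat fun n => ?_
  · rw [hsub]
    exact hu.isZeroTrace_sub (Ioc_subset_Icc_self (htT n)) ⟨le_rfl, hT0⟩ (hX n)
      (IntegrableOn.locallyIntegrableOn (hDg.integrable (by simp))) hg.weak
  · rw [hsub, integrable_indicator_iff hΩm]
    exact (hDg.sub (hX n).memLp).integrable (by simp)
  · by_cases hx : x ∈ Ω
    · rw [indicator_of_mem hx]; exact htc n x hx
    · rw [indicator_of_notMem hx, abs_zero]; positivity
  · rw [hnorm]; exact hE n

/-- The energy identity. -/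
theorem dissipation_add_energy_eq (hu : IsFiltration Ω T ε K a u)
    (hg : HasWeakGradient Ω (fun x => u x 0) Dg) {τ : ℝ} (hτ : τ ∈ Ioc 0 T) :
    2 * (∫⁻ s in Ioc 0 τ, ∫⁻ x in Ω, ENNReal.ofReal (a (u x s) * timeDeriv T u x s ^ 2))
      + energy Ω u Dg τ = energy Ω u Dg 0 := by
  refine le_antisymm (hu.dissipation_add_energy_le hg hτ) ?_
  rw [add_comm]
  exact hu.energy_zero_le hg hτ fun t ht =>
    hu.energy_le_add_dissipation_of_pos hg ht.1 ht.2 hτ.2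

end IsFiltration
end Flow

/-! ### Measure of the boundary and the a priori bound -/

section Boundary

variable {m : ℕ}

/-- Deletion of the first coordinate. -/
noncomputable def dropFirst (x : EuclideanSpace ℝ (Fin (m + 1))) : EuclideanSpace ℝ (Fin m) :=
  WithLp.toLp 2 fun i => x i.succ

lemma lipschitzWith_dropFirst : LipschitzWith 1 (dropFirst (m := m)) := by
  refine LipschitzWith.mk_one fun x y => ?_
  rw [EuclideanSpace.dist_eq, EuclideanSpace.dist_eq, Fin.sum_univ_succ]
  refine Real.sqrt_le_sqrt ?_
  simp only [dropFirst]
  exact le_add_of_nonneg_left (by positivity)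

/-- The boundary of a nonempty bounded open set has positive surface measure: its projection to a
hyperplane contains a ball, because every line through a ball inside the set leaves the set. -/
lemma euclideanHausdorffMeasure_frontier_pos {Ω : Set (EuclideanSpace ℝ (Fin (m + 1)))}
    (ho : IsOpen Ω) (hne : Ω.Nonempty) (hb : Bornology.IsBounded Ω) :
    0 < (μHE[m] : Measure (EuclideanSpace ℝ (Fin (m + 1)))) (frontier Ω) := by
  obtain ⟨x₀, hx₀⟩ := hne
  obtain ⟨r, hr, hball⟩ := Metric.isOpen_iff.1 ho x₀ hx₀
  obtain ⟨R, hR⟩ := hb.subset_ball 0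
  have hsub : Metric.ball (dropFirst x₀) r ⊆ dropFirst '' frontier Ω := by
    intro y hy
    set p : EuclideanSpace ℝ (Fin (m + 1)) := WithLp.toLp 2 (Fin.cons (x₀ 0) y) with hp
    have hpΩ : p ∈ Ω := by
      refine hball ?_
      rw [Metric.mem_ball] at hy ⊢
      refine lt_of_eq_of_lt ?_ hy
      rw [EuclideanSpace.dist_eq, EuclideanSpace.dist_eq, Fin.sum_univ_succ]
      simp [hp, dropFirst]
    set line : ℝ → EuclideanSpace ℝ (Fin (m + 1)) := fun t => p + t • EuclideanSpace.single 0 1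
      with hline
    have hc : Continuous line := by fun_prop
    have hout : line (R + ‖p‖) ∉ Ω := by
      intro h
      have h1 := hR h
      have h2 := hR hpΩ
      rw [mem_ball_zero_iff] at h1 h2
      have h3 : ‖(R + ‖p‖) • (EuclideanSpace.single 0 1 : EuclideanSpace ℝ (Fin (m + 1)))‖
          ≤ ‖line (R + ‖p‖)‖ + ‖p‖ := by
        have := norm_sub_le (line (R + ‖p‖)) p
        simpa [hline] using this
      rw [norm_smul, PiLp.norm_single, norm_one, mul_one, Real.norm_eq_abs] at h3
      linarith [le_abs_self (R + ‖p‖)]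
    obtain ⟨t, ht⟩ := (nonempty_frontier_iff (s := line ⁻¹' Ω)).2
      ⟨⟨0, show line 0 ∈ Ω by simpa [hline] using hpΩ⟩,
        fun h => hout (show R + ‖p‖ ∈ line ⁻¹' Ω by rw [h]; exact mem_univ _)⟩
    refine ⟨_, hc.frontier_preimage_subset Ω ht, ?_⟩
    ext i
    simp [dropFirst, hline, hp]
  have h1 : (μHE[m] : Measure (EuclideanSpace ℝ (Fin m))) (dropFirst '' frontier Ω)
      ≤ μHE[m] (frontier Ω) := by
    have := lipschitzWith_dropFirst.hausdorffMeasure_image_le (d := m) (by positivity) (frontier Ω)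
    rw [ENNReal.coe_one, ENNReal.one_rpow, one_mul] at this
    simp only [Measure.euclideanHausdorffMeasure_def, Measure.smul_apply]
    gcongr
  refine lt_of_lt_of_le ?_ ((measure_mono hsub).trans h1)
  rw [EuclideanSpace.euclideanHausdorffMeasure_eq_volume]
  exact Metric.measure_ball_pos _ _ hr

end Boundary

section Solution

variable {N : ℕ} {Ω : Set (EuclideanSpace ℝ (Fin N))} {T ε K : ℝ} {h P : ℝ → ℝ}
  {u : EuclideanSpace ℝ (Fin N) → ℝ → ℝ} {g ψ : EuclideanSpace ℝ (Fin N) → ℝ}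
  {Dg : EuclideanSpace ℝ (Fin N) → EuclideanSpace ℝ (Fin N)}

/-- The coefficient `a = h / (F + ε)` that the equation acquires when it is written as
`a(u) ∂ₜu = Δu`. -/
noncomputable def filtrationCoeff (h P : ℝ → ℝ) (ε s : ℝ) : ℝ := h s / (coeffF h P s + ε)

namespace Admissible

lemma coeffF_pos (hP : Admissible h P) {s : ℝ} (hs : 0 < s) : 0 < coeffF h P s :=
  mul_pos (hP.h_pos s hs) (hP.P_pos s hs)

lemma filtrationCoeff_pos (hP : Admissible h P) (hε : 0 < ε) {s : ℝ} (hs : 0 < s) :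
    0 < filtrationCoeff h P ε s :=
  div_pos (hP.h_pos s hs) (by linarith [hP.coeffF_pos hs])

lemma continuousOn_filtrationCoeff (hP : Admissible h P) (hε : 0 < ε) :
    ContinuousOn (filtrationCoeff h P ε) (Ioi 0) := by
  refine hP.h_continuous.div ?_ fun s hs => by
    have := hP.coeffF_pos (show 0 < s from hs); linarith
  exact (hP.h_continuous.mul (hP.P_continuous.mono Ioi_subset_Ici_self)).add continuousOn_const

lemma hasDerivAt_primH (hP : Admissible h P) {p : ℝ} (hp : 0 < p) :
    HasDerivAt (primH h) (h p) p := by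
  refine intervalIntegral.integral_hasDerivAt_right ?_
    (hP.h_continuous.stronglyMeasurableAtFilter isOpen_Ioi _ hp)
    (hP.h_continuous.continuousAt (Ioi_mem_nhds hp))
  obtain ⟨S, hS, hi⟩ := hP.h_integrable
  obtain ⟨δ, hδ, hsub⟩ := mem_nhdsGT_iff_exists_Ioo_subset.1 hS
  have hδ : 0 < δ := hδ
  rw [intervalIntegrable_iff_integrableOn_Ioc_of_le hp.le]
  have h2 : IntegrableOn h (Icc (δ / 2) p) :=
    (hP.h_continuous.mono fun s hs => (half_pos hδ).trans_le hs.1).integrableOn_compact isCompact_Icc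
  refine ((hi.mono_set hsub).union h2).mono_set fun s hs => ?_
  rcases lt_or_ge s δ with hlt | hge
  · exact Or.inl ⟨hs.1, hlt⟩
  · exact Or.inr ⟨by linarith, hs.2⟩

lemma hasDerivAt_primHtilde (hP : Admissible h P) (hε : 0 < ε) {p : ℝ} (hp : 0 < p) :
    HasDerivAt (primHtilde h P ε) (Real.sqrt (filtrationCoeff h P ε p)) p := by
  have hc : ContinuousOn (fun s => Real.sqrt (filtrationCoeff h P ε s)) (Ioi 0) :=
    (hP.continuousOn_filtrationCoeff hε).sqrt
  exact intervalIntegral.integral_hasDerivAt_right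
    ((hc.mono (uIcc_subset_Ioi hε hp)).intervalIntegrable)
    (hc.stronglyMeasurableAtFilter isOpen_Ioi _ hp) (hc.continuousAt (Ioi_mem_nhds hp))

end Admissible

lemma IsC21.timeDeriv_comp (hu : IsC21 Ω T u) {x : EuclideanSpace ℝ (Fin N)} (hx : x ∈ Ω) {t : ℝ}
    (ht : t ∈ Ioc 0 T) {G : ℝ → ℝ} {G' : ℝ} (hG : HasDerivAt G G' (u x t)) :
    timeDeriv T (fun y s => G (u y s)) x t = G' * timeDeriv T u x t :=
  (hG.comp_hasDerivWithinAt t (hu.time x hx t ht).hasDerivWithinAt).derivWithin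
    (uniqueDiffOn_Ioc 0 T t ht)

namespace IsClassicalSolution

lemma mem_Icc_of_mem_closure (hu : IsClassicalSolution h P Ω T ε g ψ u) (hT : 0 < T)
    (hb : ∀ x ∈ Ω, ∀ t ∈ Ioc 0 T, ε ≤ u x t ∧ u x t ≤ K) {x : EuclideanSpace ℝ (Fin N)}
    (hx : x ∈ closure Ω) {t : ℝ} (ht : t ∈ Icc 0 T) : u x t ∈ Icc ε K := by
  have hcl : closure (Ω ×ˢ Ioc 0 T) = closure Ω ×ˢ Icc 0 T := by
    rw [closure_prod_eq, closure_Ioc hT.ne]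
  have hmaps : MapsTo (fun p : EuclideanSpace ℝ (Fin N) × ℝ => u p.1 p.2) (Ω ×ˢ Ioc 0 T) (Icc ε K) :=
    fun p hp => hb p.1 hp.1 p.2 hp.2
  have h1 := hmaps.closure_of_continuousOn (by rw [hcl]; exact hu.continuous)
  rw [hcl, isClosed_Icc.closure_eq] at h1
  exact h1 (show (x, t) ∈ closure Ω ×ˢ Icc 0 T from ⟨hx, ht⟩)

lemma boundary_eq (hu : IsClassicalSolution h P Ω T ε g ψ u) (hT : 0 < T)
    {x : EuclideanSpace ℝ (Fin N)} (hx : x ∈ frontier Ω) {t : ℝ} (ht : t ∈ Icc 0 T) :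
    u x t = ε * ψ x := by
  have hmaps : MapsTo (u x) (Ioc 0 T) {ε * ψ x} := fun t ht => hu.boundary x hx t ht
  have hc : ContinuousOn (u x) (Icc 0 T) :=
    hu.continuous.comp (by fun_prop : Continuous fun t : ℝ => (x, t)).continuousOn
      fun _ hr => ⟨hx.1, hr⟩
  have h1 := hmaps.closure_of_continuousOn (by rwa [closure_Ioc hT.ne])
  rw [closure_Ioc hT.ne, closure_singleton] at h1
  exact h1 ht

lemma isFiltration (hu : IsClassicalSolution h P Ω T ε g ψ u) (hP : Admissible h P) (hT : 0 < T)
    (hε : 0 < ε) (ho : IsOpen Ω) (hbd : Bornology.IsBounded Ω)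
    (hb : ∀ x ∈ Ω, ∀ t ∈ Ioc 0 T, ε ≤ u x t ∧ u x t ≤ K) :
    IsFiltration Ω T ε K (filtrationCoeff h P ε) u where
  isOpen := ho
  isBounded := hbd
  eps_pos := hε
  coeff_continuous := hP.continuousOn_filtrationCoeff hε
  coeff_pos _ hs := hP.filtrationCoeff_pos hε hs
  regular := hu.regular
  continuous := hu.continuous
  bounds _ hx _ ht := hu.mem_Icc_of_mem_closure hT hb hx ht
  equation x hx t ht := by
    have hpos : 0 < u x t := hε.trans_le (hb x hx t ht).1
    have hF : 0 < coeffF h P (u x t) + ε := by linarith [hP.coeffF_pos hpos]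
    have h1 := hu.equation x hx t ht
    rw [hu.regular.timeDeriv_comp hx ht (hP.hasDerivAt_primH hpos)] at h1
    rw [filtrationCoeff, div_mul_eq_mul_div, eq_div_iff hF.ne']
    linarith
  boundary x hx t ht := by
    rw [hu.boundary_eq hT hx ht, hu.boundary_eq hT hx ⟨le_rfl, hT.le⟩]

lemma enorm_timeDeriv_primHtilde_sq (hu : IsClassicalSolution h P Ω T ε g ψ u) (hP : Admissible h P)
    (hε : 0 < ε) {x : EuclideanSpace ℝ (Fin N)} (hx : x ∈ Ω) {t : ℝ} (ht : t ∈ Ioc 0 T)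
    (hpos : 0 < u x t) :
    ‖timeDeriv T (fun y s => primHtilde h P ε (u y s)) x t‖ₑ ^ 2
      = ENNReal.ofReal (filtrationCoeff h P ε (u x t) * timeDeriv T u x t ^ 2) := by
  rw [hu.regular.timeDeriv_comp hx ht (hP.hasDerivAt_primHtilde hε hpos), ← ofReal_norm,
    ← ENNReal.ofReal_pow (norm_nonneg _), Real.norm_eq_abs, sq_abs, mul_pow,
    Real.sq_sqrt (hP.filtrationCoeff_pos hε hpos).le]

lemma hasWeakGradient_initial (hu : IsClassicalSolution h P Ω T ε g ψ u) (hg : IsW12 Ω g Dg)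
    (ho : IsOpen Ω) (hbd : Bornology.IsBounded Ω) :
    HasWeakGradient Ω (fun x => u x 0) Dg where
  memLp := hg.memLp_grad
  weak φ hφ hφs hφΩ e := by
    have hfin : IsFiniteMeasure (volume.restrict Ω) := ⟨by simpa using hbd.measure_lt_top⟩
    have ig : IntegrableOn g Ω := hg.memLp.integrable (by simp)
    have iDg : IntegrableOn Dg Ω := hg.memLp_grad.integrable (by simp)
    have hfd : Continuous fun x => fderiv ℝ φ x e :=
      (hφ.continuous_fderiv (by simp)).clm_apply continuous_const
    have hgr : Continuous fun x => gradient φ x :=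
      (InnerProductSpace.toDual ℝ _).symm.continuous.comp (hφ.continuous_fderiv (by simp))
    have hgrs : HasCompactSupport fun x => gradient φ x :=
      (hφs.fderiv ℝ).comp_left (map_zero _)
    obtain ⟨C, hC⟩ := hgrs.exists_bound_of_continuous hgr
    obtain ⟨C', hC'⟩ := hφs.exists_bound_of_continuous hφ.continuous
    have i1 : IntegrableOn (fun x => g x • gradient φ x) Ω :=
      ig.smul_bdd C hgr.aestronglyMeasurable (ae_of_all _ hC)
    have i2 : IntegrableOn (fun x => φ x • Dg x) Ω :=
      iDg.bdd_smul C' hφ.continuous.aestronglyMeasurable (ae_of_all _ hC')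
    have ifd : Integrable (fun x => fderiv ℝ φ x e) :=
      hfd.integrable_of_hasCompactSupport (hasCompactSupport_fderiv_apply hφs e)
    have e1 : ∫ x in Ω, fderiv ℝ φ x e = 0 := by
      rw [setIntegral_eq_integral_of_forall_compl_eq_zero]
      · simpa using integral_fderiv_mul_of_contDiffOn (μ := volume) ho
          (contDiffOn_const (c := (1 : ℝ))) (hφ.of_le (by simp)) hφs hφΩ e
      · intro x hx
        exact image_eq_zero_of_notMem_tsupport (f := fun x => fderiv ℝ φ x e)
          fun h => hx (hφΩ (tsupport_fderiv_apply_subset ℝ e h))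
    have e2 : ∀ x, inner ℝ e (g x • gradient φ x) = fderiv ℝ φ x e * g x := fun x => by
      rw [real_inner_smul_right, real_inner_comm, inner_gradient_left, mul_comm]
    have e3 : ∀ x, inner ℝ e (φ x • Dg x) = φ x * inner ℝ (Dg x) e := fun x => by
      rw [real_inner_smul_right, real_inner_comm]
    have h1 := congrArg (inner ℝ e) (hg.weak_grad φ hφ hφs hφΩ)
    rw [inner_neg_right, ← integral_inner i1, ← integral_inner i2] at h1
    simp_rw [e2, e3] at h1
    have i3 : IntegrableOn (fun x => fderiv ℝ φ x e * g x) Ω := by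
      refine (i1.const_inner e).congr (ae_of_all _ e2)
    rw [← h1, setIntegral_congr_fun (g := fun x => ε * fderiv ℝ φ x e + fderiv ℝ φ x e * g x)
      ho.measurableSet fun x hx => by simp only [hu.initial x hx]; ring,
      integral_add (ifd.integrableOn.const_mul _) i3, integral_const_mul, e1, mul_zero, zero_add]

end IsClassicalSolution

end Solution

/-- The a priori bound, deduced from the energy identity. The last term of the left side is
controlled by the boundary integral because `ψ ≥ 1` on the boundary, where `ε ψ = u ≥ ε`. -/
lemma add_add_le_of_energy_identity {N : ℕ} {Ω : Set (EuclideanSpace ℝ (Fin N))}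
    (hΩ : MeasurableSet Ω) {T K c : ℝ} {v : EuclideanSpace ℝ (Fin N) → ℝ → ℝ}
    {ψ : EuclideanSpace ℝ (Fin N) → ℝ} {D E₀ : ℝ≥0∞} {E : ℝ → ℝ≥0∞}
    {σ : Measure (EuclideanSpace ℝ (Fin N))} (hK : 0 < K) (hD : D ≤ E₀)
    (hE : ∀ t ∈ Ioc 0 T, E t ≤ E₀) (hv : ∀ t ∈ Ioc 0 T, ∀ x ∈ Ω, |v x t| ≤ K)
    (hψ : ∀ x ∈ frontier Ω, 1 ≤ ψ x) (hσ : σ (frontier Ω) ≠ 0) (hvol : volume Ω ≠ ⊤)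
    (hc : 1 + T + (ENNReal.ofReal T * volume Ω / σ (frontier Ω)).toReal ≤ c) (hT : 0 < T) :
    D + (∫⁻ t in Ioc 0 T, E t) + (∫⁻ t in Ioc 0 T, ∫⁻ x in Ω, ‖v x t‖ₑ ^ 2)
      ≤ ENNReal.ofReal c
        * (E₀ + ENNReal.ofReal (K ^ 2) * ∫⁻ x in frontier Ω, ‖ψ x‖ₑ ^ 2 ∂σ) := by
  set A := σ (frontier Ω) with hA
  set V := ENNReal.ofReal T * volume Ω with hV
  set I := ∫⁻ x in frontier Ω, ‖ψ x‖ₑ ^ 2 ∂σ with hI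
  have hVtop : V / A ≠ ⊤ := ENNReal.div_ne_top (ENNReal.mul_ne_top ENNReal.ofReal_ne_top hvol) hσ
  have hc0 : 1 + ENNReal.ofReal T + V / A ≤ ENNReal.ofReal c := by
    rw [← ENNReal.ofReal_toReal hVtop, ← ENNReal.ofReal_one,
      ← ENNReal.ofReal_add zero_le_one hT.le, ← ENNReal.ofReal_add (by positivity) (by positivity)]
    exact ENNReal.ofReal_le_ofReal hc
  have hAI : A ≤ I := by
    calc A = ∫⁻ _ in frontier Ω, 1 ∂σ := by simp [hA]
      _ ≤ I := setLIntegral_mono' isClosed_frontier.measurableSet fun x hx => by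
        have h1 : (1 : ℝ≥0∞) ≤ ‖ψ x‖ₑ := by
          rw [← ofReal_norm, ENNReal.one_le_ofReal]
          exact (hψ x hx).trans (le_abs_self _)
        exact one_le_pow₀ h1
  have h1 : ∫⁻ t in Ioc 0 T, E t ≤ ENNReal.ofReal T * E₀ := by
    calc _ ≤ ∫⁻ _ in Ioc 0 T, E₀ := setLIntegral_mono' measurableSet_Ioc hE
      _ = _ := by rw [setLIntegral_const, Real.volume_Ioc, sub_zero, mul_comm]
  have h2 : ∫⁻ t in Ioc 0 T, ∫⁻ x in Ω, ‖v x t‖ₑ ^ 2 ≤ V * ENNReal.ofReal (K ^ 2) := by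
    calc _ ≤ ∫⁻ _ in Ioc 0 T, ENNReal.ofReal (K ^ 2) * volume Ω := by
          refine setLIntegral_mono' measurableSet_Ioc fun t ht => ?_
          rw [← setLIntegral_const]
          refine setLIntegral_mono' hΩ fun x hx => ?_
          rw [← ofReal_norm, ← ENNReal.ofReal_pow (norm_nonneg _)]
          refine ENNReal.ofReal_le_ofReal ?_
          have := hv t ht x hx
          rw [Real.norm_eq_abs]
          gcongr
      _ = _ := by rw [setLIntegral_const, Real.volume_Ioc, sub_zero, hV]; ring
  have h3 : V * ENNReal.ofReal (K ^ 2) ≤ ENNReal.ofReal c * (ENNReal.ofReal (K ^ 2) * I) := by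
    have hK2 : ENNReal.ofReal (K ^ 2) ≠ 0 := by simp; positivity
    rcases eq_or_ne A ⊤ with hAt | hAt
    · -- an infinite surface measure makes the right side infinite
      have hc1 : ENNReal.ofReal c ≠ 0 := by
        refine (lt_of_lt_of_le one_pos (le_trans ?_ hc0)).ne'
        rw [add_assoc]; exact le_self_add
      have hItop : I = ⊤ := top_le_iff.1 (hAt.symm.le.trans hAI)
      rw [hItop, ENNReal.mul_top hK2, ENNReal.mul_top hc1]
      exact le_top
    · calc V * ENNReal.ofReal (K ^ 2) = V / A * (ENNReal.ofReal (K ^ 2) * A) := by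
            rw [mul_comm (ENNReal.ofReal _) A, ← mul_assoc, ENNReal.div_mul_cancel hσ hAt]
        _ ≤ _ := by
            gcongr
            exact le_add_self.trans hc0
  calc _ ≤ E₀ + ENNReal.ofReal T * E₀ + ENNReal.ofReal c * (ENNReal.ofReal (K ^ 2) * I) := by
        gcongr; exact h2.trans h3
    _ = (1 + ENNReal.ofReal T) * E₀ + ENNReal.ofReal c * (ENNReal.ofReal (K ^ 2) * I) := by ring
    _ ≤ ENNReal.ofReal c * E₀ + ENNReal.ofReal c * (ENNReal.ofReal (K ^ 2) * I) := by
        gcongr; exact le_self_add.trans hc0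
    _ = _ := by ring

end DegenerateEinstein

theorem mainTheorem5 (N : ℕ) (hN : 1 ≤ N) (Ω : Set (EuclideanSpace ℝ (Fin N)))
    (hΩ_open : IsOpen Ω) (hΩ_conn : IsConnected Ω) (hΩ_bdd : Bornology.IsBounded Ω)
    (T : ℝ) (hT : 0 < T) :
    ∃ C : ℝ, 0 < C ∧
      ∀ (h P : ℝ → ℝ), DegenerateEinstein.Admissible h P →
      ∀ (ε K : ℝ), 0 < ε →
      ∀ (g ψ : EuclideanSpace ℝ (Fin N) → ℝ)
        (Dg : EuclideanSpace ℝ (Fin N) → EuclideanSpace ℝ (Fin N)),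
        DegenerateEinstein.IsW12 Ω g Dg →
        (∀ x ∈ Ω, 0 ≤ g x) → (∀ x ∈ frontier Ω, 0 ≤ ψ x) →
      ∀ u : EuclideanSpace ℝ (Fin N) → ℝ → ℝ,
        DegenerateEinstein.IsClassicalSolution h P Ω T ε g ψ u →
        (∀ x ∈ Ω, ∀ t ∈ Ioc 0 T, ε ≤ u x t ∧ u x t ≤ K) →
        (∀ τ ∈ Ioc 0 T,
          2 * (∫⁻ t in Ioc 0 τ, ∫⁻ x in Ω,
              ‖DegenerateEinstein.timeDeriv T
                (fun y s => DegenerateEinstein.primHtilde h P ε (u y s)) x t‖ₑ ^ 2)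
            + ∫⁻ x in Ω, ‖DegenerateEinstein.spaceGrad u x τ‖ₑ ^ 2
          = ∫⁻ x in Ω, ‖Dg x‖ₑ ^ 2) ∧
        (∫⁻ t in Ioc 0 T, ∫⁻ x in Ω,
              ‖DegenerateEinstein.timeDeriv T
                (fun y s => DegenerateEinstein.primHtilde h P ε (u y s)) x t‖ₑ ^ 2)
            + (∫⁻ t in Ioc 0 T, ∫⁻ x in Ω, ‖DegenerateEinstein.spaceGrad u x t‖ₑ ^ 2)
            + (∫⁻ t in Ioc 0 T, ∫⁻ x in Ω, ‖u x t‖ₑ ^ 2)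
          ≤ ENNReal.ofReal C *
            ((∫⁻ x in Ω, ‖Dg x‖ₑ ^ 2)
              + ENNReal.ofReal (K ^ 2) * ∫⁻ x in frontier Ω, ‖ψ x‖ₑ ^ 2 ∂μHE[N - 1]) := by
  have hΩm := hΩ_open.measurableSet
  have hσ : (μHE[N - 1] : Measure (EuclideanSpace ℝ (Fin N))) (frontier Ω) ≠ 0 := by
    obtain ⟨m, rfl⟩ : ∃ m, N = m + 1 := ⟨N - 1, by omega⟩
    exact (DegenerateEinstein.euclideanHausdorffMeasure_frontier_pos hΩ_open hΩ_conn.nonempty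
      hΩ_bdd).ne'
  -- the dissipation and the energy need `1 + T`; the last summand turns `T |Ω| K²` into a multiple of
  -- the boundary integral, and it is `0` if the boundary has infinite measure
  refine ⟨1 + T + (ENNReal.ofReal T * volume Ω / (μHE[N - 1] : Measure _) (frontier Ω)).toReal,
    by positivity, ?_⟩
  intro h P hP ε K hε g ψ Dg hg _ _ u hu hb
  have hf := hu.isFiltration hP hT hε hΩ_open hΩ_bdd hb
  have hw := hu.hasWeakGradient_initial hg hΩ_open hΩ_bdd
  have hdis : ∀ τ ∈ Ioc 0 T, ∫⁻ t in Ioc 0 τ, ∫⁻ x in Ω,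
      ‖DegenerateEinstein.timeDeriv T
        (fun y s => DegenerateEinstein.primHtilde h P ε (u y s)) x t‖ₑ ^ 2
      = ∫⁻ t in Ioc 0 τ, ∫⁻ x in Ω, ENNReal.ofReal
        (DegenerateEinstein.filtrationCoeff h P ε (u x t)
          * DegenerateEinstein.timeDeriv T u x t ^ 2) := fun τ hτ =>
    setLIntegral_congr_fun measurableSet_Ioc fun t ht => setLIntegral_congr_fun hΩm fun x hx => by
      have ht' : t ∈ Ioc 0 T := ⟨ht.1, ht.2.trans hτ.2⟩
      exact hu.enorm_timeDeriv_primHtilde_sq hP hε hx ht'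
        (hf.pos (subset_closure hx) (Ioc_subset_Icc_self ht'))
  have hid : ∀ τ ∈ Ioc 0 T,
      2 * (∫⁻ t in Ioc 0 τ, ∫⁻ x in Ω,
          ‖DegenerateEinstein.timeDeriv T
            (fun y s => DegenerateEinstein.primHtilde h P ε (u y s)) x t‖ₑ ^ 2)
        + ∫⁻ x in Ω, ‖DegenerateEinstein.spaceGrad u x τ‖ₑ ^ 2
      = ∫⁻ x in Ω, ‖Dg x‖ₑ ^ 2 := fun τ hτ => by
    rw [hdis τ hτ, ← DegenerateEinstein.energy_of_pos (Dg := Dg) hτ.1,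
      hf.dissipation_add_energy_eq hw hτ, DegenerateEinstein.energy_zero]
  refine ⟨hid, ?_⟩
  obtain ⟨x₀, hx₀⟩ := hΩ_conn.nonempty
  have hK : 0 < K := by
    have := hb x₀ hx₀ T ⟨hT, le_rfl⟩
    linarith
  refine DegenerateEinstein.add_add_le_of_energy_identity hΩm hK ?_
    (fun t ht => le_add_self.trans (hid t ht).le) (fun t ht x hx => ?_) (fun x hx => ?_) hσ
    hΩ_bdd.measure_lt_top.ne le_rfl hT
  · refine le_trans ?_ (le_self_add.trans (hid T ⟨hT, le_rfl⟩).le)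
    rw [two_mul]
    exact le_self_add
  · obtain ⟨h1, h2⟩ := hb x hx t ht
    rwa [abs_of_pos (hε.trans_le h1)]
  · have h1 := (hu.mem_Icc_of_mem_closure hT hb hx.1 ⟨hT.le, le_rfl⟩).1
    rw [hu.boundary x hx T ⟨hT, le_rfl⟩] at h1
    exact le_of_mul_le_mul_left (by linarith) hε
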